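/- Let $G(x,t)=\frac1{4\pi t}e^{-|x|^2/(4t)}$ be the Gauss kernel on $\mathbb R^2$ and, for a real tempered distribution $w\in\mathscr S'(\mathbb R^2)$ and $t>0$, let $(e^{t\Delta}w)(x)=\langle w,G(x-\cdot,t)\rangle$. Let $B\mathcal X$ be the space of all $w\in\mathscr S'(\mathbb R^2)$ with $$\|w\|_{B\mathcal X}=\sup_{t>0}t^{1/4}\|e^{t\Delta}w\|_{L^{4/3}(\mathbb R^2)}<\infty .$$ Consider the Debye--Nernst--Planck system $u_t=\Delta u+\nabla\cdot(u\nabla\phi_u)$, $\phi_u=-E_2*u$ in $\mathbb R^2$ with $u(0)=u_0$, where $E_2(z)=\frac1{2\pi}\log|z|$; for $u\in L^{4/3}(\mathbb R^2)$ the field $\nabla\phi_u$ is $-(\nabla E_2)*u$. A (global) mild solution is a function $u$ with values $u(t)\in L^{4/3}(\mathbb R^2)$, $t>0$, such that for all $t>0$ (almost everywhere in $\mathbb R^2$, with an absolutely convergent time integral) $$u(t)=e^{t\Delta}u_0+\int_0^t e^{(t-\tau)\Delta}\,\nabla\cdot(u\nabla\phi_u)(\tau)\,d\tau .$$ For given $u_0$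 let $\mathscr X$ be the set of all $u$ that are (strongly) measurable and bounded functions of $t>0$ with values in $B\mathcal X$, satisfy $\int_{\mathbb R^2} u(x,t)\psi(x)\,dx\to\langle u_0,\psi\rangle$ as $t\to0^+$ for all $\psi\in\mathscr S(\mathbb R^2)$, and are measurable functions from $(0,\infty)$ to $L^{4/3}(\mathbb R^2)$ with $\sup_{t>0}t^{1/4}\|u(t)\|_{4/3}<\infty$. There is $\varepsilon>0$ such that the following holds. (i) For every $u_0\in B\mathcal X$ with $\|u_0\|_{B\mathcal X}<\varepsilon$ the system has a global mild solution $u\in\mathscr X$ with initial datum $u_0$; it satisfies $\sup_{t>0}t^{1/4}\|u(t)\|_{4/3}<2\varepsilon$, and it is the only mild solution with initial datum $u_0$ among all measurable $v:(0,\infty)\to L^{4/3}(\mathbb R^2)$ with $\sup_{t>0}t^{1/4}\|v(t)\|_{4/3}<2\varepsilon$. (ii) Small atomic measures are admissible initial data, and only those with small atoms are: there is $\eta>0$ such that for all real $M_i$ with $\sum_{i\in\mathbb N}|M_i|<\infty$ and all points $x_i\in\mathbb R^2$ the measure $\mu=\sum_i M_i\delta_{x_i}$ satisfies $\|\mu\|_{B\mathcal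 X}<\varepsilon$ if $\sum_i|M_i|<\eta$; conversely, if the points $x_i$ are distinct and $\|\mu\|_{B\mathcal X}<\varepsilon$, then $|M_i|<\eta$ for every $i$. -/

import Mathlib

noncomputable section

namespace DebyeNernstPlanck

open MeasureTheory Filter Topology SchwartzMap
open scoped ENNReal

/-- The Euclidean plane. -/
abbrev Plane : Type := EuclideanSpace ℝ (Fin 2)

/-- Real tempered distributions on the plane: continuous linear functionals on the real Schwartz
space. -/
abbrev Distr : Type := 𝓢(Plane, ℝ) →L[ℝ] ℝ

instance factOneLeFourThirds : Fact ((1 : ℝ≥0∞) ≤ 4 / 3) :=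
  ⟨by
    rw [ENNReal.le_div_iff_mul_le (by simp) (by simp)]
    norm_num⟩

instance factOneLeFour : Fact ((1 : ℝ≥0∞) ≤ 4) := ⟨by norm_num⟩

instance holderFourThirdsFour : ENNReal.HolderTriple (4 / 3) 4 1 :=
  ⟨by
    rw [ENNReal.inv_div (by simp) (by simp), inv_one, div_eq_mul_inv]
    have h : (3 : ℝ≥0∞) * 4⁻¹ + 4⁻¹ = 4 * 4⁻¹ := by
      rw [show (4 : ℝ≥0∞) * 4⁻¹ = (3 + 1) * 4⁻¹ by norm_num, add_mul, one_mul]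
    rw [h]
    exact ENNReal.mul_inv_cancel (by simp) (by simp)⟩

/-- The Lebesgue space `L^{4/3}` of real functions on the plane. -/
abbrev L43 : Type := Lp ℝ (4 / 3 : ℝ≥0∞) (volume : Measure Plane)

/-! ### The Gauss kernel and the heat semigroup -/

/-- The Gauss kernel `G(x, t) = (4 π t)⁻¹ exp (-|x|² / 4t)` of the plane. -/
def gaussKernel (t : ℝ) (x : Plane) : ℝ :=
  1 / (4 * Real.pi * t) * Real.exp (-‖x‖ ^ 2 / (4 * t))

theorem gaussKernel_contDiff (t : ℝ) : ContDiff ℝ ((⊤ : ℕ∞) : WithTop ℕ∞) (gaussKernel t) := by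
  unfold gaussKernel
  exact contDiff_const.mul (((contDiff_norm_sq ℝ).neg.div_const _).exp)

theorem pow_mul_exp_bounded (c : ℝ) (hc : 0 < c) (m : ℕ) :
    ∃ K : ℝ, ∀ r : ℝ, 0 ≤ r → (1 + r) ^ m * Real.exp (-(c * r ^ 2)) ≤ K := by
  have hlim : Tendsto (fun s : ℝ => s ^ m * Real.exp (-c * s)) atTop (𝓝 0) := by
    simpa using tendsto_rpow_mul_exp_neg_mul_atTop_nhds_zero (m : ℝ) c hc
  have hbd : ∃ K : ℝ, ∀ s : ℝ, 0 ≤ s → s ^ m * Real.exp (-c * s) ≤ K := by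
    have hev : ∀ᶠ s : ℝ in atTop, s ^ m * Real.exp (-c * s) ≤ 1 :=
      (hlim.eventually (gt_mem_nhds zero_lt_one)).mono fun _ h => le_of_lt h
    obtain ⟨A, hA⟩ := eventually_atTop.1 hev
    obtain ⟨K, hK⟩ := (isCompact_Icc (a := (0 : ℝ)) (b := A)).bddAbove_image
      (f := fun s : ℝ => s ^ m * Real.exp (-c * s)) (by fun_prop)
    refine ⟨max K 1, fun s hs => ?_⟩
    rcases le_total s A with h | h
    · exact le_max_of_le_left (hK ⟨s, ⟨hs, h⟩, rfl⟩)
    · exact le_max_of_le_right (hA s h)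
  obtain ⟨K, hK⟩ := hbd
  refine ⟨K * Real.exp (c * 2), fun r hr => ?_⟩
  have h1 := hK (1 + r) (by linarith)
  have h2 : Real.exp (-(c * r ^ 2)) ≤ Real.exp (-c * (1 + r)) * Real.exp (c * 2) := by
    rw [← Real.exp_add]
    apply Real.exp_le_exp.2
    nlinarith [sq_nonneg (r - 1), mul_nonneg hc.le (sq_nonneg (r - 1 / 2))]
  calc (1 + r) ^ m * Real.exp (-(c * r ^ 2))
      ≤ (1 + r) ^ m * (Real.exp (-c * (1 + r)) * Real.exp (c * 2)) := by gcongr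
    _ = ((1 + r) ^ m * Real.exp (-c * (1 + r))) * Real.exp (c * 2) := by ring
    _ ≤ K * Real.exp (c * 2) := by gcongr

theorem exp_neg_sq_decay (c : ℝ) (hc : 0 < c) (k n : ℕ) :
    ∃ C : ℝ, ∀ x : Plane,
      ‖x‖ ^ k * ‖iteratedFDeriv ℝ n (fun y : Plane => Real.exp (-(c * ‖y‖ ^ 2))) x‖ ≤ C := by
  have htg : Function.HasTemperateGrowth (fun y : Plane => -(c * ‖y‖ ^ 2)) := by
    fun_prop
  obtain ⟨m, C₀, hC₀, hb⟩ := htg.norm_iteratedFDeriv_le_uniform n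
  obtain ⟨K, hK⟩ := pow_mul_exp_bounded c hc (k + m * n)
  refine ⟨n.factorial * (1 + C₀) ^ n * K, fun x => ?_⟩
  have h0 := norm_nonneg x
  have hbase : 1 ≤ (1 + C₀) * (1 + ‖x‖) ^ m :=
    one_le_mul_of_one_le_of_one_le (by linarith) (one_le_pow₀ (by linarith))
  have key : ‖iteratedFDeriv ℝ n (Real.exp ∘ fun y : Plane => -(c * ‖y‖ ^ 2)) x‖ ≤
      n.factorial * Real.exp (-(c * ‖x‖ ^ 2)) * ((1 + C₀) * (1 + ‖x‖) ^ m) ^ n := by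
    refine norm_iteratedFDeriv_comp_le (n := n) (N := (n : WithTop ℕ∞)) Real.contDiff_exp
      (htg.1.of_le (by exact_mod_cast le_top)) le_rfl x ?_ ?_
    · intro i _
      rw [norm_iteratedFDeriv_eq_norm_iteratedDeriv, iteratedDeriv_eq_iterate,
        Real.iter_deriv_exp, Real.norm_eq_abs, abs_of_pos (Real.exp_pos _)]
    · intro i hi1 hi2
      refine (hb i hi2 x).trans ?_
      refine le_trans ?_ (le_self_pow₀ hbase (by omega))
      gcongr
      linarith
  have key2 : ‖iteratedFDeriv ℝ n (fun y : Plane => Real.exp (-(c * ‖y‖ ^ 2))) x‖ ≤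
      n.factorial * Real.exp (-(c * ‖x‖ ^ 2)) * ((1 + C₀) * (1 + ‖x‖) ^ m) ^ n := key
  calc ‖x‖ ^ k * ‖iteratedFDeriv ℝ n (fun y : Plane => Real.exp (-(c * ‖y‖ ^ 2))) x‖
      ≤ (1 + ‖x‖) ^ k *
          (n.factorial * Real.exp (-(c * ‖x‖ ^ 2)) * ((1 + C₀) * (1 + ‖x‖) ^ m) ^ n) := by
        gcongr
        linarith
    _ = n.factorial * (1 + C₀) ^ n *
          ((1 + ‖x‖) ^ (k + m * n) * Real.exp (-(c * ‖x‖ ^ 2))) := by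
        rw [mul_pow, ← pow_mul, pow_add]; ring
    _ ≤ n.factorial * (1 + C₀) ^ n * K := by
        gcongr
        exact hK _ h0

/-- The function `y ↦ exp (-c |y|²)`, `c > 0`, as a Schwartz function. -/
def expNegSq (c : ℝ) (hc : 0 < c) : 𝓢(Plane, ℝ) where
  toFun y := Real.exp (-(c * ‖y‖ ^ 2))
  smooth' := (contDiff_const.mul (contDiff_norm_sq ℝ)).neg.exp
  decay' := exp_neg_sq_decay c hc

/-- For `t > 0` and a point `x`, the Schwartz function `y ↦ G(x - y, t)`
(see `heatTest_apply`). -/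
def heatTest (t : ℝ) (ht : 0 < t) (x : Plane) : 𝓢(Plane, ℝ) :=
  (1 / (4 * Real.pi * t)) •
    SchwartzMap.compSubConstCLM ℝ x (expNegSq (1 / (4 * t)) (by positivity))

theorem heatTest_apply (t : ℝ) (ht : 0 < t) (x y : Plane) :
    heatTest t ht x y = gaussKernel t (x - y) := by
  change 1 / (4 * Real.pi * t) * Real.exp (-(1 / (4 * t) * ‖y - x‖ ^ 2)) = _
  rw [gaussKernel, norm_sub_rev y x]
  congr 2
  ring

/-- The function `e^{tΔ} w`, for `t > 0` and a tempered distribution `w`: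
`(e^{tΔ} w)(x) = ⟨w, G(x - ·, t)⟩`. -/
def heat (t : ℝ) (ht : 0 < t) (w : Distr) (x : Plane) : ℝ :=
  w (heatTest t ht x)

/-! ### The homogeneous Besov-type space modelled on `L^{4/3}` -/

/-- `‖w‖_{BX} = sup_{t > 0} t^{1/4} ‖e^{tΔ} w‖_{4/3}`, with values in `[0, ∞]`.
The space `BX` consists of the tempered distributions for which this is finite. -/
def besovNorm (w : Distr) : ℝ≥0∞ :=
  ⨆ (t : ℝ) (ht : 0 < t),
    ENNReal.ofReal (t ^ (1 / 4 : ℝ)) * eLpNorm (heat t ht w) (4 / 3) volume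

/-- The tempered distribution `ψ ↦ ∫ f ψ` given by a function `f ∈ L^{4/3}`. -/
def toDistr (f : L43) : Distr :=
  (ContinuousLinearMap.mul ℝ ℝ).lpPairing volume (4 / 3) 4 f ∘L
    SchwartzMap.toLpCLM ℝ ℝ 4 volume

theorem toDistr_apply (f : L43) (ψ : 𝓢(Plane, ℝ)) :
    toDistr f ψ = ∫ x, f x * ψ x := by
  simp only [toDistr, ContinuousLinearMap.comp_apply, SchwartzMap.toLpCLM_apply,
    ContinuousLinearMap.lpPairing_eq_integral, ContinuousLinearMap.mul_apply']
  refine integral_congr_ae ?_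
  filter_upwards [ψ.coeFn_toLp 4 volume] with x hx
  rw [hx]

theorem atomic_bound (M : ℕ → ℝ) (x : ℕ → Plane) (ψ : 𝓢(Plane, ℝ)) (i : ℕ) :
    ‖M i * ψ (x i)‖ ≤ |M i| * SchwartzMap.seminorm ℝ 0 0 ψ := by
  rw [norm_mul, Real.norm_eq_abs]
  exact mul_le_mul_of_nonneg_left (ψ.norm_le_seminorm ℝ (x i)) (abs_nonneg _)

theorem atomic_summable (M : ℕ → ℝ) (x : ℕ → Plane) (hM : Summable fun i => |M i|)
    (ψ : 𝓢(Plane, ℝ)) : Summable fun i => M i * ψ (x i) :=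
  Summable.of_norm_bounded (hM.mul_right _) (atomic_bound M x ψ)

/-- The atomic measure `∑ᵢ Mᵢ δ_{xᵢ}`, where `∑ᵢ |Mᵢ| < ∞`, as a tempered distribution:
`ψ ↦ ∑ᵢ Mᵢ ψ(xᵢ)`. -/
def atomic (M : ℕ → ℝ) (x : ℕ → Plane) (hM : Summable fun i => |M i|) : Distr :=
  SchwartzMap.mkCLMtoNormedSpace (fun ψ => ∑' i, M i * ψ (x i))
    (fun ψ₁ ψ₂ => by
      rw [← (atomic_summable M x hM ψ₁).tsum_add (atomic_summable M x hM ψ₂)]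
      exact tsum_congr fun i => mul_add _ _ _)
    (fun a ψ => by
      rw [RingHom.id_apply, smul_eq_mul, ← tsum_mul_left]
      exact tsum_congr fun i => mul_left_comm _ _ _)
    ⟨{(0, 0)}, ∑' i, |M i|, tsum_nonneg fun i => abs_nonneg _, fun ψ => by
      rw [Finset.sup_singleton, SchwartzMap.schwartzSeminormFamily_apply, ← tsum_mul_right]
      exact tsum_of_norm_bounded (hM.mul_right _).hasSum (atomic_bound M x ψ)⟩

/-! ### The nonlinear term -/

/-- The fundamental solution `E₂(z) = (2π)⁻¹ log |z|` of the Laplace equation in the plane. -/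
def E₂ (z : Plane) : ℝ := 1 / (2 * Real.pi) * Real.log ‖z‖

/-- The field `∇φ_v = -(∇E₂) ∗ v`, where `φ_v = -E₂ ∗ v`. -/
def gradPotential (v : Plane → ℝ) (x : Plane) : Plane :=
  -∫ y, v y • gradient E₂ (x - y)

/-- The function `e^{sΔ} B(u, v)`, `s > 0`, with `B(u, v) = ∇ · (u ∇φ_v)` a distribution. The pairing
of the distributional divergence of `F = u ∇φ_v` with `G(x - ·, s)` is
`∫ (∇G)(x - y, s) · F(y) dy`. -/
def heatBilin (s : ℝ) (u v : Plane → ℝ) (x : Plane) : ℝ :=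
  ∫ y, inner ℝ (gradient (gaussKernel s) (x - y)) (u y • gradPotential v y)

/-! ### Mild solutions and the space in which they are sought -/

/-- `u` is a (global in time) mild solution with initial datum `u₀`: for every `t > 0` and almost
every `x` the time integral converges absolutely and
`u(t) = e^{tΔ} u₀ + ∫₀ᵗ e^{(t - τ)Δ} B(u(τ), u(τ)) dτ`. Only the values `u(t)`, `t > 0`, matter. -/
def IsMildSolution (u₀ : Distr) (u : ℝ → L43) : Prop :=
  ∀ (t : ℝ) (ht : 0 < t), ∀ᵐ x : Plane,
    IntervalIntegrable (fun τ => heatBilin (t - τ) (u τ) (u τ) x) volume 0 t ∧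
    u t x = heat t ht u₀ x + ∫ τ in (0 : ℝ)..t, heatBilin (t - τ) (u τ) (u τ) x

/-- `sup_{t > 0} t^{1/4} ‖u(t)‖_{4/3}`, with values in `[0, ∞]`. -/
def weightedSup (u : ℝ → L43) : ℝ≥0∞ :=
  ⨆ (t : ℝ) (_ : 0 < t), ENNReal.ofReal (t ^ (1 / 4 : ℝ) * ‖u t‖)

/-- (Strong) measurability in `L^{4/3}` of a function of time `t > 0`. -/
def MeasurableInTime (u : ℝ → L43) : Prop :=
  AEStronglyMeasurable u (volume.restrict (Set.Ioi 0))

/-- Membership of `u` in the solution space, with initial datum `u₀`: `u` is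
a measurable and bounded function of `t` with values in `BX`, takes the initial datum in the sense
of tempered distributions, and is a measurable function of `t > 0` with values in `L^{4/3}` such
that `sup_{t > 0} t^{1/4} ‖u(t)‖_{4/3} < ∞`. -/
structure MemSolutionSpace (u₀ : Distr) (u : ℝ → L43) : Prop where
  /-- Strong measurability in `BX`: for almost every `t > 0`, `u(t)` is the limit in `BX` of a
  sequence of simple functions with values in `BX`. -/
  measurable_besov : ∃ s : ℕ → SimpleFunc ℝ Distr,
    (∀ n t, besovNorm (s n t) < ∞) ∧
    ∀ᵐ t ∂(volume.restrict (Set.Ioi (0 : ℝ))),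
      Tendsto (fun n => besovNorm (s n t - toDistr (u t))) atTop (𝓝 0)
  bounded_besov : ⨆ (t : ℝ) (_ : 0 < t), besovNorm (toDistr (u t)) < ∞
  initial : ∀ ψ : 𝓢(Plane, ℝ),
    Tendsto (fun t => ∫ x, u t x * ψ x) (𝓝[>] 0) (𝓝 (u₀ ψ))
  measurable_L43 : MeasurableInTime u
  bounded_L43 : weightedSup u < ∞

end DebyeNernstPlanck

end

noncomputable section

namespace DebyeNernstPlanck

open MeasureTheory Filter Topology SchwartzMap
open scoped ENNReal NNReal

/-! ### The Gauss kernel and its gradient -/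

/-! The problem is a fixed-point equation `u = e^{tΔ}u₀ + N(u)` with quadratic `N`, and the weight
`t^{1/4}` on `L^{4/3}` is exactly the one that `N` reproduces. Since `|∇E₂(z)| ≤ 1/|z|`, the
Hardy–Littlewood–Sobolev inequality `hls` makes the flux `u∇φ_v` a bounded bilinear map `L^{4/3} ×
L^{4/3} → L¹` (`flux`). By Young's inequality `e^{sΔ}∇·` maps `L¹` to `L^{4/3}` with norm
`O(s^{-3/4})`. If `‖u(τ)‖ ≤ aτ^{-1/4}`, the flux is `O(a²τ^{-1/2})` in `L¹`, and `∫₀ᵗ (t-τ)^{-3/4}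
τ^{-1/2} dτ` is a multiple of `t^{-1/4}`. Hence `N` is bounded and locally Lipschitz in the weighted
norm (`norm_nonlinear_le`, `norm_nonlinear_sub_le`). For small data the Picard iterates stay in a
small ball and converge geometrically (`exists_fixedPoint`), and the same contraction gives
uniqueness (`fixedPoint_unique`).

Two things connect this fixed point with the definitions. The mild equation is pointwise almost
everywhere, so the Bochner integral in `L^{4/3}` is identified with a pointwise time integral
(`coeFn_integral`, `coeFn_duhamel`), which gives `isMildSolution_iff`. Membership in the solution
space (`memSolutionSpace_of_eq`) uses that the Duhamel term is also bounded in `L¹`, by the kernel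
bound `s^{-1/2}`, and that `L¹` embeds in `BX`. The linear part is continuous in `BX` for `t > 0` by
the semigroup law. The initial datum is attained because the linear part tends to `u₀` in the sense
of distributions (`tendsto_integral_heat`), while the Duhamel term tested against a Schwartz
function is `O(t^{1/2})`. All manipulations of `e^{tΔ}w` for a tempered `w` rest on
`apply_convSchwartz`, which carries `w` inside an integral of translates.

For atomic measures let `γ = ‖G(·,1)‖_{4/3}`, which is `gaussConst`. Young's inequality for measures
gives `‖μ‖ ≤ γ ∑|Mᵢ|` (`besovNorm_atomic_le`). Rescaling `e^{tΔ}μ` about `xᵢ` as `t → 0` isolates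
`Mᵢ G(·,1)`, and Fatou's lemma gives `γ|Mᵢ| ≤ ‖μ‖` (`ofReal_mul_abs_le_besovNorm_atomic`). The
constant is the same in both directions, so the single threshold `η = ε/γ` serves for both. -/

theorem gaussKernel_nonneg {t : ℝ} (ht : 0 < t) (x : Plane) : 0 ≤ gaussKernel t x := by
  unfold gaussKernel; positivity

theorem gaussKernel_pos {t : ℝ} (ht : 0 < t) (x : Plane) : 0 < gaussKernel t x := by
  unfold gaussKernel; positivity

theorem continuous_gaussKernel (t : ℝ) : Continuous (gaussKernel t) :=
  (gaussKernel_contDiff t).continuous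

theorem gaussKernel_neg (t : ℝ) (x : Plane) : gaussKernel t (-x) = gaussKernel t x := by
  simp [gaussKernel]

theorem gaussKernel_le_of_le {t : ℝ} (ht : 0 < t) (x : Plane) :
    gaussKernel t x ≤ 1 / (4 * Real.pi * t) := by
  unfold gaussKernel
  refine mul_le_of_le_one_right (by positivity) (Real.exp_le_one_iff.2 ?_)
  rw [neg_div]
  exact neg_nonpos.2 (by positivity)

theorem integral_exp_neg_mul_normSq {b : ℝ} (hb : 0 < b) :
    ∫ x : Plane, Real.exp (-b * ‖x‖ ^ 2) = Real.pi / b := by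
  rw [GaussianFourier.integral_rexp_neg_mul_sq_norm hb]
  simp

theorem integrable_exp_neg_mul_normSq {b : ℝ} (hb : 0 < b) :
    Integrable fun x : Plane => Real.exp (-b * ‖x‖ ^ 2) := by
  by_contra h
  have h1 := integral_exp_neg_mul_normSq hb
  rw [integral_undef h] at h1
  have : 0 < Real.pi / b := by positivity
  linarith

theorem gaussKernel_eq {t : ℝ} (x : Plane) :
    gaussKernel t x = 1 / (4 * Real.pi * t) * Real.exp (-(1 / (4 * t)) * ‖x‖ ^ 2) := by
  rw [gaussKernel]; congr 2; ring

theorem integrable_gaussKernel {t : ℝ} (ht : 0 < t) : Integrable (gaussKernel t) := by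
  have := (integrable_exp_neg_mul_normSq (b := 1 / (4 * t)) (by positivity)).const_mul
    (1 / (4 * Real.pi * t))
  exact this.congr (.of_forall fun x => (gaussKernel_eq x).symm)

theorem integral_gaussKernel {t : ℝ} (ht : 0 < t) : ∫ x, gaussKernel t x = 1 := by
  simp_rw [gaussKernel_eq]
  rw [integral_const_mul, integral_exp_neg_mul_normSq (by positivity)]
  have := Real.pi_pos
  field_simp

theorem eLpNorm_one_gaussKernel {t : ℝ} (ht : 0 < t) : eLpNorm (gaussKernel t) 1 volume = 1 := by
  rw [eLpNorm_one_eq_lintegral_enorm]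
  have : ∀ x, ‖gaussKernel t x‖ₑ = ENNReal.ofReal (gaussKernel t x) := fun x =>
    Real.enorm_of_nonneg (gaussKernel_nonneg ht x)
  simp_rw [this]
  rw [← ofReal_integral_eq_lintegral_ofReal (integrable_gaussKernel ht)
    (.of_forall (gaussKernel_nonneg ht)), integral_gaussKernel ht, ENNReal.ofReal_one]

/-- The norm `‖G(·, 1)‖_{4/3}`. -/
def gaussConst : ℝ := ((1 / (4 * Real.pi)) ^ (4 / 3 : ℝ) * (3 * Real.pi)) ^ (3 / 4 : ℝ)

theorem gaussConst_pos : 0 < gaussConst := by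
  unfold gaussConst; positivity

theorem toReal_four_thirds : (4 / 3 : ℝ≥0∞).toReal = 4 / 3 := by simp

theorem four_thirds_ne_zero : (4 / 3 : ℝ≥0∞) ≠ 0 := by simp

theorem four_thirds_ne_top : (4 / 3 : ℝ≥0∞) ≠ ∞ := ENNReal.div_ne_top (by simp) (by simp)

theorem eLpNorm_four_thirds_eq {E : Type*} [NormedAddCommGroup E] (f : Plane → E) :
    eLpNorm f (4 / 3) volume = (∫⁻ x, ‖f x‖ₑ ^ (4 / 3 : ℝ)) ^ (3 / 4 : ℝ) := by
  rw [eLpNorm_eq_lintegral_rpow_enorm_toReal four_thirds_ne_zero four_thirds_ne_top,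
    toReal_four_thirds]
  norm_num

theorem eLpNorm_gaussKernel {t : ℝ} (ht : 0 < t) :
    eLpNorm (gaussKernel t) (4 / 3) volume = ENNReal.ofReal (gaussConst * t ^ (-1 / 4 : ℝ)) := by
  have hpi := Real.pi_pos
  have h1 : ∀ x, ‖gaussKernel t x‖ₑ ^ (4 / 3 : ℝ) =
      ENNReal.ofReal ((1 / (4 * Real.pi * t)) ^ (4 / 3 : ℝ) *
        Real.exp (-(1 / (3 * t)) * ‖x‖ ^ 2)) := fun x => by
    rw [Real.enorm_of_nonneg (gaussKernel_nonneg ht x),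
      ENNReal.ofReal_rpow_of_nonneg (gaussKernel_nonneg ht x) (by norm_num), gaussKernel_eq,
      Real.mul_rpow (by positivity) (Real.exp_pos _).le, ← Real.exp_mul]
    congr 3
    field_simp
  rw [eLpNorm_four_thirds_eq]
  simp_rw [h1]
  rw [← ofReal_integral_eq_lintegral_ofReal
    ((integrable_exp_neg_mul_normSq (by positivity)).const_mul _)
    (.of_forall fun x => by positivity), integral_const_mul,
    integral_exp_neg_mul_normSq (by positivity),
    ENNReal.ofReal_rpow_of_nonneg (by positivity) (by norm_num)]
  congr 1
  have h2 : (1 / (4 * Real.pi * t)) ^ (4 / 3 : ℝ) * (Real.pi / (1 / (3 * t))) =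
      ((1 / (4 * Real.pi)) ^ (4 / 3 : ℝ) * (3 * Real.pi)) * t ^ (-1 / 3 : ℝ) := by
    have h3 : t ^ (-1 / 3 : ℝ) = (1 / t) ^ (4 / 3 : ℝ) * t := by
      rw [one_div, Real.inv_rpow ht.le, ← Real.rpow_neg ht.le]
      nth_rewrite 3 [← Real.rpow_one t]
      rw [← Real.rpow_add ht]
      norm_num
    rw [h3, show 1 / (4 * Real.pi * t) = 1 / (4 * Real.pi) * (1 / t) by field_simp,
      Real.mul_rpow (by positivity) (by positivity)]
    field_simp
  rw [h2, Real.mul_rpow (by positivity) (by positivity), gaussConst, ← Real.rpow_mul ht.le]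
  norm_num

theorem memLp_gaussKernel {t : ℝ} (ht : 0 < t) : MemLp (gaussKernel t) (4 / 3) volume :=
  ⟨(continuous_gaussKernel t).aestronglyMeasurable, by
    rw [eLpNorm_gaussKernel ht]; exact ENNReal.ofReal_lt_top⟩

/-- Completing the square in `y`. The second factor has integral one in `y`, which yields the
semigroup law for the kernels. -/
theorem gaussKernel_mul_gaussKernel {s t : ℝ} (hs : 0 < s) (ht : 0 < t) (x y : Plane) :
    gaussKernel s (x - y) * gaussKernel t y =
      gaussKernel (s + t) x * gaussKernel (s * t / (s + t)) (y - (t / (s + t)) • x) := by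
  have hst : 0 < s + t := by positivity
  have hpi := Real.pi_pos
  simp only [gaussKernel]
  rw [mul_mul_mul_comm, ← Real.exp_add, mul_mul_mul_comm (1 / (4 * Real.pi * (s + t))),
    ← Real.exp_add]
  congr 1
  · field_simp
  · congr 1
    rw [norm_sub_sq_real, norm_sub_sq_real, inner_smul_right, norm_smul, Real.norm_eq_abs,
      mul_pow, sq_abs, real_inner_comm]
    field_simp
    ring

theorem integral_gaussKernel_mul_gaussKernel {s t : ℝ} (hs : 0 < s) (ht : 0 < t) (x : Plane) :
    ∫ y, gaussKernel s (x - y) * gaussKernel t y = gaussKernel (s + t) x := by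
  simp_rw [gaussKernel_mul_gaussKernel hs ht]
  rw [integral_const_mul, integral_sub_right_eq_self (gaussKernel (s * t / (s + t))),
    integral_gaussKernel (by positivity), mul_one]

theorem gradient_gaussKernel {s : ℝ} (hs : 0 < s) (z : Plane) :
    gradient (gaussKernel s) z = -(gaussKernel s z / (2 * s)) • z := by
  apply HasGradientAt.gradient
  rw [hasGradientAt_iff_hasFDerivAt]
  have h := (((hasStrictFDerivAt_norm_sq z).hasFDerivAt.neg.mul_const (1 / (4 * s))).exp).const_mul
    (1 / (4 * Real.pi * s))
  have h2 : HasFDerivAt (gaussKernel s) _ z := h.congr_of_eventuallyEq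
    (.of_forall fun x => by simp only [gaussKernel, Pi.neg_apply]; congr 2; ring)
  refine h2.congr_fderiv ?_
  ext v
  simp only [Pi.neg_apply, gaussKernel, InnerProductSpace.toDual_apply_apply, inner_smul_left,
    smul_apply, neg_apply, smul_eq_mul,
    innerSL_apply_apply, nsmul_eq_mul]
  rw [show -‖z‖ ^ 2 / (4 * s) = -‖z‖ ^ 2 * (1 / (4 * s)) by ring]
  simp only [conj_trivial]
  push_cast
  field_simp
  ring

theorem norm_gradient_gaussKernel_eq {s : ℝ} (hs : 0 < s) (z : Plane) :
    ‖gradient (gaussKernel s) z‖ = ‖z‖ / (2 * s) * gaussKernel s z := by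
  rw [gradient_gaussKernel hs, norm_smul, norm_neg, Real.norm_eq_abs,
    abs_of_nonneg (by have := gaussKernel_nonneg hs z; positivity)]
  ring

theorem gaussKernel_eq_double {s : ℝ} (hs : 0 < s) (z : Plane) :
    gaussKernel s z = 2 * gaussKernel (2 * s) z * Real.exp (-(‖z‖ ^ 2 / (8 * s))) := by
  have hpi := Real.pi_pos
  simp only [gaussKernel]
  rw [show -‖z‖ ^ 2 / (4 * s) = -‖z‖ ^ 2 / (4 * (2 * s)) + -(‖z‖ ^ 2 / (8 * s)) by field_simp; ring,
    Real.exp_add]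
  field_simp

/-- Half of the Gaussian exponent is spent on absorbing the factor `|z|/s`, by `e^{-a} ≤ 1/(1+a)`;
the other half is a Gaussian at time `2s`. Every `L^p` bound for the gradient thus reduces to one
for the kernel itself. -/
theorem norm_gradient_gaussKernel_le {s : ℝ} (hs : 0 < s) (z : Plane) :
    ‖gradient (gaussKernel s) z‖ ≤ 2 * s ^ (-1 / 2 : ℝ) * gaussKernel (2 * s) z := by
  rw [norm_gradient_gaussKernel_eq hs, gaussKernel_eq_double hs]
  have hG := gaussKernel_nonneg (t := 2 * s) (by positivity) z
  have hsq : s ^ (-1 / 2 : ℝ) = 1 / √s := by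
    rw [Real.sqrt_eq_rpow, one_div, ← Real.rpow_neg hs.le]; norm_num
  have hr : 0 < √s := Real.sqrt_pos.2 hs
  have hss : √s * √s = s := Real.mul_self_sqrt hs.le
  have he : Real.exp (-(‖z‖ ^ 2 / (8 * s))) ≤ 1 / (1 + ‖z‖ ^ 2 / (8 * s)) := by
    rw [Real.exp_neg, ← one_div]
    exact one_div_le_one_div_of_le (by positivity) (by linarith [Real.add_one_le_exp (‖z‖ ^ 2 / (8 * s))])
  have key : ‖z‖ / s * Real.exp (-(‖z‖ ^ 2 / (8 * s))) ≤ 2 * (1 / √s) := by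
    calc ‖z‖ / s * Real.exp (-(‖z‖ ^ 2 / (8 * s))) ≤ ‖z‖ / s * (1 / (1 + ‖z‖ ^ 2 / (8 * s))) := by
          gcongr
      _ ≤ 2 * (1 / √s) := by
          rw [div_mul_div_comm, mul_one_div, div_le_div_iff₀ (by positivity) hr]
          rw [show s * (1 + ‖z‖ ^ 2 / (8 * s)) = s + ‖z‖ ^ 2 / 8 by field_simp]
          nlinarith [sq_nonneg (‖z‖ - 2 * √s)]
  calc ‖z‖ / (2 * s) * (2 * gaussKernel (2 * s) z * Real.exp (-(‖z‖ ^ 2 / (8 * s))))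
      = (‖z‖ / s * Real.exp (-(‖z‖ ^ 2 / (8 * s)))) * gaussKernel (2 * s) z := by
        field_simp
    _ ≤ 2 * s ^ (-1 / 2 : ℝ) * gaussKernel (2 * s) z := by
        rw [hsq]; gcongr

/-- The extra factor `|z|` cancels the singularity `s^{-1/2}`. This bound, uniform in `s`, is what
makes the Duhamel term small against test functions. -/
theorem norm_mul_norm_gradient_gaussKernel_le {s : ℝ} (hs : 0 < s) (z : Plane) :
    ‖z‖ * ‖gradient (gaussKernel s) z‖ ≤ 8 * gaussKernel (2 * s) z := by
  rw [norm_gradient_gaussKernel_eq hs, gaussKernel_eq_double hs]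
  have hG := gaussKernel_nonneg (t := 2 * s) (by positivity) z
  have he : ‖z‖ ^ 2 / (8 * s) * Real.exp (-(‖z‖ ^ 2 / (8 * s))) ≤ 1 := by
    rw [Real.exp_neg, ← div_eq_mul_inv, div_le_one (Real.exp_pos _)]
    linarith [Real.add_one_le_exp (‖z‖ ^ 2 / (8 * s))]
  calc ‖z‖ * (‖z‖ / (2 * s) * (2 * gaussKernel (2 * s) z * Real.exp (-(‖z‖ ^ 2 / (8 * s)))))
      = 8 * (‖z‖ ^ 2 / (8 * s) * Real.exp (-(‖z‖ ^ 2 / (8 * s)))) * gaussKernel (2 * s) z := by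
        field_simp
    _ ≤ 8 * gaussKernel (2 * s) z := by nlinarith

theorem continuous_gradient_gaussKernel {s : ℝ} (hs : 0 < s) :
    Continuous (gradient (gaussKernel s)) := by
  rw [funext (gradient_gaussKernel hs)]
  have := continuous_gaussKernel s
  fun_prop

theorem gradient_gaussKernel_neg {s : ℝ} (hs : 0 < s) (z : Plane) :
    gradient (gaussKernel s) (-z) = -gradient (gaussKernel s) z := by
  simp [gradient_gaussKernel hs, gaussKernel_neg]

theorem integrable_gradient_gaussKernel {s : ℝ} (hs : 0 < s) :
    Integrable (gradient (gaussKernel s)) :=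
  ((integrable_gaussKernel (t := 2 * s) (by positivity)).const_mul (2 * s ^ (-1 / 2 : ℝ))).mono'
    (continuous_gradient_gaussKernel hs).aestronglyMeasurable
    (.of_forall (norm_gradient_gaussKernel_le hs))

theorem integral_gradient_gaussKernel {s : ℝ} (hs : 0 < s) :
    ∫ z, gradient (gaussKernel s) z = 0 := by
  have h := integral_neg_eq_self (gradient (gaussKernel s)) volume
  simp_rw [gradient_gaussKernel_neg hs, integral_neg] at h
  have h2 : (2 : ℝ) • ∫ z, gradient (gaussKernel s) z = 0 := by
    rw [two_smul]
    nth_rewrite 1 [← h]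
    exact neg_add_cancel _
  exact (smul_eq_zero.1 h2).resolve_left two_ne_zero

theorem eLpNorm_gradient_gaussKernel_le {s : ℝ} (hs : 0 < s) (p : ℝ≥0∞) :
    eLpNorm (gradient (gaussKernel s)) p volume ≤
      ENNReal.ofReal (2 * s ^ (-1 / 2 : ℝ)) * eLpNorm (gaussKernel (2 * s)) p volume :=
  eLpNorm_le_mul_eLpNorm_of_ae_le_mul (.of_forall fun z => by
    rw [Real.norm_of_nonneg (gaussKernel_nonneg (t := 2 * s) (by positivity) z)]
    exact norm_gradient_gaussKernel_le hs z) p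

theorem eLpNorm_one_gradient_gaussKernel_le {s : ℝ} (hs : 0 < s) :
    eLpNorm (gradient (gaussKernel s)) 1 volume ≤ ENNReal.ofReal (2 * s ^ (-1 / 2 : ℝ)) := by
  refine (eLpNorm_gradient_gaussKernel_le hs 1).trans_eq ?_
  rw [eLpNorm_one_gaussKernel (by positivity), mul_one]

theorem eLpNorm_four_thirds_gradient_gaussKernel_le {s : ℝ} (hs : 0 < s) :
    eLpNorm (gradient (gaussKernel s)) (4 / 3) volume ≤
      ENNReal.ofReal (2 * gaussConst * s ^ (-3 / 4 : ℝ)) := by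
  refine (eLpNorm_gradient_gaussKernel_le hs _).trans ?_
  rw [eLpNorm_gaussKernel (by positivity), ← ENNReal.ofReal_mul (by positivity)]
  refine ENNReal.ofReal_le_ofReal ?_
  have h1 : (2 * s) ^ (-1 / 4 : ℝ) ≤ s ^ (-1 / 4 : ℝ) :=
    Real.rpow_le_rpow_of_nonpos hs (by linarith) (by norm_num)
  have h2 : s ^ (-3 / 4 : ℝ) = s ^ (-1 / 2 : ℝ) * s ^ (-1 / 4 : ℝ) := by
    rw [← Real.rpow_add hs]; norm_num
  have := gaussConst_pos
  calc 2 * s ^ (-1 / 2 : ℝ) * (gaussConst * (2 * s) ^ (-1 / 4 : ℝ))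
      ≤ 2 * s ^ (-1 / 2 : ℝ) * (gaussConst * s ^ (-1 / 4 : ℝ)) := by gcongr
    _ = _ := by rw [h2]; ring

/-! ### The gradient of the fundamental solution -/

theorem measurable_gradient_E₂ : Measurable (gradient E₂) := by
  unfold gradient
  exact (InnerProductSpace.toDual ℝ Plane).symm.continuous.measurable.comp (measurable_fderiv ℝ E₂)

theorem gradient_E₂ {z : Plane} (hz : z ≠ 0) :
    gradient E₂ z = (1 / (2 * Real.pi * ‖z‖ ^ 2)) • z := by
  apply HasGradientAt.gradient
  rw [hasGradientAt_iff_hasFDerivAt]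
  have hz' : ‖z‖ ^ 2 ≠ 0 := by positivity
  have h := (((hasStrictFDerivAt_norm_sq z).hasFDerivAt).log hz').const_mul (1 / (4 * Real.pi))
  have h2 : HasFDerivAt E₂ _ z := h.congr_of_eventuallyEq
    (.of_forall fun x => by simp only [E₂, Real.log_pow]; push_cast; ring)
  refine h2.congr_fderiv ?_
  ext v
  simp only [InnerProductSpace.toDual_apply_apply, inner_smul_left,
    smul_apply, smul_eq_mul, innerSL_apply_apply, nsmul_eq_mul, conj_trivial]
  push_cast
  field_simp
  norm_num

/-- In `[0,∞]` the right side is infinite at the origin, so the bound holds everywhere, whatever the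
gradient is there. -/
theorem enorm_gradient_E₂_le (z : Plane) : ‖gradient E₂ z‖ₑ ≤ ‖z‖ₑ⁻¹ := by
  rcases eq_or_ne z 0 with rfl | hz
  · simp
  · have h0 : 0 < ‖z‖ := norm_pos_iff.2 hz
    rw [← ofReal_norm, ← ofReal_norm, ← ENNReal.ofReal_inv_of_pos h0]
    refine ENNReal.ofReal_le_ofReal ?_
    rw [gradient_E₂ hz, norm_smul, Real.norm_of_nonneg (by positivity)]
    rw [one_div_mul_eq_div, div_le_iff₀ (by positivity), pow_two]
    have : ‖z‖⁻¹ * (2 * Real.pi * (‖z‖ * ‖z‖)) = 2 * Real.pi * ‖z‖ := by field_simp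
    rw [this]
    nlinarith [Real.pi_gt_three]

/-! ### Young's inequality and convolution as a bilinear map -/

/-- **Young's inequality** for the convolution of a nonnegative function and a measure. -/
theorem eLpNorm_lintegral_sub_le {p : ℝ≥0∞} (hp : 1 ≤ p) (hp' : p ≠ ∞) {k : Plane → ℝ≥0∞}
    (hk : Measurable k) (ν : Measure Plane) [SFinite ν] :
    eLpNorm (fun x => ∫⁻ y, k (x - y) ∂ν) p volume ≤ ν Set.univ * eLpNorm k p volume := by
  have hp0 : p ≠ 0 := (zero_lt_one.trans_le hp).ne'
  have hpr : 1 ≤ p.toReal := by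
    rw [← ENNReal.toReal_one]; exact ENNReal.toReal_mono hp' hp
  have hpr0 : 0 < p.toReal := by linarith
  have hmeas : Measurable fun q : Plane × Plane => k (q.1 - q.2) := by fun_prop
  -- Hölder against the constant function on the measure `ν`. Tonelli and translation invariance
  -- then finish the proof. Keeping a general `ν` covers both integrable densities and sums of point
  -- masses.
  have jensen : ∀ x, (∫⁻ y, k (x - y) ∂ν) ^ p.toReal ≤
      ν Set.univ ^ (p.toReal - 1) * ∫⁻ y, k (x - y) ^ p.toReal ∂ν := fun x => by
    have h := eLpNorm_le_eLpNorm_mul_rpow_measure_univ (μ := ν) (f := fun y => k (x - y)) hp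
      (hk.comp (measurable_const.sub measurable_id)).aestronglyMeasurable
    rw [eLpNorm_one_eq_lintegral_enorm, eLpNorm_eq_lintegral_rpow_enorm_toReal hp0 hp'] at h
    simp only [enorm_eq_self] at h
    refine (ENNReal.rpow_le_rpow h hpr0.le).trans_eq ?_
    rw [ENNReal.mul_rpow_of_nonneg _ _ hpr0.le, ← ENNReal.rpow_mul, ← ENNReal.rpow_mul,
      one_div_mul_cancel hpr0.ne', ENNReal.rpow_one, mul_comm]
    congr 2
    simp only [ENNReal.toReal_one]
    field_simp
  rw [eLpNorm_eq_lintegral_rpow_enorm_toReal hp0 hp', eLpNorm_eq_lintegral_rpow_enorm_toReal hp0 hp']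
  simp only [enorm_eq_self]
  have tonelli : ∫⁻ x, ∫⁻ y, k (x - y) ^ p.toReal ∂ν = ν Set.univ * ∫⁻ x, k x ^ p.toReal := by
    rw [lintegral_lintegral_swap (by fun_prop)]
    simp_rw [lintegral_sub_right_eq_self (fun x => k x ^ p.toReal)]
    rw [lintegral_const, mul_comm]
  have main : ∫⁻ x, (∫⁻ y, k (x - y) ∂ν) ^ p.toReal ≤
      ν Set.univ ^ p.toReal * ∫⁻ x, k x ^ p.toReal := by
    calc ∫⁻ x, (∫⁻ y, k (x - y) ∂ν) ^ p.toReal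
        ≤ ∫⁻ x, ν Set.univ ^ (p.toReal - 1) * ∫⁻ y, k (x - y) ^ p.toReal ∂ν :=
          lintegral_mono jensen
      _ = ν Set.univ ^ (p.toReal - 1) * (ν Set.univ * ∫⁻ x, k x ^ p.toReal) := by
          rw [lintegral_const_mul _ (by fun_prop), tonelli]
      _ = _ := by
          rw [← mul_assoc]
          congr 1
          nth_rewrite 2 [← ENNReal.rpow_one (ν Set.univ)]
          rw [← ENNReal.rpow_add_of_nonneg _ _ (by linarith) zero_le_one, sub_add_cancel]
  calc (∫⁻ x, (∫⁻ y, k (x - y) ∂ν) ^ p.toReal) ^ (1 / p.toReal)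
      ≤ (ν Set.univ ^ p.toReal * ∫⁻ x, k x ^ p.toReal) ^ (1 / p.toReal) := by gcongr
    _ = _ := by
        rw [ENNReal.mul_rpow_of_nonneg _ _ (by positivity), ← ENNReal.rpow_mul,
          mul_one_div_cancel hpr0.ne', ENNReal.rpow_one]

theorem eLpNorm_lintegral_sub_mul_le {p : ℝ≥0∞} (hp : 1 ≤ p) (hp' : p ≠ ∞) {k f : Plane → ℝ≥0∞}
    (hk : Measurable k) (hf : Measurable f) :
    eLpNorm (fun x => ∫⁻ y, k (x - y) * f y) p volume ≤ (∫⁻ y, f y) * eLpNorm k p volume := by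
  have h := eLpNorm_lintegral_sub_le hp hp' hk (volume.withDensity f)
  rw [withDensity_apply _ MeasurableSet.univ, Measure.restrict_univ] at h
  refine le_trans (le_of_eq ?_) h
  congr 1
  ext x
  rw [lintegral_withDensity_eq_lintegral_mul _ hf (by fun_prop)]
  simp [mul_comm]

theorem eLpNorm_convFun_lintegral_le {E E' : Type*} [NormedAddCommGroup E] [NormedAddCommGroup E']
    {p : ℝ≥0∞} (hp : 1 ≤ p) (hp' : p ≠ ∞)
    {k : Plane → E} {f : Plane → E'}
    (hk : AEStronglyMeasurable k) (hf : AEStronglyMeasurable f) :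
    eLpNorm (fun x => ∫⁻ y, ‖k (x - y)‖ₑ * ‖f y‖ₑ) p volume ≤
      eLpNorm f 1 volume * eLpNorm k p volume := by
  have h := eLpNorm_lintegral_sub_mul_le hp hp' (k := fun x => ‖hk.mk k x‖ₑ)
    (f := fun x => ‖hf.mk f x‖ₑ) hk.stronglyMeasurable_mk.enorm hf.stronglyMeasurable_mk.enorm
  rw [eLpNorm_congr_ae hk.ae_eq_mk, eLpNorm_congr_ae hf.ae_eq_mk, eLpNorm_one_eq_lintegral_enorm]
  rw [show eLpNorm (fun x => ‖hk.mk k x‖ₑ) p volume = eLpNorm (hk.mk k) p volume from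
    eLpNorm_enorm _] at h
  refine le_trans (le_of_eq ?_) h
  congr 1
  ext x
  refine lintegral_congr_ae ?_
  filter_upwards [hf.ae_eq_mk, (quasiMeasurePreserving_sub_left volume x).ae_eq_comp hk.ae_eq_mk]
    with y h1 h2
  simp only [Function.comp_apply] at h2
  rw [h1, h2]

section Convolution

variable {E E' F : Type*} [NormedAddCommGroup E] [NormedSpace ℝ E] [NormedAddCommGroup E']
  [NormedSpace ℝ E'] [NormedAddCommGroup F] [NormedSpace ℝ F]
  (L : E →L[ℝ] E' →L[ℝ] F) {p : ℝ≥0∞}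

/-- The convolution `x ↦ ∫ L (k (x - y)) (f y) dy`. -/
def convFun (k : Plane → E) (f : Plane → E') (x : Plane) : F := ∫ y, L (k (x - y)) (f y)

theorem convFun_congr_ae {k k' : Plane → E} {f f' : Plane → E'} (hk : k =ᵐ[volume] k')
    (hf : f =ᵐ[volume] f') : convFun L k f = convFun L k' f' := by
  ext x
  refine integral_congr_ae ?_
  filter_upwards [hf, (quasiMeasurePreserving_sub_left volume x).ae_eq_comp hk] with y h1 h2
  simp only [Function.comp_apply] at h2
  rw [h1, h2]

theorem aestronglyMeasurable_conv_integrand {k : Plane → E} {f : Plane → E'}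
    (hk : AEStronglyMeasurable k) (hf : AEStronglyMeasurable f) :
    AEStronglyMeasurable (fun q : Plane × Plane => L (k (q.1 - q.2)) (f q.2))
      (volume.prod volume) :=
  L.aestronglyMeasurable_comp₂
    (hk.comp_quasiMeasurePreserving (quasiMeasurePreserving_sub_of_right_invariant volume volume))
    hf.comp_snd

theorem aestronglyMeasurable_convFun {k : Plane → E} {f : Plane → E'}
    (hk : AEStronglyMeasurable k) (hf : AEStronglyMeasurable f) :
    AEStronglyMeasurable (convFun L k f) :=
  (aestronglyMeasurable_conv_integrand L hk hf).integral_prod_right'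

theorem enorm_bilin_le (hL : ‖L‖ ≤ 1) (a : E) (b : E') : ‖L a b‖ₑ ≤ ‖a‖ₑ * ‖b‖ₑ := by
  rw [← ofReal_norm, ← ofReal_norm, ← ofReal_norm, ← ENNReal.ofReal_mul (norm_nonneg _)]
  refine ENNReal.ofReal_le_ofReal ((L.le_opNorm₂ a b).trans ?_)
  rw [mul_assoc]
  exact mul_le_of_le_one_left (by positivity) hL

theorem eLpNorm_convFun_le (hL : ‖L‖ ≤ 1) (hp : 1 ≤ p) (hp' : p ≠ ∞) {k : Plane → E}
    {f : Plane → E'} (hk : AEStronglyMeasurable k) (hf : AEStronglyMeasurable f) :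
    eLpNorm (convFun L k f) p volume ≤ eLpNorm f 1 volume * eLpNorm k p volume := by
  refine le_trans ?_ (eLpNorm_convFun_lintegral_le hp hp' hk hf)
  refine eLpNorm_mono_enorm fun x => ?_
  rw [enorm_eq_self]
  exact (enorm_integral_le_lintegral_enorm _).trans
    (lintegral_mono fun y => enorm_bilin_le L hL _ _)

theorem memLp_convFun (hL : ‖L‖ ≤ 1) (hp : 1 ≤ p) (hp' : p ≠ ∞) {k : Plane → E}
    {f : Plane → E'} (hk : MemLp k p) (hf : MemLp f 1) : MemLp (convFun L k f) p :=
  ⟨aestronglyMeasurable_convFun L hk.1 hf.1,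
    (eLpNorm_convFun_le L hL hp hp' hk.1 hf.1).trans_lt (ENNReal.mul_lt_top hf.2 hk.2)⟩

/-- The convolution of the absolute values has finite `L^p` norm, hence is finite almost everywhere.
Additivity of the convolution in each argument needs this. -/
theorem ae_integrable_conv_integrand (hL : ‖L‖ ≤ 1) (hp : 1 ≤ p) (hp' : p ≠ ∞) {k : Plane → E}
    {f : Plane → E'} (hk : MemLp k p) (hf : MemLp f 1) :
    ∀ᵐ x : Plane, Integrable (fun y => L (k (x - y)) (f y)) := by
  have hp0 : p ≠ 0 := (zero_lt_one.trans_le hp).ne'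
  have h1 := (eLpNorm_convFun_lintegral_le hp hp' hk.1 hf.1).trans_lt (ENNReal.mul_lt_top hf.2 hk.2)
  have hm : AEMeasurable (fun x => ∫⁻ y, ‖k (x - y)‖ₑ * ‖f y‖ₑ) := by
    refine AEMeasurable.lintegral_prod_right' (f := fun q : Plane × Plane =>
      ‖k (q.1 - q.2)‖ₑ * ‖f q.2‖ₑ) (ν := volume) (μ := volume) ?_
    exact (hk.1.comp_quasiMeasurePreserving
      (quasiMeasurePreserving_sub_of_right_invariant volume volume)).enorm.mul
      hf.1.comp_snd.enorm
  rw [eLpNorm_lt_top_iff_lintegral_rpow_enorm_lt_top hp0 hp'] at h1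
  simp only [enorm_eq_self] at h1
  have h2 := ae_lt_top' (hm.pow_const _) h1.ne
  filter_upwards [h2] with x hx
  have hpr0 : 0 < p.toReal := ENNReal.toReal_pos hp0 hp'
  rw [ENNReal.rpow_lt_top_iff_of_pos hpr0] at hx
  refine ⟨L.aestronglyMeasurable_comp₂
    (hk.1.comp_quasiMeasurePreserving (quasiMeasurePreserving_sub_left volume x)) hf.1, ?_⟩
  exact (lintegral_mono fun y => enorm_bilin_le L hL _ _).trans_lt hx

variable [Fact (1 ≤ p)] [hptop : Fact (p ≠ ∞)]

/-- Convolution as a continuous bilinear map `L^p × L^1 → L^p`. -/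
def conv (hL : ‖L‖ ≤ 1) :
    Lp E p (volume : Measure Plane) →L[ℝ] Lp E' 1 (volume : Measure Plane) →L[ℝ]
      Lp F p (volume : Measure Plane) :=
  LinearMap.mkContinuous₂
    (LinearMap.mk₂ ℝ (fun k f => (memLp_convFun L hL Fact.out hptop.out
        (Lp.memLp k) (Lp.memLp f)).toLp)
      (fun k k' f => by
        rw [← MemLp.toLp_add]
        refine MemLp.toLp_congr _ _ ?_
        rw [convFun_congr_ae L (Lp.coeFn_add k k') (ae_eq_refl _)]
        filter_upwards [ae_integrable_conv_integrand L hL Fact.out hptop.out (Lp.memLp k)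
          (Lp.memLp f), ae_integrable_conv_integrand L hL Fact.out hptop.out (Lp.memLp k')
          (Lp.memLp f)] with x h1 h2
        simp only [Pi.add_apply, convFun]
        rw [← integral_add h1 h2]
        simp)
      (fun c k f => by
        rw [← MemLp.toLp_const_smul]
        refine MemLp.toLp_congr _ _ ?_
        rw [convFun_congr_ae L (Lp.coeFn_smul c k) (ae_eq_refl _)]
        refine .of_forall fun x => ?_
        simp only [Pi.smul_apply, convFun]
        rw [← integral_smul]
        simp)
      (fun k f f' => by
        rw [← MemLp.toLp_add]
        refine MemLp.toLp_congr _ _ ?_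
        rw [convFun_congr_ae L (ae_eq_refl _) (Lp.coeFn_add f f')]
        filter_upwards [ae_integrable_conv_integrand L hL Fact.out hptop.out (Lp.memLp k)
          (Lp.memLp f), ae_integrable_conv_integrand L hL Fact.out hptop.out (Lp.memLp k)
          (Lp.memLp f')] with x h1 h2
        simp only [Pi.add_apply, convFun]
        rw [← integral_add h1 h2]
        simp)
      (fun c k f => by
        rw [← MemLp.toLp_const_smul]
        refine MemLp.toLp_congr _ _ ?_
        rw [convFun_congr_ae L (ae_eq_refl _) (Lp.coeFn_smul c f)]
        refine .of_forall fun x => ?_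
        simp only [Pi.smul_apply, convFun]
        rw [← integral_smul]
        simp))
    1 (fun k f => by
      rw [LinearMap.mk₂_apply, Lp.norm_toLp, one_mul, Lp.norm_def, Lp.norm_def, mul_comm,
        ← ENNReal.toReal_mul]
      exact ENNReal.toReal_mono (ENNReal.mul_lt_top (Lp.eLpNorm_lt_top f) (Lp.eLpNorm_lt_top k)).ne
        (eLpNorm_convFun_le L hL Fact.out hptop.out (Lp.memLp k).1 (Lp.memLp f).1))

theorem coeFn_conv (hL : ‖L‖ ≤ 1) (k : Lp E p (volume : Measure Plane))
    (f : Lp E' 1 (volume : Measure Plane)) : conv L hL k f =ᵐ[volume] convFun L k f :=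
  MemLp.coeFn_toLp (memLp_convFun L hL Fact.out hptop.out (Lp.memLp k) (Lp.memLp f))

theorem norm_conv_le (hL : ‖L‖ ≤ 1) (k : Lp E p (volume : Measure Plane))
    (f : Lp E' 1 (volume : Measure Plane)) : ‖conv L hL k f‖ ≤ ‖k‖ * ‖f‖ := by
  have h := (conv (p := p) L hL).le_opNorm₂ k f
  have h1 : ‖conv (p := p) L hL‖ ≤ 1 := LinearMap.mkContinuous₂_norm_le _ zero_le_one _
  rw [mul_assoc] at h
  exact h.trans (mul_le_of_le_one_left (by positivity) h1)

end Convolution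

/-! ### The Hardy–Littlewood–Sobolev inequality -/

/-- Twice the area of the unit disc. -/
def discConst : ℝ := 2 * (volume : Measure Plane).real (Metric.ball 0 1)

theorem discConst_nonneg : 0 ≤ discConst := by unfold discConst; positivity

theorem lintegral_ofReal_norm_eq {f : ℝ → ℝ} (hf0 : ∀ r, 0 ≤ f r)
    (hf : IntegrableOn (fun y : ℝ => y * f y) (Set.Ioi 0)) :
    ∫⁻ x : Plane, ENNReal.ofReal (f ‖x‖) =
      ENNReal.ofReal (discConst * ∫ y in Set.Ioi (0 : ℝ), y * f y) := by
  have h1 : Integrable (fun x : Plane => f ‖x‖) := by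
    rw [integrable_fun_norm_addHaar (volume : Measure Plane)]
    simpa using hf
  rw [← ofReal_integral_eq_lintegral_ofReal h1 (.of_forall fun x => hf0 _),
    integral_fun_norm_addHaar (volume : Measure Plane)]
  simp [discConst, mul_assoc]

theorem lintegral_ball_inv_norm_le {r : ℝ} (hr : 0 < r) :
    ∫⁻ z : Plane in Metric.ball 0 r, ‖z‖ₑ⁻¹ ≤ ENNReal.ofReal (discConst * r) := by
  have hind : ∀ y : ℝ, y ∈ Set.Ioi (0 : ℝ) →
      (Set.Ioo 0 r).indicator (fun _ => (1 : ℝ)) y =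
        y * (Set.Ioo 0 r).indicator (fun y => y⁻¹) y := fun y hy => by
    by_cases h : y ∈ Set.Ioo 0 r
    · simp [h, mul_inv_cancel₀ (Set.mem_Ioi.1 hy).ne']
    · simp [h]
  have hint : IntegrableOn ((Set.Ioo 0 r).indicator (fun _ => (1 : ℝ))) (Set.Ioi 0) :=
    ((integrable_indicator_iff measurableSet_Ioo).2 (by simp)).integrableOn
  have h := lintegral_ofReal_norm_eq (f := (Set.Ioo 0 r).indicator (fun y => y⁻¹))
    (fun y => Set.indicator_nonneg (fun y hy => inv_nonneg.2 hy.1.le) y)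
    (hint.congr_fun hind measurableSet_Ioi)
  rw [← setIntegral_congr_fun measurableSet_Ioi hind,
    setIntegral_indicator measurableSet_Ioo] at h
  have h2 : ∫ _ in Set.Ioi 0 ∩ Set.Ioo 0 r, (1 : ℝ) = r := by
    rw [Set.inter_eq_right.2 (fun y hy => hy.1)]
    simp [hr.le]
  rw [h2] at h
  rw [← h, ← lintegral_indicator measurableSet_ball]
  refine lintegral_mono_ae ?_
  -- The origin is discarded: there the left integrand is infinite and the right one vanishes.
  filter_upwards [compl_mem_ae_iff.2 (measure_singleton (0 : Plane))] with z hz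
  have hz0 : 0 < ‖z‖ := norm_pos_iff.2 hz
  by_cases hzr : ‖z‖ < r
  · rw [Set.indicator_of_mem (by simpa using hzr), Set.indicator_of_mem (Set.mem_Ioo.2 ⟨hz0, hzr⟩),
      ENNReal.ofReal_inv_of_pos hz0, ofReal_norm]
  · rw [Set.indicator_of_notMem (by simpa using hzr)]
    exact zero_le

theorem lintegral_compl_ball_inv_norm_pow_le {r : ℝ} (hr : 0 < r) :
    ∫⁻ z : Plane in (Metric.ball 0 r)ᶜ, (‖z‖ₑ⁻¹) ^ (4 : ℝ) ≤
      ENNReal.ofReal (discConst * (r ^ (-2 : ℝ) / 2)) := by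
  have hind : ∀ y : ℝ, y ∈ Set.Ioi (0 : ℝ) →
      (Set.Ici r).indicator (fun y => y ^ (-3 : ℝ)) y =
        y * (Set.Ici r).indicator (fun y => y ^ (-4 : ℝ)) y := fun y hy => by
    by_cases h : y ∈ Set.Ici r
    · simp only [h, Set.indicator_of_mem]
      nth_rewrite 2 [← Real.rpow_one y]
      rw [← Real.rpow_add hy]; norm_num
    · simp [h]
  have hint : IntegrableOn ((Set.Ici r).indicator (fun y => y ^ (-3 : ℝ))) (Set.Ioi 0) :=
    ((integrable_indicator_iff measurableSet_Ici).2
      ((integrableOn_Ici_iff_integrableOn_Ioi).2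
        (integrableOn_Ioi_rpow_of_lt (by norm_num) hr))).integrableOn
  have h := lintegral_ofReal_norm_eq (f := (Set.Ici r).indicator (fun y => y ^ (-4 : ℝ)))
    (fun y => Set.indicator_nonneg (fun y hy => Real.rpow_nonneg (hr.le.trans hy) _) y)
    (hint.congr_fun hind measurableSet_Ioi)
  rw [← setIntegral_congr_fun measurableSet_Ioi hind,
    setIntegral_indicator measurableSet_Ici] at h
  have h2 : ∫ y in Set.Ioi 0 ∩ Set.Ici r, y ^ (-3 : ℝ) = r ^ (-2 : ℝ) / 2 := by
    rw [Set.inter_eq_right.2 (Set.Ici_subset_Ioi.2 hr), integral_Ici_eq_integral_Ioi,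
      integral_Ioi_rpow_of_lt (by norm_num) hr]
    norm_num
  rw [h2] at h
  rw [← h, ← lintegral_indicator measurableSet_ball.compl]
  refine lintegral_mono fun z => ?_
  by_cases hzr : ‖z‖ < r
  · rw [Set.indicator_of_notMem (by simpa using hzr)]
    exact zero_le
  · have hz0 : 0 < ‖z‖ := hr.trans_le (not_lt.1 hzr)
    rw [Set.indicator_of_mem (by simpa using hzr), Set.indicator_of_mem (Set.mem_Ici.2 (not_lt.1 hzr)),
      ← ofReal_norm, ← ENNReal.ofReal_inv_of_pos hz0,
      ENNReal.ofReal_rpow_of_nonneg (by positivity) (by norm_num),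
      Real.inv_rpow hz0.le, Real.rpow_neg hz0.le]

/-- The constant in the Hardy–Littlewood–Sobolev inequality. -/
def hlsConst : ℝ := 2 * (discConst + discConst ^ (1 / 4 : ℝ))

theorem hlsConst_nonneg : 0 ≤ hlsConst := by
  have := discConst_nonneg
  unfold hlsConst; positivity

/-- The near part is estimated with `h ≤ a`, the far part by Hölder with exponents `4/3` and `4`,
the kernel `1/|z|` being in `L⁴` away from the origin. -/
theorem lintegral_lower_part_le {h : Plane → ℝ≥0} (hh : Measurable h)
    (hB : ∫⁻ y, (h y : ℝ≥0∞) ^ (4 / 3 : ℝ) ≤ 1) (x : Plane) {a : ℝ≥0} (ha : 0 < a) :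
    ∫⁻ y in {y | h y ≤ a}, (h y : ℝ≥0∞) * ‖x - y‖ₑ⁻¹ ≤
      ENNReal.ofReal (discConst + discConst ^ (1 / 4 : ℝ)) * (a : ℝ≥0∞) ^ (1 / 3 : ℝ) := by
  have hD := discConst_nonneg
  -- This radius balances the two parts: the near one is of order `a·r`, the far one of order
  -- `r^{-1/2}`, and both equal `a^{1/3}`.
  set r : ℝ := (a : ℝ) ^ (-2 / 3 : ℝ) with hrdef
  have ha' : (0 : ℝ) < a := ha
  have hr : 0 < r := by positivity
  set b : Set Plane := {y | x - y ∈ Metric.ball 0 r} with hb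
  have hbm : MeasurableSet b := (measurable_const.sub measurable_id) measurableSet_ball
  have e1 : ∫⁻ y in b, ‖x - y‖ₑ⁻¹ ≤ ENNReal.ofReal (discConst * r) := by
    refine le_trans (le_of_eq ?_) (lintegral_ball_inv_norm_le hr)
    rw [← lintegral_indicator hbm, ← lintegral_indicator measurableSet_ball,
      ← lintegral_sub_left_eq_self ((Metric.ball 0 r).indicator _) x]
    rfl
  have e2 : ∫⁻ y in bᶜ, (‖x - y‖ₑ⁻¹) ^ (4 : ℝ) ≤ ENNReal.ofReal (discConst * r ^ (-2 : ℝ)) := by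
    refine le_trans (le_of_eq ?_) ((lintegral_compl_ball_inv_norm_pow_le hr).trans
      (ENNReal.ofReal_le_ofReal ?_))
    · rw [← lintegral_indicator hbm.compl, ← lintegral_indicator measurableSet_ball.compl,
        ← lintegral_sub_left_eq_self ((Metric.ball 0 r)ᶜ.indicator _) x]
      rfl
    · have : 0 ≤ r ^ (-2 : ℝ) := by positivity
      gcongr; linarith
  have hr1 : (a : ℝ) * r = (a : ℝ) ^ (1 / 3 : ℝ) := by
    nth_rewrite 1 [← Real.rpow_one (a : ℝ)]
    rw [hrdef, ← Real.rpow_add ha']; norm_num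
  have hr2 : (r ^ (-2 : ℝ)) ^ (1 / 4 : ℝ) = (a : ℝ) ^ (1 / 3 : ℝ) := by
    rw [hrdef, ← Real.rpow_mul ha'.le, ← Real.rpow_mul ha'.le]; norm_num
  have haE : (a : ℝ≥0∞) ^ (1 / 3 : ℝ) = ENNReal.ofReal ((a : ℝ) ^ (1 / 3 : ℝ)) := by
    rw [← ENNReal.ofReal_rpow_of_nonneg ha'.le (by norm_num), ENNReal.ofReal_coe_nnreal]
  have p1 : ∫⁻ y in {y | h y ≤ a} ∩ b, (h y : ℝ≥0∞) * ‖x - y‖ₑ⁻¹ ≤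
      ENNReal.ofReal (discConst * (a : ℝ) ^ (1 / 3 : ℝ)) := by
    calc ∫⁻ y in {y | h y ≤ a} ∩ b, (h y : ℝ≥0∞) * ‖x - y‖ₑ⁻¹
        ≤ ∫⁻ y in {y | h y ≤ a} ∩ b, (a : ℝ≥0∞) * ‖x - y‖ₑ⁻¹ := by
          refine setLIntegral_mono' ((measurableSet_le hh measurable_const).inter hbm) fun y hy => ?_
          gcongr
          exact hy.1
      _ ≤ ∫⁻ y in b, (a : ℝ≥0∞) * ‖x - y‖ₑ⁻¹ := lintegral_mono_set Set.inter_subset_right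
      _ = a * ∫⁻ y in b, ‖x - y‖ₑ⁻¹ := lintegral_const_mul _ (by fun_prop)
      _ ≤ a * ENNReal.ofReal (discConst * r) := by gcongr
      _ = _ := by
          rw [← ENNReal.ofReal_coe_nnreal, ← ENNReal.ofReal_mul ha'.le, ← hr1]
          ring_nf
  have p2 : ∫⁻ y in {y | h y ≤ a} ∩ bᶜ, (h y : ℝ≥0∞) * ‖x - y‖ₑ⁻¹ ≤
      ENNReal.ofReal (discConst ^ (1 / 4 : ℝ) * (a : ℝ) ^ (1 / 3 : ℝ)) := by
    calc ∫⁻ y in {y | h y ≤ a} ∩ bᶜ, (h y : ℝ≥0∞) * ‖x - y‖ₑ⁻¹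
        ≤ ∫⁻ y in bᶜ, (h y : ℝ≥0∞) * ‖x - y‖ₑ⁻¹ := lintegral_mono_set Set.inter_subset_right
      _ ≤ (∫⁻ y in bᶜ, (h y : ℝ≥0∞) ^ (4 / 3 : ℝ)) ^ (1 / (4 / 3) : ℝ) *
          (∫⁻ y in bᶜ, (‖x - y‖ₑ⁻¹) ^ (4 : ℝ)) ^ (1 / 4 : ℝ) :=
          ENNReal.lintegral_mul_le_Lp_mul_Lq _
            ((Real.holderConjugate_iff).2 ⟨by norm_num, by norm_num⟩)
            (by fun_prop) (by fun_prop)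
      _ ≤ 1 ^ (1 / (4 / 3) : ℝ) * ENNReal.ofReal (discConst * r ^ (-2 : ℝ)) ^ (1 / 4 : ℝ) := by
          gcongr
          exact (setLIntegral_le_lintegral _ _).trans hB
      _ = _ := by
          rw [ENNReal.one_rpow, one_mul, ENNReal.ofReal_rpow_of_nonneg (by positivity) (by norm_num),
            Real.mul_rpow hD (by positivity), hr2]
  rw [← lintegral_inter_add_sdiff _ _ hbm, Set.sdiff_eq]
  refine (add_le_add p1 p2).trans_eq ?_
  rw [← ENNReal.ofReal_add (by positivity) (by positivity), haE, ← ENNReal.ofReal_mul (by positivity)]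
  ring_nf

/-- The previous bound with `a = f(x)` leaves `f · f^{1/3} = f^{4/3}`, whose integral is at most
one. -/
theorem lintegral_lintegral_lower_part_le {f h : Plane → ℝ≥0} (hf : Measurable f)
    (hh : Measurable h) (hA : ∫⁻ y, (f y : ℝ≥0∞) ^ (4 / 3 : ℝ) ≤ 1)
    (hB : ∫⁻ y, (h y : ℝ≥0∞) ^ (4 / 3 : ℝ) ≤ 1) :
    ∫⁻ x, ∫⁻ y, {q : Plane × Plane | h q.2 ≤ f q.1}.indicator
        (fun q => (f q.1 : ℝ≥0∞) * (h q.2 * ‖q.1 - q.2‖ₑ⁻¹)) (x, y) ≤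
      ENNReal.ofReal (discConst + discConst ^ (1 / 4 : ℝ)) := by
  calc _ ≤ ∫⁻ x, ENNReal.ofReal (discConst + discConst ^ (1 / 4 : ℝ)) *
          (f x : ℝ≥0∞) ^ (4 / 3 : ℝ) := by
        refine lintegral_mono fun x => ?_
        rcases eq_or_ne (f x) 0 with h0 | h0
        · simp [Set.indicator_apply, h0]
        have h1 : ∀ y, {q : Plane × Plane | h q.2 ≤ f q.1}.indicator
            (fun q => (f q.1 : ℝ≥0∞) * (h q.2 * ‖q.1 - q.2‖ₑ⁻¹)) (x, y) =
            f x * {y | h y ≤ f x}.indicator (fun y => (h y : ℝ≥0∞) * ‖x - y‖ₑ⁻¹) y := fun y => by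
          simp only [Set.indicator_apply, Set.mem_ofPred_eq]
          split_ifs <;> simp
        simp_rw [h1]
        have hms : MeasurableSet {y | h y ≤ f x} := measurableSet_le hh measurable_const
        rw [lintegral_const_mul _ (Measurable.indicator (by fun_prop) hms), lintegral_indicator hms]
        calc (f x : ℝ≥0∞) * ∫⁻ y in {y | h y ≤ f x}, (h y : ℝ≥0∞) * ‖x - y‖ₑ⁻¹
            ≤ f x * (ENNReal.ofReal (discConst + discConst ^ (1 / 4 : ℝ)) *
                (f x : ℝ≥0∞) ^ (1 / 3 : ℝ)) := by
              gcongr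
              exact lintegral_lower_part_le hh hB x (pos_iff_ne_zero.2 h0)
          _ = _ := by
              rw [mul_left_comm]
              congr 1
              nth_rewrite 1 [← ENNReal.rpow_one (f x : ℝ≥0∞)]
              rw [← ENNReal.rpow_add_of_nonneg _ _ zero_le_one (by norm_num)]
              norm_num
    _ ≤ ENNReal.ofReal (discConst + discConst ^ (1 / 4 : ℝ)) * 1 := by
        rw [lintegral_const_mul _ (by fun_prop)]
        gcongr
    _ = _ := mul_one _

/-- Each pair `(x, y)` satisfies `h(y) ≤ f(x)` or `f(x) ≤ h(y)`. The two regions are exchanged by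
the symmetry of the kernel, so each contributes the same bound. -/
theorem hls_normalized {f h : Plane → ℝ≥0} (hf : Measurable f)
    (hh : Measurable h) (hA : ∫⁻ y, (f y : ℝ≥0∞) ^ (4 / 3 : ℝ) ≤ 1)
    (hB : ∫⁻ y, (h y : ℝ≥0∞) ^ (4 / 3 : ℝ) ≤ 1) :
    ∫⁻ x, f x * ∫⁻ y, (h y : ℝ≥0∞) * ‖x - y‖ₑ⁻¹ ≤ ENNReal.ofReal hlsConst := by
  have hm : ∀ {f h : Plane → ℝ≥0}, Measurable f → Measurable h → Measurable
      ({q : Plane × Plane | h q.2 ≤ f q.1}.indicator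
        (fun q => (f q.1 : ℝ≥0∞) * (h q.2 * ‖q.1 - q.2‖ₑ⁻¹))) := fun hf hh =>
    Measurable.indicator (by fun_prop) (measurableSet_le (by fun_prop) (by fun_prop))
  calc _ ≤ ∫⁻ x, ∫⁻ y, ({q : Plane × Plane | h q.2 ≤ f q.1}.indicator
        (fun q => (f q.1 : ℝ≥0∞) * (h q.2 * ‖q.1 - q.2‖ₑ⁻¹)) (x, y) +
        {q : Plane × Plane | f q.2 ≤ h q.1}.indicator
        (fun q => (h q.1 : ℝ≥0∞) * (f q.2 * ‖q.1 - q.2‖ₑ⁻¹)) (y, x)) := by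
        refine lintegral_mono fun x => ?_
        rw [← lintegral_const_mul _ (by fun_prop)]
        refine lintegral_mono fun y => ?_
        simp only [Set.indicator_apply, Set.mem_ofPred_eq]
        rcases le_total (h y) (f x) with hle | hle
        · rw [if_pos hle]; exact le_self_add
        · rw [if_pos hle, enorm_sub_rev y x, mul_left_comm (h y : ℝ≥0∞)]; exact le_add_self
    _ ≤ ENNReal.ofReal (discConst + discConst ^ (1 / 4 : ℝ)) +
        ENNReal.ofReal (discConst + discConst ^ (1 / 4 : ℝ)) := by
        have hm1 := hm hf hh
        have hm2 := hm hh hf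
        have hm3 : Measurable fun q : Plane × Plane => {q : Plane × Plane | f q.2 ≤ h q.1}.indicator
            (fun q => (h q.1 : ℝ≥0∞) * (f q.2 * ‖q.1 - q.2‖ₑ⁻¹)) (q.2, q.1) :=
          hm2.comp measurable_swap
        have e : ∀ x, ∫⁻ y, ({q : Plane × Plane | h q.2 ≤ f q.1}.indicator
            (fun q => (f q.1 : ℝ≥0∞) * (h q.2 * ‖q.1 - q.2‖ₑ⁻¹)) (x, y) +
            {q : Plane × Plane | f q.2 ≤ h q.1}.indicator
            (fun q => (h q.1 : ℝ≥0∞) * (f q.2 * ‖q.1 - q.2‖ₑ⁻¹)) (y, x)) = _ := fun x =>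
          lintegral_add_left (hm1.comp measurable_prodMk_left) _
        refine (lintegral_congr e).trans_le
          ((lintegral_add_left hm1.lintegral_prod_right' _).trans_le ?_)
        refine add_le_add (lintegral_lintegral_lower_part_le hf hh hA hB) ?_
        rw [lintegral_lintegral_swap hm3.aemeasurable]
        exact lintegral_lintegral_lower_part_le hh hf hB hA
    _ = _ := by
        have := discConst_nonneg
        rw [← ENNReal.ofReal_add (by positivity) (by positivity), hlsConst]
        ring_nf

theorem lintegral_rpow_coeFn_le_one {u : L43} (hu : ‖u‖ ≤ 1) :
    ∫⁻ y, (‖u y‖₊ : ℝ≥0∞) ^ (4 / 3 : ℝ) ≤ 1 := by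
  have h : eLpNorm u (4 / 3) volume ≤ 1 := by
    rw [← Lp.enorm_def, ← ofReal_norm]
    exact ENNReal.ofReal_le_one.2 hu
  rw [eLpNorm_four_thirds_eq] at h
  by_contra! hlt
  exact absurd h (not_le.2 (ENNReal.one_lt_rpow hlt (by norm_num)))

theorem hls_unit {u v : L43} (hu : ‖u‖ ≤ 1) (hv : ‖v‖ ≤ 1) :
    ∫⁻ x, ‖u x‖ₑ * ∫⁻ y, ‖v y‖ₑ * ‖x - y‖ₑ⁻¹ ≤ ENNReal.ofReal hlsConst :=
  hls_normalized (Lp.stronglyMeasurable u).measurable.nnnorm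
    (Lp.stronglyMeasurable v).measurable.nnnorm
    (lintegral_rpow_coeFn_le_one hu) (lintegral_rpow_coeFn_le_one hv)

theorem enorm_coeFn_eq_mul_normalized (u : L43) :
    ∀ᵐ x, ‖u x‖ₑ = ‖u‖ₑ * ‖(‖u‖⁻¹ • u : L43) x‖ₑ := by
  filter_upwards [Lp.coeFn_smul ‖u‖⁻¹ u, Lp.coeFn_zero ℝ (4 / 3) (volume : Measure Plane)]
    with x hx h0
  rw [hx, Pi.smul_apply, enorm_smul, ← mul_assoc]
  rcases eq_or_ne u 0 with rfl | hu
  · simp only [h0, Pi.zero_apply, enorm_zero, zero_mul]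
  · rw [enorm_inv (norm_ne_zero_iff.2 hu), enorm_norm,
      ENNReal.mul_inv_cancel (by simpa using hu) (by simp), one_mul]

theorem norm_normalized_le (u : L43) : ‖‖u‖⁻¹ • u‖ ≤ 1 := by
  rw [norm_smul, norm_inv, norm_norm]
  exact inv_mul_le_one

/-- The **Hardy–Littlewood–Sobolev inequality** for the kernel `1 / |x - y|` and the exponents
`4/3`, `4/3` in the plane. -/
theorem hls (u v : L43) :
    ∫⁻ x, ‖u x‖ₑ * ∫⁻ y, ‖v y‖ₑ * ‖x - y‖ₑ⁻¹ ≤ ENNReal.ofReal hlsConst * (‖u‖ₑ * ‖v‖ₑ) := by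
  have hvm : Measurable fun y => ‖(‖v‖⁻¹ • v : L43) y‖ₑ := (Lp.stronglyMeasurable _).enorm
  have hum : Measurable fun y => ‖(‖u‖⁻¹ • u : L43) y‖ₑ := (Lp.stronglyMeasurable _).enorm
  have h1 : ∀ x, ∫⁻ y, ‖v y‖ₑ * ‖x - y‖ₑ⁻¹ =
      ‖v‖ₑ * ∫⁻ y, ‖(‖v‖⁻¹ • v : L43) y‖ₑ * ‖x - y‖ₑ⁻¹ := fun x => by
    rw [← lintegral_const_mul _ (by fun_prop)]
    refine lintegral_congr_ae ?_
    filter_upwards [enorm_coeFn_eq_mul_normalized v] with y hy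
    rw [hy, mul_assoc]
  have hm2 : Measurable fun x => ∫⁻ y, ‖(‖v‖⁻¹ • v : L43) y‖ₑ * ‖x - y‖ₑ⁻¹ :=
    Measurable.lintegral_prod_right' (f := fun q : Plane × Plane =>
      ‖(‖v‖⁻¹ • v : L43) q.2‖ₑ * ‖q.1 - q.2‖ₑ⁻¹) (by fun_prop)
  calc ∫⁻ x, ‖u x‖ₑ * ∫⁻ y, ‖v y‖ₑ * ‖x - y‖ₑ⁻¹
      = ∫⁻ x, (‖u‖ₑ * ‖v‖ₑ) *
          (‖(‖u‖⁻¹ • u : L43) x‖ₑ * ∫⁻ y, ‖(‖v‖⁻¹ • v : L43) y‖ₑ * ‖x - y‖ₑ⁻¹) := by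
        refine lintegral_congr_ae ?_
        filter_upwards [enorm_coeFn_eq_mul_normalized u] with x hx
        rw [hx, h1, mul_mul_mul_comm]
    _ = (‖u‖ₑ * ‖v‖ₑ) * ∫⁻ x, ‖(‖u‖⁻¹ • u : L43) x‖ₑ *
          ∫⁻ y, ‖(‖v‖⁻¹ • v : L43) y‖ₑ * ‖x - y‖ₑ⁻¹ := lintegral_const_mul _ (hum.mul hm2)
    _ ≤ (‖u‖ₑ * ‖v‖ₑ) * ENNReal.ofReal hlsConst := by
        gcongr
        exact hls_unit (norm_normalized_le u) (norm_normalized_le v)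
    _ = _ := mul_comm _ _

/-! ### The flux `u ∇φ_v` as a bilinear map `L^{4/3} × L^{4/3} → L^1` -/

/-- Integrable vector fields on the plane. -/
abbrev L1Field : Type := Lp Plane 1 (volume : Measure Plane)

theorem gradPotential_eq_convFun (v : Plane → ℝ) (x : Plane) :
    gradPotential v x = -convFun (ContinuousLinearMap.lsmul ℝ ℝ).flip (gradient E₂) v x := rfl

theorem gradPotential_congr_ae {v v' : Plane → ℝ} (h : v =ᵐ[volume] v') :
    gradPotential v = gradPotential v' := by
  ext1 x
  rw [gradPotential_eq_convFun, gradPotential_eq_convFun, convFun_congr_ae _ (ae_eq_refl _) h]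

theorem aestronglyMeasurable_gradPotential {v : Plane → ℝ} (hv : AEStronglyMeasurable v) :
    AEStronglyMeasurable (gradPotential v) := by
  have h := aestronglyMeasurable_convFun (ContinuousLinearMap.lsmul ℝ ℝ).flip
    measurable_gradient_E₂.stronglyMeasurable.aestronglyMeasurable hv
  exact h.neg.congr (.of_forall fun x => (gradPotential_eq_convFun v x).symm)

theorem enorm_smul_gradient_E₂_le (v : Plane → ℝ) (x y : Plane) :
    ‖v y • gradient E₂ (x - y)‖ₑ ≤ ‖v y‖ₑ * ‖x - y‖ₑ⁻¹ := by
  rw [enorm_smul]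
  gcongr
  exact enorm_gradient_E₂_le _

theorem enorm_gradPotential_le (v : Plane → ℝ) (x : Plane) :
    ‖gradPotential v x‖ₑ ≤ ∫⁻ y, ‖v y‖ₑ * ‖x - y‖ₑ⁻¹ := by
  rw [gradPotential, enorm_neg]
  exact (enorm_integral_le_lintegral_enorm _).trans
    (lintegral_mono fun y => enorm_smul_gradient_E₂_le v x y)

theorem measurable_lintegral_riesz (v : L43) :
    Measurable fun x : Plane => ∫⁻ y, ‖v y‖ₑ * ‖x - y‖ₑ⁻¹ := by
  have hvm : Measurable fun y => ‖v y‖ₑ := (Lp.stronglyMeasurable _).enorm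
  exact Measurable.lintegral_prod_right' (f := fun q : Plane × Plane =>
      ‖v q.2‖ₑ * ‖q.1 - q.2‖ₑ⁻¹) (by fun_prop)

/-- The Hardy–Littlewood–Sobolev inequality is tested with a Gaussian in the outer variable. Since
the Gaussian is positive everywhere, finiteness of the double integral forces finiteness of the
inner one almost everywhere. -/
theorem ae_integrable_smul_gradient_E₂ (v : L43) :
    ∀ᵐ x : Plane, Integrable fun y => v y • gradient E₂ (x - y) := by
  set g : L43 := (memLp_gaussKernel one_pos).toLp
  have hvm := measurable_lintegral_riesz v
  have hgm : Measurable fun y => ‖g y‖ₑ := (Lp.stronglyMeasurable _).enorm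
  have h := (hls g v).trans_lt (by finiteness)
  filter_upwards [ae_lt_top (hgm.mul hvm) h.ne, (memLp_gaussKernel one_pos).coeFn_toLp]
    with x hx hg
  have hg0 : ‖g x‖ₑ ≠ 0 := by
    rw [hg]; simpa using (gaussKernel_pos one_pos x).ne'
  refine ⟨(Lp.stronglyMeasurable v).aestronglyMeasurable.smul
    (measurable_gradient_E₂.comp (measurable_const.sub measurable_id)).aestronglyMeasurable, ?_⟩
  refine (lintegral_mono fun y => enorm_smul_gradient_E₂_le v x y).trans_lt ?_
  exact ENNReal.lt_top_of_mul_ne_top_right hx.ne hg0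

theorem gradPotential_add (v w : L43) :
    gradPotential (v + w : L43) =ᵐ[volume] gradPotential v + gradPotential w := by
  rw [gradPotential_congr_ae (Lp.coeFn_add v w)]
  filter_upwards [ae_integrable_smul_gradient_E₂ v, ae_integrable_smul_gradient_E₂ w] with x h1 h2
  simp only [Pi.add_apply, gradPotential]
  rw [← neg_add, ← integral_add h1 h2]
  simp [add_smul]

theorem gradPotential_smul (c : ℝ) (v : L43) :
    gradPotential (c • v : L43) = c • gradPotential v := by
  rw [gradPotential_congr_ae (Lp.coeFn_smul c v)]
  ext1 x
  simp only [Pi.smul_apply, gradPotential]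
  rw [smul_neg, ← integral_smul]
  simp [mul_smul]

theorem eLpNorm_flux_le (u v : L43) :
    eLpNorm (fun y => u y • gradPotential v y) 1 volume ≤
      ENNReal.ofReal hlsConst * (‖u‖ₑ * ‖v‖ₑ) := by
  refine le_trans ?_ (hls u v)
  rw [eLpNorm_one_eq_lintegral_enorm]
  refine lintegral_mono fun x => ?_
  rw [enorm_smul]
  gcongr
  exact enorm_gradPotential_le _ _

theorem memLp_flux (u v : L43) : MemLp (fun y => u y • gradPotential v y) 1 volume :=
  ⟨(Lp.aestronglyMeasurable u).smul (aestronglyMeasurable_gradPotential (Lp.aestronglyMeasurable v)),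
    (eLpNorm_flux_le u v).trans_lt (by finiteness)⟩

/-- The flux `(u, v) ↦ u ∇φ_v` as a continuous bilinear map `L^{4/3} × L^{4/3} → L^1`. -/
def flux : L43 →L[ℝ] L43 →L[ℝ] L1Field :=
  LinearMap.mkContinuous₂
    (LinearMap.mk₂ ℝ (fun u v => (memLp_flux u v).toLp)
      (fun u u' v => by
        rw [← MemLp.toLp_add]
        refine MemLp.toLp_congr _ _ ?_
        filter_upwards [Lp.coeFn_add u u'] with x hx
        rw [hx]
        exact add_smul _ _ _)
      (fun c u v => by
        rw [← MemLp.toLp_const_smul]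
        refine MemLp.toLp_congr _ _ ?_
        filter_upwards [Lp.coeFn_smul c u] with x hx
        rw [hx]
        exact mul_smul _ _ _)
      (fun u v v' => by
        rw [← MemLp.toLp_add]
        refine MemLp.toLp_congr _ _ ?_
        filter_upwards [gradPotential_add v v'] with x hx
        rw [hx]
        exact smul_add _ _ _)
      (fun c u v => by
        rw [← MemLp.toLp_const_smul]
        refine MemLp.toLp_congr _ _ (.of_forall fun x => ?_)
        simp only [gradPotential_smul, Pi.smul_apply]
        rw [smul_comm]))
    hlsConst (fun u v => by
      rw [LinearMap.mk₂_apply, Lp.norm_toLp, mul_assoc]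
      refine ENNReal.toReal_le_of_le_ofReal (by have := hlsConst_nonneg; positivity)
        ((eLpNorm_flux_le u v).trans_eq ?_)
      rw [ENNReal.ofReal_mul hlsConst_nonneg, ENNReal.ofReal_mul (norm_nonneg _), ofReal_norm,
        ofReal_norm])

theorem coeFn_flux (u v : L43) : flux u v =ᵐ[volume] fun y => u y • gradPotential v y :=
  MemLp.coeFn_toLp (memLp_flux u v)

theorem norm_flux_le (u v : L43) : ‖flux u v‖ ≤ hlsConst * ‖u‖ * ‖v‖ := by
  refine (flux.le_opNorm₂ u v).trans ?_
  gcongr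
  exact LinearMap.mkContinuous₂_norm_le _ hlsConst_nonneg _

/-! ### Continuity of the kernels in time -/

/-- Dominated convergence applied to the `p`-th powers. It is used for Gaussian kernels near a fixed
positive time. -/
theorem tendsto_eLpNorm_sub_of_dominated {ι E : Type*} [NormedAddCommGroup E] {l : Filter ι}
    [l.IsCountablyGenerated] {p : ℝ≥0∞} (hp : p ≠ 0) (hp' : p ≠ ∞) {F : ι → Plane → E}
    {f : Plane → E} {b : Plane → ℝ} (hb : MemLp b p) (hf : AEStronglyMeasurable f)
    (hF : ∀ᶠ i in l, AEStronglyMeasurable (F i)) (hFb : ∀ᶠ i in l, ∀ z, ‖F i z - f z‖ ≤ b z)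
    (hlim : ∀ z, Tendsto (fun i => F i z) l (𝓝 (f z))) :
    Tendsto (fun i => eLpNorm (fun z => F i z - f z) p) l (𝓝 0) := by
  have hpr : 0 < p.toReal := ENNReal.toReal_pos hp hp'
  simp_rw [eLpNorm_eq_lintegral_rpow_enorm_toReal hp hp']
  have h : Tendsto (fun i => ∫⁻ z, ‖F i z - f z‖ₑ ^ p.toReal) l (𝓝 (∫⁻ _ : Plane, 0)) := by
    refine tendsto_lintegral_filter_of_dominated_convergence' (fun z => ‖b z‖ₑ ^ p.toReal)
      ?_ ?_ ?_ ?_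
    · filter_upwards [hF] with i hi
      exact (hi.sub hf).enorm.pow_const _
    · filter_upwards [hFb] with i hi
      refine .of_forall fun z => ?_
      gcongr
      rw [← ofReal_norm, ← ofReal_norm]
      exact ENNReal.ofReal_le_ofReal ((hi z).trans (le_abs_self _))
    · exact (lintegral_rpow_enorm_lt_top_of_eLpNorm_lt_top hp hp' hb.2).ne
    · refine .of_forall fun z => ?_
      have h1 : Tendsto (fun i => ‖F i z - f z‖ₑ) l (𝓝 0) := by
        have := ((hlim z).sub_const (f z)).enorm
        simpa using this
      have := h1.ennrpow_const p.toReal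
      rwa [ENNReal.zero_rpow_of_pos hpr] at this
  rw [lintegral_zero] at h
  have := h.ennrpow_const (1 / p.toReal)
  rwa [ENNReal.zero_rpow_of_pos (by positivity)] at this

theorem memLp_gaussKernel' {t : ℝ} (ht : 0 < t) (p : ℝ≥0∞) :
    MemLp (gaussKernel t) p (volume : Measure Plane) := by
  have h := (heatTest t ht 0).memLp p (volume : Measure Plane)
  refine h.ae_eq (.of_forall fun y => ?_)
  rw [heatTest_apply, zero_sub, gaussKernel_neg]

theorem memLp_gradient_gaussKernel {t : ℝ} (ht : 0 < t) (p : ℝ≥0∞) :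
    MemLp (gradient (gaussKernel t)) p (volume : Measure Plane) :=
  ⟨(continuous_gradient_gaussKernel ht).aestronglyMeasurable,
    (eLpNorm_gradient_gaussKernel_le ht p).trans_lt
      (ENNReal.mul_lt_top ENNReal.ofReal_lt_top (memLp_gaussKernel' (by positivity) p).2)⟩

/-- The exponential increases with time, and the quotient `b/a` compensates the prefactor. A single
later Gaussian therefore dominates the kernels at all times near a given one. -/
theorem gaussKernel_le_mul {a b : ℝ} (ha : 0 < a) (hab : a ≤ b) (z : Plane) :
    gaussKernel a z ≤ b / a * gaussKernel b z := by
  have hb : 0 < b := ha.trans_le hab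
  have hpi := Real.pi_pos
  simp only [gaussKernel]
  rw [← mul_assoc, show b / a * (1 / (4 * Real.pi * b)) = 1 / (4 * Real.pi * a) by field_simp]
  gcongr 1 / (4 * Real.pi * a) * Real.exp ?_
  rw [neg_div, neg_div]
  exact neg_le_neg (by gcongr)

theorem continuousAt_gaussKernel_left {a : ℝ} (ha : 0 < a) (z : Plane) :
    ContinuousAt (fun s => gaussKernel s z) a := by
  unfold gaussKernel
  have := Real.pi_pos
  refine ContinuousAt.mul (continuousAt_const.div (by fun_prop) (by positivity)) ?_
  exact (continuousAt_const.div (by fun_prop) (by positivity)).rexp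

theorem eventually_half_le_two_mul {a : ℝ} (ha : 0 < a) : ∀ᶠ s in 𝓝 a, a / 2 < s ∧ s < 2 * a :=
  (lt_mem_nhds (by linarith)).and (gt_mem_nhds (by linarith))

theorem tendsto_eLpNorm_gaussKernel_sub {a : ℝ} (ha : 0 < a) {p : ℝ≥0∞} (hp : p ≠ 0)
    (hp' : p ≠ ∞) :
    Tendsto (fun s => eLpNorm (fun z => gaussKernel s z - gaussKernel a z) p volume) (𝓝 a)
      (𝓝 0) := by
  refine tendsto_eLpNorm_sub_of_dominated hp hp'
    ((memLp_gaussKernel' (t := 2 * a) (by positivity) p).const_mul 6)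
    (continuous_gaussKernel a).aestronglyMeasurable
    (.of_forall fun s => (continuous_gaussKernel s).aestronglyMeasurable) ?_
    (fun z => continuousAt_gaussKernel_left ha z)
  filter_upwards [eventually_half_le_two_mul ha] with s ⟨hs1, hs2⟩ z
  have hs0 : 0 < s := by linarith
  have h1 := gaussKernel_le_mul hs0 hs2.le z
  have h2 := gaussKernel_le_mul ha (by linarith : a ≤ 2 * a) z
  have h3 : 2 * a / s ≤ 4 := by rw [div_le_iff₀ hs0]; linarith
  have h4 : 2 * a / a = 2 := by field_simp
  have h5 := gaussKernel_nonneg (t := 2 * a) (by positivity) z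
  rw [h4] at h2
  refine (norm_sub_le _ _).trans ?_
  rw [Real.norm_of_nonneg (gaussKernel_nonneg hs0 z), Real.norm_of_nonneg (gaussKernel_nonneg ha z)]
  nlinarith

theorem tendsto_eLpNorm_gradient_gaussKernel_sub {a : ℝ} (ha : 0 < a) {p : ℝ≥0∞} (hp : p ≠ 0)
    (hp' : p ≠ ∞) :
    Tendsto (fun s => eLpNorm (fun z => gradient (gaussKernel s) z - gradient (gaussKernel a) z)
      p volume) (𝓝 a) (𝓝 0) := by
  have hev := eventually_half_le_two_mul ha
  have hb : ∀ s, a / 2 ≤ s → s ≤ 2 * a → ∀ z, ‖gradient (gaussKernel s) z‖ ≤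
      8 * (a / 2) ^ (-1 / 2 : ℝ) * gaussKernel (4 * a) z := fun s hs1 hs2 z => by
    have hs0 : 0 < s := by linarith
    refine (norm_gradient_gaussKernel_le hs0 z).trans ?_
    have h1 := gaussKernel_le_mul (a := 2 * s) (b := 4 * a) (by positivity) (by linarith) z
    have h3 : 4 * a / (2 * s) ≤ 4 := by rw [div_le_iff₀ (by positivity)]; linarith
    have h5 := gaussKernel_nonneg (t := 4 * a) (by positivity) z
    have h6 : s ^ (-1 / 2 : ℝ) ≤ (a / 2) ^ (-1 / 2 : ℝ) :=
      Real.rpow_le_rpow_of_nonpos (by positivity) hs1 (by norm_num)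
    have h7 : gaussKernel (2 * s) z ≤ 4 * gaussKernel (4 * a) z := by nlinarith
    have h8 := gaussKernel_nonneg (t := 2 * s) (by positivity) z
    calc 2 * s ^ (-1 / 2 : ℝ) * gaussKernel (2 * s) z
        ≤ 2 * (a / 2) ^ (-1 / 2 : ℝ) * (4 * gaussKernel (4 * a) z) := by gcongr
      _ = _ := by ring
  refine tendsto_eLpNorm_sub_of_dominated hp hp'
    ((memLp_gaussKernel' (t := 4 * a) (by positivity) p).const_mul
      (16 * (a / 2) ^ (-1 / 2 : ℝ)))
    (continuous_gradient_gaussKernel ha).aestronglyMeasurable ?_ ?_ ?_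
  · filter_upwards [lt_mem_nhds ha] with s hs
    exact (continuous_gradient_gaussKernel hs).aestronglyMeasurable
  · filter_upwards [hev] with s ⟨hs1, hs2⟩ z
    refine (norm_sub_le _ _).trans ?_
    linarith [hb s hs1.le hs2.le z, hb a (by linarith) (by linarith) z]
  · intro z
    have h : Tendsto (fun s => -(gaussKernel s z / (2 * s)) • z) (𝓝 a)
        (𝓝 (-(gaussKernel a z / (2 * a)) • z)) :=
      (((continuousAt_gaussKernel_left ha z).div (by fun_prop) (by positivity)).neg).smul
        continuousAt_const
    rw [gradient_gaussKernel ha]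
    refine h.congr' ?_
    filter_upwards [lt_mem_nhds ha] with s hs
    rw [gradient_gaussKernel hs]

instance fact_one_ne_top : Fact ((1 : ℝ≥0∞) ≠ ∞) := ⟨by simp⟩

instance fact_four_thirds_ne_top : Fact ((4 / 3 : ℝ≥0∞) ≠ ∞) := ⟨four_thirds_ne_top⟩

section GradHeat

variable (p : ℝ≥0∞)

/-- The kernel `∇G(·, s)`, `s > 0`, as an element of `L^p`. -/
def gradHeat (s : ℝ) : Lp Plane p (volume : Measure Plane) :=
  open Classical in if hs : 0 < s then (memLp_gradient_gaussKernel hs p).toLp else 0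

theorem coeFn_gradHeat {s : ℝ} (hs : 0 < s) :
    gradHeat p s =ᵐ[volume] gradient (gaussKernel s) := by
  rw [gradHeat, dif_pos hs]
  exact MemLp.coeFn_toLp _

theorem gradHeat_of_nonpos {s : ℝ} (hs : s ≤ 0) : gradHeat p s = 0 := dif_neg hs.not_gt

theorem norm_gradHeat {s : ℝ} (hs : 0 < s) :
    ‖gradHeat p s‖ = (eLpNorm (gradient (gaussKernel s)) p volume).toReal := by
  rw [gradHeat, dif_pos hs, Lp.norm_toLp]

theorem norm_gradHeat_one_le {s : ℝ} (hs : 0 < s) : ‖gradHeat 1 s‖ ≤ 2 * s ^ (-(1 / 2) : ℝ) := by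
  rw [norm_gradHeat 1 hs]
  refine ENNReal.toReal_le_of_le_ofReal (by positivity) ?_
  simpa [neg_div] using eLpNorm_one_gradient_gaussKernel_le hs

theorem norm_gradHeat_four_thirds_le {s : ℝ} (hs : 0 < s) :
    ‖gradHeat (4 / 3) s‖ ≤ 2 * gaussConst * s ^ (-(3 / 4) : ℝ) := by
  rw [norm_gradHeat _ hs]
  have := gaussConst_pos
  refine ENNReal.toReal_le_of_le_ofReal (by positivity) ?_
  simpa [neg_div] using eLpNorm_four_thirds_gradient_gaussKernel_le hs

theorem continuousOn_gradHeat [Fact (1 ≤ p)] [hp' : Fact (p ≠ ∞)] :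
    ContinuousOn (gradHeat p) (Set.Ioi 0) := by
  intro a ha
  refine ContinuousAt.continuousWithinAt ?_
  rw [Set.mem_Ioi] at ha
  have hp : p ≠ 0 := (zero_lt_one.trans_le (Fact.out : 1 ≤ p)).ne'
  rw [ContinuousAt, tendsto_iff_edist_tendsto_0]
  refine (tendsto_eLpNorm_gradient_gaussKernel_sub ha hp hp'.out).congr' ?_
  filter_upwards [lt_mem_nhds ha] with s hs
  rw [gradHeat, gradHeat, dif_pos hs, dif_pos ha, Lp.edist_toLp_toLp]
  rfl

theorem stronglyMeasurable_gradHeat [Fact (1 ≤ p)] [hp' : Fact (p ≠ ∞)] :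
    StronglyMeasurable (gradHeat p) := by
  refine stronglyMeasurable_of_restrict_of_restrict_compl (s := Set.Ioi 0) measurableSet_Ioi
    (continuousOn_gradHeat p).domRestrict.stronglyMeasurable ?_
  have : (Set.Ioi (0 : ℝ))ᶜ.domRestrict (gradHeat p) = fun _ => 0 := by
    ext1 s
    exact gradHeat_of_nonpos p (not_lt.1 s.2)
  rw [this]
  exact stronglyMeasurable_const

end GradHeat

/-! ### Bochner integrals in `L^p` are computed pointwise -/

theorem one_sub_one_div_toReal_nonneg {p : ℝ≥0∞} (hp : 1 ≤ p) : 0 ≤ 1 - 1 / p.toReal := by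
  rcases eq_or_ne p ∞ with rfl | hp'
  · simp
  · have : 1 ≤ p.toReal := by
      rw [← ENNReal.toReal_one]; exact ENNReal.toReal_mono hp' hp
    rw [sub_nonneg, div_le_one (by linarith)]
    exact this

section Evaluation

variable {T : Type*} [MeasurableSpace T] {μ : Measure T} [SFinite μ] {p : ℝ≥0∞}
  [hp : Fact (1 ≤ p)]

theorem setLIntegral_enorm_le {A : Set Plane} (f : Lp ℝ p (volume : Measure Plane)) :
    ∫⁻ x in A, ‖f x‖ₑ ≤
      ‖f‖ₑ * (volume A) ^ (1 - 1 / p.toReal) := by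
  have h := eLpNorm_le_eLpNorm_mul_rpow_measure_univ (μ := volume.restrict A) (f := f) hp.out
    (Lp.aestronglyMeasurable f).restrict
  rw [eLpNorm_one_eq_lintegral_enorm, Measure.restrict_apply_univ] at h
  simp only [ENNReal.toReal_one, div_one] at h
  refine h.trans ?_
  gcongr
  rw [Lp.enorm_def]
  exact eLpNorm_mono_measure _ Measure.restrict_le_self

theorem integrableOn_coeFn {A : Set Plane} (hA : volume A < ∞)
    (f : Lp ℝ p (volume : Measure Plane)) : IntegrableOn f A := by
  have := (Lp.memLp f).restrict A
  have : IsFiniteMeasure (volume.restrict A) := ⟨by simpa using hA⟩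
  exact ((Lp.memLp f).restrict A).integrable hp.out

/-- Integration over a set of finite measure as a continuous functional on `L^p`. -/
def setIntegralCLM {A : Set Plane} (hA : volume A < ∞) :
    Lp ℝ p (volume : Measure Plane) →L[ℝ] ℝ :=
  LinearMap.mkContinuous
    { toFun f := ∫ x in A, f x
      map_add' f g := by
        rw [← integral_add (integrableOn_coeFn hA f) (integrableOn_coeFn hA g)]
        exact integral_congr_ae (ae_restrict_of_ae (Lp.coeFn_add f g))
      map_smul' c f := by
        rw [RingHom.id_apply, ← integral_smul]
        exact integral_congr_ae (ae_restrict_of_ae (Lp.coeFn_smul c f)) }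
    ((volume A) ^ (1 - 1 / p.toReal)).toReal (fun f => by
      change ‖∫ x in A, f x‖ ≤ _
      refine (norm_integral_le_lintegral_norm _).trans ?_
      simp only [ofReal_norm]
      rw [mul_comm, ← toReal_enorm f, ← ENNReal.toReal_mul]
      have hpr := one_sub_one_div_toReal_nonneg hp.out
      exact ENNReal.toReal_mono (ENNReal.mul_ne_top (by simp)
        (ENNReal.rpow_ne_top_of_nonneg hpr hA.ne)) (setLIntegral_enorm_le f))

theorem setIntegralCLM_apply {A : Set Plane} (hA : volume A < ∞)
    (f : Lp ℝ p (volume : Measure Plane)) : setIntegralCLM hA f = ∫ x in A, f x := rfl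

/-- Integrals over sets of finite measure are continuous functionals on `L^p`, so they commute with
the Bochner integral; Fubini then shows that both sides have the same integral over each such set.
Integrability in `τ` for almost every `x` comes from exhausting the plane by balls. -/
theorem coeFn_integral {f : T → Lp ℝ p (volume : Measure Plane)} (hf : Integrable f μ)
    {φ : T × Plane → ℝ} (hφ : AEStronglyMeasurable φ (μ.prod volume))
    (hfφ : ∀ᵐ τ ∂μ, f τ =ᵐ[volume] fun x => φ (τ, x)) :
    ∀ᵐ x, Integrable (fun τ => φ (τ, x)) μ ∧ (∫ τ, f τ ∂μ) x = ∫ τ, φ (τ, x) ∂μ := by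
  have hpr := one_sub_one_div_toReal_nonneg hp.out
  have hint : ∀ A : Set Plane, volume A < ∞ → Integrable φ (μ.prod (volume.restrict A)) := by
    intro A hA
    have hφA : AEStronglyMeasurable φ (μ.prod (volume.restrict A)) :=
      hφ.mono_ac (Measure.AbsolutelyContinuous.prod Measure.AbsolutelyContinuous.rfl
        Measure.restrict_le_self.absolutelyContinuous)
    refine ⟨hφA, ?_⟩
    rw [hasFiniteIntegral_iff_enorm, lintegral_prod _ hφA.enorm]
    calc ∫⁻ τ, (∫⁻ x in A, ‖φ (τ, x)‖ₑ) ∂μ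
        ≤ ∫⁻ τ, ‖f τ‖ₑ * (volume A) ^ (1 - 1 / p.toReal) ∂μ := by
          refine lintegral_mono_ae ?_
          filter_upwards [hfφ] with τ hτ
          refine le_trans (le_of_eq ?_) (setLIntegral_enorm_le (A := A) (f τ))
          refine lintegral_congr_ae (ae_restrict_of_ae ?_)
          filter_upwards [hτ] with x hx
          rw [hx]
      _ = (∫⁻ τ, ‖f τ‖ₑ ∂μ) * (volume A) ^ (1 - 1 / p.toReal) :=
          lintegral_mul_const'' _ hf.1.enorm
      _ < ∞ := ENNReal.mul_lt_top hf.2 (ENNReal.rpow_ne_top_of_nonneg hpr hA.ne).lt_top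
  have h1 : ∀ᵐ x, Integrable (fun τ => φ (τ, x)) μ := by
    have : ∀ n : ℕ, ∀ᵐ x ∂(volume.restrict (Metric.ball (0 : Plane) n)),
        Integrable (fun τ => φ (τ, x)) μ := fun n =>
      (hint _ measure_ball_lt_top).prod_left_ae
    have h2 : ∀ᵐ x : Plane, ∀ n : ℕ, x ∈ Metric.ball (0 : Plane) n →
        Integrable (fun τ => φ (τ, x)) μ :=
      ae_all_iff.2 fun n => (ae_restrict_iff' measurableSet_ball).1 (this n)
    filter_upwards [h2] with x hx
    obtain ⟨n, hn⟩ := exists_nat_gt ‖x‖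
    exact hx n (by simpa using hn)
  have h2 : (fun x => (∫ τ, f τ ∂μ) x) =ᵐ[volume] fun x => ∫ τ, φ (τ, x) ∂μ := by
    refine ae_eq_of_forall_setIntegral_eq_of_sigmaFinite
      (fun A _ hA => integrableOn_coeFn hA _)
      (fun A _ hA => (hint A hA).integral_prod_right) fun A _ hA => ?_
    rw [← setIntegralCLM_apply hA, ← ContinuousLinearMap.integral_comp_comm _ hf,
      integral_integral_swap (f := fun x τ => φ (τ, x)) (hint A hA).swap]
    refine integral_congr_ae ?_
    filter_upwards [hfφ] with τ hτ
    rw [setIntegralCLM_apply]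
    exact integral_congr_ae (ae_restrict_of_ae hτ)
  filter_upwards [h1, h2] with x hx1 hx2
  exact ⟨hx1, hx2⟩

end Evaluation

/-! ### The Duhamel integral -/

/-- The real inner product of the plane as a continuous bilinear map. -/
def innerBilin : Plane →L[ℝ] Plane →L[ℝ] ℝ :=
  LinearMap.mkContinuous₂ (innerₗ Plane) 1 fun x y => by
    rw [innerₗ_apply_apply, one_mul]
    exact norm_inner_le_norm x y

theorem innerBilin_apply (x y : Plane) : innerBilin x y = inner ℝ x y := rfl

theorem norm_innerBilin_le : ‖innerBilin‖ ≤ 1 :=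
  LinearMap.mkContinuous₂_norm_le _ zero_le_one _

/-- An elementary substitute for the Beta integral. At each `τ` one of `τ` and `t - τ` is at least
`t/2`; its negative power is bounded by the value at `t/2`, and the other power is integrable. -/
theorem integrableOn_rpow_mul_rpow {α β : ℝ} (hα : 0 ≤ α) (hα1 : α < 1) (hβ : 0 ≤ β)
    (hβ1 : β < 1) {t : ℝ} (ht : 0 < t) :
    IntegrableOn (fun τ => (t - τ) ^ (-α) * τ ^ (-β)) (Set.Ioo 0 t) ∧
      ∫ τ in Set.Ioo 0 t, (t - τ) ^ (-α) * τ ^ (-β) ≤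
        (2 ^ β / (1 - α) + 2 ^ α / (1 - β)) * t ^ (1 - α - β) := by
  have i1 : ∀ {γ : ℝ}, γ < 1 → IntegrableOn (fun τ : ℝ => τ ^ (-γ)) (Set.Ioo 0 t) := fun hγ =>
    (intervalIntegrable_iff_integrableOn_Ioo_of_le ht.le).1
      (intervalIntegral.intervalIntegrable_rpow' (by linarith))
  have v1 : ∀ {γ : ℝ}, γ < 1 → ∫ τ in (0 : ℝ)..t, τ ^ (-γ) = t ^ (1 - γ) / (1 - γ) := fun {γ} hγ => by
    rw [integral_rpow (Or.inl (by linarith)), Real.zero_rpow (by linarith), sub_zero,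
      neg_add_eq_sub]
  have i2 : IntervalIntegrable (fun τ : ℝ => (t - τ) ^ (-α)) volume 0 t := by
    have := (intervalIntegral.intervalIntegrable_rpow' (a := 0) (b := t)
      (by linarith : -1 < -α)).comp_sub_left t
    simpa using this.symm
  have v2 : ∫ τ in (0 : ℝ)..t, (t - τ) ^ (-α) = t ^ (1 - α) / (1 - α) := by
    rw [intervalIntegral.integral_comp_sub_left (fun τ => τ ^ (-α)), sub_self, sub_zero, v1 hα1]
  have i2' := (intervalIntegrable_iff_integrableOn_Ioo_of_le ht.le).1 i2
  have hle : ∀ τ ∈ Set.Ioo 0 t, (t - τ) ^ (-α) * τ ^ (-β) ≤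
      (t / 2) ^ (-β) * (t - τ) ^ (-α) + (t / 2) ^ (-α) * τ ^ (-β) := by
    rintro τ ⟨h0, h1⟩
    have hs : 0 < t - τ := by linarith
    rcases le_total τ (t / 2) with h | h
    · have : (t - τ) ^ (-α) ≤ (t / 2) ^ (-α) :=
        Real.rpow_le_rpow_of_nonpos (by positivity) (by linarith) (by linarith)
      have h2 : (t - τ) ^ (-α) * τ ^ (-β) ≤ (t / 2) ^ (-α) * τ ^ (-β) := by gcongr
      have h3 : 0 ≤ (t / 2) ^ (-β) * (t - τ) ^ (-α) := by positivity
      linarith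
    · have : τ ^ (-β) ≤ (t / 2) ^ (-β) :=
        Real.rpow_le_rpow_of_nonpos (by positivity) h (by linarith)
      have h2 : (t - τ) ^ (-α) * τ ^ (-β) ≤ (t - τ) ^ (-α) * (t / 2) ^ (-β) := by gcongr
      have h3 : 0 ≤ (t / 2) ^ (-α) * τ ^ (-β) := by positivity
      linarith
  have hmaj : IntegrableOn (fun τ => (t / 2) ^ (-β) * (t - τ) ^ (-α) + (t / 2) ^ (-α) * τ ^ (-β))
      (Set.Ioo 0 t) := (i2'.const_mul _).add ((i1 hβ1).const_mul _)
  have hint : IntegrableOn (fun τ => (t - τ) ^ (-α) * τ ^ (-β)) (Set.Ioo 0 t) := by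
    refine hmaj.mono' (by fun_prop) ?_
    filter_upwards [ae_restrict_mem measurableSet_Ioo] with τ hτ
    rw [Real.norm_of_nonneg]
    · exact hle τ hτ
    · have := hτ.1; have : 0 < t - τ := sub_pos.2 hτ.2
      positivity
  refine ⟨hint, (setIntegral_mono_on hint hmaj measurableSet_Ioo hle).trans_eq ?_⟩
  rw [integral_add (i2'.const_mul _) ((i1 hβ1).const_mul _), integral_const_mul,
    integral_const_mul, ← integral_Ioc_eq_integral_Ioo, ← integral_Ioc_eq_integral_Ioo,
    ← intervalIntegral.integral_of_le ht.le, ← intervalIntegral.integral_of_le ht.le, v1 hβ1, v2]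
  have e1 : ∀ γ : ℝ, (t / 2) ^ (-γ) = 2 ^ γ * t ^ (-γ) := fun γ => by
    rw [Real.div_rpow ht.le zero_le_two, Real.rpow_neg zero_le_two]
    field_simp
  have e2 : t ^ (1 - α - β) = t ^ (-β) * t ^ (1 - α) := by
    rw [← Real.rpow_add ht]; ring_nf
  have e3 : t ^ (1 - α - β) = t ^ (-α) * t ^ (1 - β) := by
    rw [← Real.rpow_add ht]; ring_nf
  rw [e1, e1, add_mul, ]
  nth_rewrite 1 [e2]
  rw [e3]
  ring

theorem stronglyMeasurable_bilin_comp {T E F G : Type*} [MeasurableSpace T]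
    [NormedAddCommGroup E] [NormedSpace ℝ E] [NormedAddCommGroup F] [NormedSpace ℝ F]
    [NormedAddCommGroup G] [NormedSpace ℝ G] (B : E →L[ℝ] F →L[ℝ] G) {f : T → E} {g : T → F}
    (hf : StronglyMeasurable f) (hg : StronglyMeasurable g) :
    StronglyMeasurable fun a => B (f a) (g a) :=
  B.continuous₂.comp_stronglyMeasurable (hf.prodMk hg)

section Duhamel

variable (p : ℝ≥0∞) [Fact (1 ≤ p)] [hp' : Fact (p ≠ ∞)]

/-- The Duhamel integral `∫₀ᵗ e^{(t - τ)Δ} ∇ · P(τ) dτ` in `L^p` of a time-dependent integrable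
vector field `P`. -/
def duhamel (P : ℝ → L1Field) (t : ℝ) : Lp ℝ p (volume : Measure Plane) :=
  ∫ τ in Set.Ioo 0 t, conv innerBilin norm_innerBilin_le (gradHeat p (t - τ)) (P τ)

theorem restrict_Ioo_le {t : ℝ} :
    (volume : Measure ℝ).restrict (Set.Ioo 0 t) ≤ volume.restrict (Set.Ioi 0) :=
  Measure.restrict_mono Set.Ioo_subset_Ioi_self le_rfl

theorem aestronglyMeasurable_duhamel_integrand {P : ℝ → L1Field}
    (hP : AEStronglyMeasurable P (volume.restrict (Set.Ioi 0))) (t : ℝ) :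
    AEStronglyMeasurable
      (fun τ => conv innerBilin norm_innerBilin_le (gradHeat p (t - τ)) (P τ))
      (volume.restrict (Set.Ioo 0 t)) := by
  refine (conv innerBilin norm_innerBilin_le).aestronglyMeasurable_comp₂ ?_
    (hP.mono_measure restrict_Ioo_le)
  exact ((stronglyMeasurable_gradHeat p).comp_measurable (by fun_prop)).aestronglyMeasurable

variable {p}

theorem norm_duhamel_integrand_le {P : ℝ → L1Field} {α β c m t : ℝ} (hc : 0 ≤ c)
    (hk : ∀ s, 0 < s → ‖gradHeat p s‖ ≤ c * s ^ (-α))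
    (hP : ∀ τ, 0 < τ → ‖P τ‖ ≤ m * τ ^ (-β)) {τ : ℝ} (hτ : τ ∈ Set.Ioo 0 t) :
    ‖conv innerBilin norm_innerBilin_le (gradHeat p (t - τ)) (P τ)‖ ≤
      c * m * ((t - τ) ^ (-α) * τ ^ (-β)) := by
  have hs : 0 < t - τ := sub_pos.2 hτ.2
  calc _ ≤ ‖gradHeat p (t - τ)‖ * ‖P τ‖ := norm_conv_le _ _ _ _
    _ ≤ (c * (t - τ) ^ (-α)) * (m * τ ^ (-β)) :=
        mul_le_mul (hk _ hs) (hP _ hτ.1) (norm_nonneg _) (by positivity)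
    _ = _ := by ring

theorem integrableOn_duhamel_integrand {P : ℝ → L1Field}
    (hPm : AEStronglyMeasurable P (volume.restrict (Set.Ioi 0))) {α β c m t : ℝ}
    (hα : 0 ≤ α) (hα1 : α < 1) (hβ : 0 ≤ β) (hβ1 : β < 1) (hc : 0 ≤ c)
    (hk : ∀ s, 0 < s → ‖gradHeat p s‖ ≤ c * s ^ (-α))
    (hP : ∀ τ, 0 < τ → ‖P τ‖ ≤ m * τ ^ (-β)) (ht : 0 < t) :
    IntegrableOn (fun τ => conv innerBilin norm_innerBilin_le (gradHeat p (t - τ)) (P τ))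
      (Set.Ioo 0 t) := by
  refine ((integrableOn_rpow_mul_rpow hα hα1 hβ hβ1 ht).1.const_mul (c * m)).mono'
    (aestronglyMeasurable_duhamel_integrand p hPm t) ?_
  filter_upwards [ae_restrict_mem measurableSet_Ioo] with τ hτ
  exact norm_duhamel_integrand_le hc hk hP hτ

theorem norm_duhamel_le {P : ℝ → L1Field} {α β c m t : ℝ}
    (hα : 0 ≤ α) (hα1 : α < 1) (hβ : 0 ≤ β) (hβ1 : β < 1) (hc : 0 ≤ c) (hm : 0 ≤ m)
    (hk : ∀ s, 0 < s → ‖gradHeat p s‖ ≤ c * s ^ (-α))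
    (hP : ∀ τ, 0 < τ → ‖P τ‖ ≤ m * τ ^ (-β)) (ht : 0 < t) :
    ‖duhamel p P t‖ ≤ c * m * ((2 ^ β / (1 - α) + 2 ^ α / (1 - β)) * t ^ (1 - α - β)) := by
  have h := integrableOn_rpow_mul_rpow hα hα1 hβ hβ1 ht
  calc ‖duhamel p P t‖ ≤ ∫ τ in Set.Ioo 0 t, c * m * ((t - τ) ^ (-α) * τ ^ (-β)) := by
        refine norm_integral_le_of_norm_le (h.1.const_mul _) ?_
        filter_upwards [ae_restrict_mem measurableSet_Ioo] with τ hτ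
        exact norm_duhamel_integrand_le hc hk hP hτ
    _ = c * m * ∫ τ in Set.Ioo 0 t, (t - τ) ^ (-α) * τ ^ (-β) := integral_const_mul _ _
    _ ≤ _ := mul_le_mul_of_nonneg_left h.2 (by positivity)

theorem duhamel_congr_ae {P P' : ℝ → L1Field} (h : P =ᵐ[volume.restrict (Set.Ioi 0)] P') :
    duhamel p P = duhamel p P' := by
  ext1 t
  refine integral_congr_ae ?_
  filter_upwards [ae_mono restrict_Ioo_le h] with τ hτ
  rw [hτ]

/-- The zero extension of `gradHeat` frees the domain of integration from `t`, so measurability in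
`t` follows from that of parameter integrals. -/
theorem duhamel_eq_setIntegral_Ioi (P : ℝ → L1Field) (t : ℝ) :
    duhamel p P t = ∫ τ in Set.Ioi 0,
      conv innerBilin norm_innerBilin_le (gradHeat p (t - τ)) (P τ) := by
  refine (setIntegral_eq_of_subset_of_forall_sdiff_eq_zero measurableSet_Ioi
    Set.Ioo_subset_Ioi_self fun τ hτ => ?_).symm
  have : t - τ ≤ 0 := by
    by_contra! hlt
    exact hτ.2 (Set.mem_Ioo.2 ⟨Set.mem_Ioi.1 hτ.1, by linarith⟩)
  rw [gradHeat_of_nonpos p this, map_zero]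
  rfl

theorem stronglyMeasurable_duhamel {P : ℝ → L1Field}
    (hP : AEStronglyMeasurable P (volume.restrict (Set.Ioi 0))) :
    StronglyMeasurable (duhamel p P) := by
  have h2 : StronglyMeasurable fun q : ℝ × ℝ => gradHeat p (q.1 - q.2) :=
    (stronglyMeasurable_gradHeat p).comp_measurable (by fun_prop)
  have h3 : StronglyMeasurable fun q : ℝ × ℝ => hP.mk P q.2 :=
    hP.stronglyMeasurable_mk.comp_measurable measurable_snd
  have h5 := stronglyMeasurable_bilin_comp (conv (p := p) innerBilin norm_innerBilin_le) h2 h3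
  have h6 := h5.integral_prod_right' (ν := volume.restrict (Set.Ioi (0 : ℝ)))
  rw [duhamel_congr_ae hP.ae_eq_mk, funext (duhamel_eq_setIntegral_Ioi (p := p) (hP.mk P))]
  exact h6

end Duhamel

/-! ### Pointwise evaluation of the Duhamel integral -/

theorem stronglyMeasurable_gradient_gaussKernel_formula :
    StronglyMeasurable fun q : ℝ × Plane => -(gaussKernel q.1 q.2 / (2 * q.1)) • q.2 := by
  unfold gaussKernel
  refine Measurable.stronglyMeasurable ?_
  fun_prop

/-- The pairing of an integrable field with `∇G(x - ·, s)`, as a continuous functional. -/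
def evalDiv {s : ℝ} (hs : 0 < s) (x : Plane) : L1Field →L[ℝ] ℝ :=
  (innerBilin.lpPairing volume 1 ∞).flip
    ((memLp_gradient_gaussKernel hs ∞).comp_measurePreserving
      (Measure.measurePreserving_sub_left volume x)).toLp

theorem evalDiv_apply {s : ℝ} (hs : 0 < s) (x : Plane) (F : L1Field) :
    evalDiv hs x F = convFun innerBilin (gradient (gaussKernel s)) F x := by
  rw [evalDiv, ContinuousLinearMap.flip_apply, ContinuousLinearMap.lpPairing_eq_integral]
  refine integral_congr_ae ?_
  filter_upwards [((memLp_gradient_gaussKernel hs ∞).comp_measurePreserving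
      (Measure.measurePreserving_sub_left volume x)).coeFn_toLp] with y hy
  rw [hy, innerBilin_apply, innerBilin_apply, real_inner_comm]
  rfl

/-- The function `(τ, x) ↦ (e^{(t - τ)Δ} ∇ · P(τ))(x)`, extended by zero to `τ ≥ t`. -/
def divHeat (t : ℝ) (P : ℝ → L1Field) (q : ℝ × Plane) : ℝ :=
  open Classical in
  if q.1 < t then convFun innerBilin (gradient (gaussKernel (t - q.1))) (P q.1) q.2 else 0

/-- For positive times the gradient of the kernel is given by an explicit formula that is jointly
measurable in time and space, so the parameter integral is measurable as well. -/
theorem measurable_divHeat_const (t : ℝ) (F : L1Field) :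
    Measurable (divHeat t fun _ => F) := by
  have h1 : StronglyMeasurable fun r : (ℝ × Plane) × Plane =>
      inner ℝ (-(gaussKernel (t - r.1.1) (r.1.2 - r.2) / (2 * (t - r.1.1))) • (r.1.2 - r.2))
        (F r.2) := by
    have a1 : StronglyMeasurable fun r : (ℝ × Plane) × Plane =>
        -(gaussKernel (t - r.1.1) (r.1.2 - r.2) / (2 * (t - r.1.1))) • (r.1.2 - r.2) :=
      stronglyMeasurable_gradient_gaussKernel_formula.comp_measurable
        (g := fun r : (ℝ × Plane) × Plane => (t - r.1.1, r.1.2 - r.2)) (by fun_prop)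
    have a2 : StronglyMeasurable fun r : (ℝ × Plane) × Plane => F r.2 :=
      (Lp.stronglyMeasurable F).comp_measurable measurable_snd
    exact a1.inner a2
  have h2 := h1.integral_prod_right' (ν := (volume : Measure Plane))
  classical
  have h3 : (divHeat t fun _ => F) = fun q : ℝ × Plane => if q.1 < t then
      ∫ y, inner ℝ (-(gaussKernel (t - q.1) (q.2 - y) / (2 * (t - q.1))) • (q.2 - y)) (F y)
      else 0 := by
    ext1 q
    by_cases hq : q.1 < t
    · rw [divHeat, if_pos hq, if_pos hq, convFun]
      refine integral_congr_ae (.of_forall fun y => ?_)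
      simp only [innerBilin_apply, gradient_gaussKernel (sub_pos.2 hq)]
    · rw [divHeat, if_neg hq, if_neg hq]
  rw [h3]
  exact Measurable.ite (measurableSet_lt measurable_fst measurable_const) h2.measurable
    measurable_const

/-- The case of a constant field handles simple functions of time. For fixed `(τ, x)` the evaluation
`evalDiv` is continuous on `L¹`, so approximating `P` by simple functions gives a pointwise limit.
-/
theorem measurable_divHeat (t : ℝ) {P : ℝ → L1Field} (hP : StronglyMeasurable P) :
    Measurable (divHeat t P) := by
  refine measurable_of_tendsto_metrizable
    (f := fun n q => divHeat t (fun _ => hP.approx n q.1) q) (fun n => ?_) ?_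
  · exact ((hP.approx n).comp (Prod.fst : ℝ × Plane → ℝ) measurable_fst).measurable_bind
      (fun F q => divHeat t (fun _ => F) q) fun F => measurable_divHeat_const t F
  · rw [tendsto_pi_nhds]
    intro q
    by_cases hq : q.1 < t
    · simp only [divHeat, if_pos hq, ← evalDiv_apply (sub_pos.2 hq)]
      exact ((evalDiv (sub_pos.2 hq) q.2).continuous.tendsto _).comp (hP.tendsto_approx q.1)
    · simp only [divHeat, if_neg hq]
      exact tendsto_const_nhds

/-- The pointwise integral does not depend on `p`. This serves both to read the fixed-point equation
pointwise and to compare the `L^{4/3}` and `L¹` versions of the Duhamel term. -/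
theorem coeFn_duhamel {p : ℝ≥0∞} [Fact (1 ≤ p)] [hp' : Fact (p ≠ ∞)] {P : ℝ → L1Field}
    (hP : AEStronglyMeasurable P (volume.restrict (Set.Ioi 0))) {t : ℝ} (ht : 0 < t)
    (hint : IntegrableOn (fun τ => conv innerBilin norm_innerBilin_le (gradHeat p (t - τ)) (P τ))
      (Set.Ioo 0 t)) :
    ∀ᵐ x, IntervalIntegrable
        (fun τ => convFun innerBilin (gradient (gaussKernel (t - τ))) (P τ) x) volume 0 t ∧
      duhamel p P t x =
        ∫ τ in (0 : ℝ)..t, convFun innerBilin (gradient (gaussKernel (t - τ))) (P τ) x := by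
  have hmk : ∀ᵐ τ ∂(volume.restrict (Set.Ioo 0 t)), P τ = hP.mk P τ :=
    ae_mono restrict_Ioo_le hP.ae_eq_mk
  have h := coeFn_integral hint (φ := divHeat t (hP.mk P))
    (measurable_divHeat t hP.stronglyMeasurable_mk).aestronglyMeasurable (by
      filter_upwards [ae_restrict_mem measurableSet_Ioo, hmk] with τ hτ hτ2
      have h1 := coeFn_conv innerBilin norm_innerBilin_le (gradHeat p (t - τ)) (P τ)
      rw [convFun_congr_ae _ (coeFn_gradHeat p (sub_pos.2 hτ.2)) (ae_eq_refl _)] at h1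
      filter_upwards [h1] with x hx
      rw [hx, divHeat, if_pos hτ.2, hτ2])
  filter_upwards [h] with x ⟨hx1, hx2⟩
  have e : ∀ᵐ τ ∂(volume.restrict (Set.Ioo 0 t)), divHeat t (hP.mk P) (τ, x) =
      convFun innerBilin (gradient (gaussKernel (t - τ))) (P τ) x := by
    filter_upwards [ae_restrict_mem measurableSet_Ioo, hmk] with τ hτ hτ2
    rw [divHeat, if_pos hτ.2, hτ2]
  constructor
  · rw [intervalIntegrable_iff_integrableOn_Ioo_of_le ht.le]
    exact hx1.congr e
  · rw [intervalIntegral.integral_of_le ht.le, integral_Ioc_eq_integral_Ioo,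
      ← integral_congr_ae e, ← hx2]
    rfl

/-! ### Weighted superpositions of translates of a Schwartz function -/

section Superposition

/-- The function `x ↦ ∫ g(y) φ(x - c(y)) dy`. -/
def superFun {V : Type*} [NormedAddCommGroup V] [NormedSpace ℝ V] (g : Plane → ℝ)
    (c : Plane → Plane) (φ : Plane → V) (x : Plane) : V := ∫ y, g y • φ (x - c y)

variable {V : Type*} [NormedAddCommGroup V] [NormedSpace ℝ V] {g : Plane → ℝ} {c : Plane → Plane}

theorem aestronglyMeasurable_translate (φ : 𝓢(Plane, V)) (hc : Measurable c) (x : Plane) :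
    AEStronglyMeasurable (fun y => φ (x - c y)) :=
  (φ.continuous.stronglyMeasurable.comp_measurable
    (measurable_const.sub hc)).aestronglyMeasurable

theorem integrable_smul_translate (φ : 𝓢(Plane, V)) (hg : Integrable g) (hc : Measurable c)
    (x : Plane) : Integrable fun y => g y • φ (x - c y) := by
  refine (hg.norm.mul_const (SchwartzMap.seminorm ℝ 0 0 φ)).mono'
    (hg.1.smul (aestronglyMeasurable_translate φ hc x)) (.of_forall fun y => ?_)
  rw [norm_smul]
  gcongr
  exact φ.norm_le_seminorm ℝ _

/-- Differentiation under the integral. The derivative is again a superposition, of the Schwartz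
function `fderiv φ`, and this drives the inductions on the order below. -/
theorem hasFDerivAt_superFun (φ : 𝓢(Plane, V)) (hg : Integrable g) (hc : Measurable c)
    (x : Plane) :
    HasFDerivAt (superFun g c φ) (superFun g c (SchwartzMap.fderivCLM ℝ Plane V φ) x) x := by
  refine hasFDerivAt_integral_of_dominated_of_fderiv_le (s := Set.univ)
    (F' := fun x y => g y • SchwartzMap.fderivCLM ℝ Plane V φ (x - c y))
    (bound := fun y => ‖g y‖ * SchwartzMap.seminorm ℝ 0 0 (SchwartzMap.fderivCLM ℝ Plane V φ))
    univ_mem (.of_forall fun z => (integrable_smul_translate φ hg hc z).1)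
    (integrable_smul_translate φ hg hc x) (integrable_smul_translate _ hg hc x).1
    (.of_forall fun y z _ => ?_) (hg.norm.mul_const _) (.of_forall fun y z _ => ?_)
  · rw [norm_smul]
    gcongr
    exact (SchwartzMap.fderivCLM ℝ Plane V φ).norm_le_seminorm ℝ _
  · have h := (φ.hasFDerivAt (z - c y)).comp z ((hasFDerivAt_id z).sub_const (c y))
    rw [ContinuousLinearMap.comp_id] at h
    exact h.const_smul (g y)

theorem fderiv_superFun (φ : 𝓢(Plane, V)) (hg : Integrable g) (hc : Measurable c) :
    fderiv ℝ (superFun g c φ) = superFun g c (SchwartzMap.fderivCLM ℝ Plane V φ) :=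
  funext fun x => (hasFDerivAt_superFun φ hg hc x).fderiv

/-- The target space is quantified inside the induction because each differentiation replaces `V` by
`Plane →L[ℝ] V`. -/
theorem contDiff_superFun_nat (hg : Integrable g) (hc : Measurable c) (n : ℕ) :
    ∀ {V : Type*} [NormedAddCommGroup V] [NormedSpace ℝ V] (φ : 𝓢(Plane, V)),
      ContDiff ℝ n (superFun g c φ) := by
  induction n with
  | zero =>
    intro V _ _ φ
    rw [Nat.cast_zero, contDiff_zero, continuous_iff_continuousAt]
    exact fun x => (hasFDerivAt_superFun φ hg hc x).continuousAt
  | succ n ih =>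
    intro V _ _ φ
    rw [Nat.cast_add, Nat.cast_one, contDiff_succ_iff_fderiv, fderiv_superFun φ hg hc]
    exact ⟨fun x => (hasFDerivAt_superFun φ hg hc x).differentiableAt, by simp, ih _⟩

theorem aestronglyMeasurable_iteratedFDeriv_translate (φ : 𝓢(Plane, V)) (hc : Measurable c)
    (n : ℕ) (x : Plane) : AEStronglyMeasurable fun y => iteratedFDeriv ℝ n φ (x - c y) :=
  have : SecondCountableTopologyEither Plane (Plane [×n]→L[ℝ] V) :=
    secondCountableTopologyEither_of_left _ _
  (((φ.smooth ⊤).continuous_iteratedFDeriv (by exact_mod_cast le_top)).stronglyMeasurable.comp_measurable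
    (measurable_const.sub hc)).aestronglyMeasurable

theorem integrable_smul_iteratedFDeriv (φ : 𝓢(Plane, V)) (hg : Integrable g) (hc : Measurable c) (n : ℕ)
    (x : Plane) : Integrable fun y => g y • iteratedFDeriv ℝ n φ (x - c y) := by
  refine (hg.norm.mul_const (SchwartzMap.seminorm ℝ 0 n φ)).mono'
    (hg.1.smul
      (aestronglyMeasurable_iteratedFDeriv_translate φ hc n x)) (.of_forall fun y => ?_)
  rw [norm_smul]
  gcongr
  exact φ.norm_iteratedFDeriv_le_seminorm ℝ n _

theorem iteratedFDeriv_superFun (hg : Integrable g) (hc : Measurable c) (n : ℕ) :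
    ∀ {V : Type*} [NormedAddCommGroup V] [NormedSpace ℝ V] (φ : 𝓢(Plane, V)) (x : Plane),
      iteratedFDeriv ℝ n (superFun g c φ) x = superFun g c (iteratedFDeriv ℝ n φ) x := by
  induction n with
  | zero =>
    intro V _ _ φ x
    rw [iteratedFDeriv_zero_eq_comp]
    simp only [superFun, iteratedFDeriv_zero_eq_comp, Function.comp_apply]
    refine ((continuousMultilinearCurryFin0 ℝ Plane V).symm.toContinuousLinearEquiv.integral_comp_comm
      (fun y => g y • φ (x - c y))).symm.trans (integral_congr_ae (.of_forall fun y => ?_))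
    exact map_smul (continuousMultilinearCurryFin0 ℝ Plane V).symm (g y) (φ (x - c y))
  | succ n ih =>
    intro V _ _ φ x
    ext m
    rw [iteratedFDeriv_succ_apply_right, fderiv_superFun φ hg hc, ih, superFun, superFun,
      ContinuousMultilinearMap.integral_apply (integrable_smul_iteratedFDeriv φ hg hc (n + 1) x),
      ContinuousMultilinearMap.integral_apply
        (integrable_smul_iteratedFDeriv (SchwartzMap.fderivCLM ℝ Plane V φ) hg hc n x),
      ContinuousLinearMap.integral_apply]
    · refine integral_congr_ae (.of_forall fun y => ?_)
      simp only [smul_apply, iteratedFDeriv_succ_apply_right]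
      rfl
    · exact (ContinuousMultilinearMap.apply ℝ (fun _ : Fin n => Plane) (Plane →L[ℝ] V)
        (Fin.init m)).integrable_comp
        (integrable_smul_iteratedFDeriv (SchwartzMap.fderivCLM ℝ Plane V φ) hg hc n x)

/-- A constant controlling the derivatives of order `n` of a Schwartz function with the weight
`(1 + |x|)^k`. -/
def decayConst (φ : 𝓢(Plane, V)) (k n : ℕ) : ℝ :=
  2 ^ k * (Finset.Iic (k, n)).sup (fun m => SchwartzMap.seminorm ℝ m.1 m.2) φ

theorem decayConst_nonneg (φ : 𝓢(Plane, V)) (k n : ℕ) : 0 ≤ decayConst φ k n := by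
  unfold decayConst; positivity

/-- A Peetre-type inequality, `|x| ≤ (1 + R)(1 + |z|)`: moving the argument by `R` costs only a
polynomial factor in `R`. -/
theorem pow_mul_norm_iteratedFDeriv_le (φ : 𝓢(Plane, V)) (k n : ℕ) {R : ℝ} {x z : Plane}
    (hz : ‖x - z‖ ≤ R) :
    ‖x‖ ^ k * ‖iteratedFDeriv ℝ n φ z‖ ≤ (1 + R) ^ k * decayConst φ k n := by
  have h := SchwartzMap.one_add_le_sup_seminorm_apply (𝕜 := ℝ) (m := (k, n)) le_rfl le_rfl φ z
  have hR : 0 ≤ R := (norm_nonneg _).trans hz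
  have hx : ‖x‖ ≤ (1 + R) * (1 + ‖z‖) := by
    have : ‖x‖ ≤ ‖x - z‖ + ‖z‖ := by simpa using norm_add_le (x - z) z
    nlinarith [norm_nonneg z, mul_nonneg hR (norm_nonneg z)]
  calc ‖x‖ ^ k * ‖iteratedFDeriv ℝ n φ z‖
      ≤ ((1 + R) * (1 + ‖z‖)) ^ k * ‖iteratedFDeriv ℝ n φ z‖ := by gcongr
    _ = (1 + R) ^ k * ((1 + ‖z‖) ^ k * ‖iteratedFDeriv ℝ n φ z‖) := by rw [mul_pow, mul_assoc]
    _ ≤ _ := mul_le_mul_of_nonneg_left h (by positivity)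

theorem pow_mul_norm_iteratedFDeriv_sub_le (φ : 𝓢(Plane, V)) (k n : ℕ) {R : ℝ} {x a b : Plane}
    (ha : ‖a‖ ≤ R) (hb : ‖b‖ ≤ R) :
    ‖x‖ ^ k * ‖iteratedFDeriv ℝ n φ (x - a) - iteratedFDeriv ℝ n φ (x - b)‖ ≤
      (1 + R) ^ k * decayConst φ k (n + 1) * ‖a - b‖ := by
  have hd : Differentiable ℝ (iteratedFDeriv ℝ n φ) :=
    (φ.smooth ⊤).differentiable_iteratedFDeriv (by exact_mod_cast WithTop.coe_lt_top n)
  have h := (convex_closedBall x R).norm_image_sub_le_of_norm_fderiv_le (𝕜 := ℝ)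
    (f := fun z => ‖x‖ ^ k • iteratedFDeriv ℝ n φ z) (x := x - b) (y := x - a)
    (C := (1 + R) ^ k * decayConst φ k (n + 1)) (fun z _ => (hd z).fun_const_smul _)
    (fun z hz => by
      rw [fderiv_fun_const_smul (hd z), norm_smul, norm_fderiv_iteratedFDeriv,
        Real.norm_of_nonneg (by positivity)]
      refine pow_mul_norm_iteratedFDeriv_le φ k (n + 1) ?_
      rwa [← dist_eq_norm, dist_comm])
    (by simpa [dist_eq_norm] using hb) (by simpa [dist_eq_norm] using ha)
  rw [← smul_sub, norm_smul, Real.norm_of_nonneg (by positivity)] at h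
  refine h.trans_eq ?_
  congr 1
  rw [sub_sub_sub_cancel_left, norm_sub_rev]

/-! ### Superpositions with a Schwartz weight -/

variable (g : 𝓢(Plane, ℝ))

theorem integrable_one_add_norm_pow_mul (k : ℕ) :
    Integrable fun y => (1 + ‖y‖) ^ k * ‖g y‖ := by
  refine (((g.integrable (μ := volume)).norm.add
    (g.integrable_pow_mul volume k)).const_mul (2 ^ k)).mono' (by fun_prop) (.of_forall fun y => ?_)
  rw [Real.norm_of_nonneg (by positivity)]
  have h := add_pow_le zero_le_one (norm_nonneg y) k
  rw [one_pow] at h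
  have h2 : (2 : ℝ) ^ (k - 1) ≤ 2 ^ k := pow_le_pow_right₀ one_le_two (Nat.sub_le k 1)
  calc (1 + ‖y‖) ^ k * ‖g y‖ ≤ (2 ^ (k - 1) * (1 + ‖y‖ ^ k)) * ‖g y‖ := by gcongr
    _ ≤ (2 ^ k * (1 + ‖y‖ ^ k)) * ‖g y‖ := by gcongr
    _ = 2 ^ k * (‖g y‖ + ‖y‖ ^ k * ‖g y‖) := by ring

theorem one_add_two_mul_pow_le {c : Plane → Plane} {y : Plane} (hc : ‖c y‖ ≤ 2 * ‖y‖) (k : ℕ) :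
    (1 + ‖c y‖) ^ k ≤ 2 ^ k * (1 + ‖y‖) ^ k := by
  rw [← mul_pow]
  gcongr
  linarith

/-- The Schwartz function `x ↦ ∫ g(y) φ(x - c(y)) dy`, where `|c(y)| ≤ 2|y|`. -/
def superpose {c : Plane → Plane} (hc : Measurable c) (hc2 : ∀ y, ‖c y‖ ≤ 2 * ‖y‖)
    (φ : 𝓢(Plane, V)) : 𝓢(Plane, V) where
  toFun := superFun g c φ
  smooth' := contDiff_infty.2 fun n => contDiff_superFun_nat g.integrable hc n φ
  decay' k n := by
    refine ⟨∫ y, 2 ^ k * decayConst φ k n * ((1 + ‖y‖) ^ k * ‖g y‖), fun x => ?_⟩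
    rw [iteratedFDeriv_superFun g.integrable hc, superFun, ← Real.norm_of_nonneg
      (r := ‖x‖ ^ k) (by positivity), ← norm_smul, ← integral_smul]
    refine norm_integral_le_of_norm_le ((integrable_one_add_norm_pow_mul g k).const_mul _)
      (.of_forall fun y => ?_)
    rw [norm_smul, norm_smul, Real.norm_of_nonneg (by positivity)]
    have h1 := pow_mul_norm_iteratedFDeriv_le φ k n (x := x) (z := x - c y) (R := ‖c y‖) (by simp)
    have h2 := one_add_two_mul_pow_le (hc2 y) k
    have h3 := decayConst_nonneg φ k n
    calc ‖x‖ ^ k * (‖g y‖ * ‖iteratedFDeriv ℝ n φ (x - c y)‖)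
        = ‖g y‖ * (‖x‖ ^ k * ‖iteratedFDeriv ℝ n φ (x - c y)‖) := by ring
      _ ≤ ‖g y‖ * (2 ^ k * (1 + ‖y‖) ^ k * decayConst φ k n) := by
          refine mul_le_mul_of_nonneg_left (h1.trans ?_) (norm_nonneg _)
          gcongr
      _ = _ := by ring

theorem superpose_apply {c : Plane → Plane} (hc : Measurable c) (hc2 : ∀ y, ‖c y‖ ≤ 2 * ‖y‖)
    (φ : 𝓢(Plane, V)) (x : Plane) :
    superpose g hc hc2 φ x = ∫ y, g y • φ (x - c y) := rfl

/-- The mean value inequality costs one derivative of `φ`. The estimate shows that replacing `c` by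
a pointwise approximation changes the superposition little in the Schwartz topology. -/
theorem seminorm_superpose_sub_le {c : Plane → Plane} (hc : Measurable c)
    (hc2 : ∀ y, ‖c y‖ ≤ 2 * ‖y‖) {c' : Plane → Plane} (hc' : Measurable c')
    (hc2' : ∀ y, ‖c' y‖ ≤ 2 * ‖y‖) (φ : 𝓢(Plane, V)) (k n : ℕ) :
    SchwartzMap.seminorm ℝ k n (superpose g hc hc2 φ - superpose g hc' hc2' φ) ≤
      ∫ y, 2 ^ k * decayConst φ k (n + 1) * ((1 + ‖y‖) ^ k * ‖g y‖ * ‖c y - c' y‖) := by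
  have hD := decayConst_nonneg φ k (n + 1)
  refine SchwartzMap.seminorm_le_bound ℝ k n _ (integral_nonneg fun y => by positivity) fun x => ?_
  have e : iteratedFDeriv ℝ n (superpose g hc hc2 φ - superpose g hc' hc2' φ : 𝓢(Plane, V)) x =
      ∫ y, g y • (iteratedFDeriv ℝ n φ (x - c y) - iteratedFDeriv ℝ n φ (x - c' y)) := by
    change iteratedFDeriv ℝ n (superFun g c φ - superFun g c' φ) x = _
    rw [iteratedFDeriv_sub_apply (contDiff_superFun_nat g.integrable hc n φ).contDiffAt
      (contDiff_superFun_nat g.integrable hc' n φ).contDiffAt,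
      iteratedFDeriv_superFun g.integrable hc, iteratedFDeriv_superFun g.integrable hc', superFun,
      superFun, ← integral_sub (integrable_smul_iteratedFDeriv φ g.integrable hc n x)
        (integrable_smul_iteratedFDeriv φ g.integrable hc' n x)]
    simp only [smul_sub]
  rw [e, ← Real.norm_of_nonneg (r := ‖x‖ ^ k) (by positivity), ← norm_smul, ← integral_smul]
  refine norm_integral_le_of_norm_le ?_ (.of_forall fun y => ?_)
  · refine (((integrable_one_add_norm_pow_mul g (k + 1)).const_mul 4).mono'
      ?_ (.of_forall fun y => ?_)).const_mul _
    · exact ((by fun_prop : AEStronglyMeasurable fun y => (1 + ‖y‖) ^ k * ‖g y‖).mul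
        (hc.sub hc').norm.aestronglyMeasurable)
    · rw [Real.norm_of_nonneg (by positivity), pow_succ]
      have : ‖c y - c' y‖ ≤ 4 * (1 + ‖y‖) := by
        linarith [norm_sub_le (c y) (c' y), hc2 y, hc2' y]
      calc _ ≤ (1 + ‖y‖) ^ k * ‖g y‖ * (4 * (1 + ‖y‖)) := by gcongr
        _ = _ := by ring
  · rw [norm_smul, norm_smul, Real.norm_of_nonneg (by positivity)]
    have h1 := pow_mul_norm_iteratedFDeriv_sub_le φ k n (x := x) (hc2 y) (hc2' y)
    have h2 : (1 + 2 * ‖y‖) ^ k ≤ 2 ^ k * (1 + ‖y‖) ^ k := by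
      rw [← mul_pow]; gcongr; linarith
    calc ‖x‖ ^ k * (‖g y‖ * ‖iteratedFDeriv ℝ n φ (x - c y) - iteratedFDeriv ℝ n φ (x - c' y)‖)
        = ‖g y‖ *
          (‖x‖ ^ k * ‖iteratedFDeriv ℝ n φ (x - c y) - iteratedFDeriv ℝ n φ (x - c' y)‖) := by ring
      _ ≤ ‖g y‖ * (2 ^ k * (1 + ‖y‖) ^ k * decayConst φ k (n + 1) * ‖c y - c' y‖) := by
          refine mul_le_mul_of_nonneg_left (h1.trans ?_) (norm_nonneg _)
          gcongr
      _ = _ := by ring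

end Superposition

/-! ### Tempered distributions tested against translates -/

section Distributions

variable (w : Distr) (g φ : 𝓢(Plane, ℝ))

theorem exists_seminorm_bound :
    ∃ (s : Finset (ℕ × ℕ)) (C : ℝ), 0 ≤ C ∧
      ∀ φ, |w φ| ≤ C * ∑ i ∈ s, SchwartzMap.seminorm ℝ i.1 i.2 φ := by
  obtain ⟨s, C, _, hC⟩ := Seminorm.bound_of_continuous (schwartz_withSeminorms ℝ Plane ℝ)
    ((normSeminorm ℝ ℝ).comp w.toLinearMap) w.continuous.norm
  refine ⟨s, C, C.2, fun φ => (hC φ).trans ?_⟩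
  refine mul_le_mul_of_nonneg_left ?_ C.2
  refine (Seminorm.finset_sup_le_sum _ s φ).trans_eq ?_
  simp [schwartzSeminormFamily]

theorem iteratedFDeriv_translate (a x : Plane) (n : ℕ) :
    iteratedFDeriv ℝ n (φ.compSubConstCLM ℝ a) x = iteratedFDeriv ℝ n φ (x - a) :=
  iteratedFDeriv_comp_sub n a x

theorem seminorm_translate_le (a : Plane) (k n : ℕ) :
    SchwartzMap.seminorm ℝ k n (φ.compSubConstCLM ℝ a) ≤ (1 + ‖a‖) ^ k * decayConst φ k n := by
  refine SchwartzMap.seminorm_le_bound ℝ k n _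
    (mul_nonneg (by positivity) (decayConst_nonneg φ k n)) fun x => ?_
  rw [iteratedFDeriv_translate]
  exact pow_mul_norm_iteratedFDeriv_le φ k n (by simp)

theorem seminorm_translate_sub_le {R : ℝ} {a b : Plane} (ha : ‖a‖ ≤ R) (hb : ‖b‖ ≤ R) (k n : ℕ) :
    SchwartzMap.seminorm ℝ k n (φ.compSubConstCLM ℝ a - φ.compSubConstCLM ℝ b) ≤
      (1 + R) ^ k * decayConst φ k (n + 1) * ‖a - b‖ := by
  have hR : 0 ≤ R := (norm_nonneg a).trans ha
  have := decayConst_nonneg φ k (n + 1)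
  refine SchwartzMap.seminorm_le_bound ℝ k n _ (by positivity) fun x => ?_
  have e : iteratedFDeriv ℝ n (φ.compSubConstCLM ℝ a - φ.compSubConstCLM ℝ b : 𝓢(Plane, ℝ)) x =
      iteratedFDeriv ℝ n φ (x - a) - iteratedFDeriv ℝ n φ (x - b) := by
    rw [← iteratedFDeriv_translate, ← iteratedFDeriv_translate]
    exact iteratedFDeriv_sub_apply ((SchwartzMap.smooth _ n).contDiffAt)
      ((SchwartzMap.smooth _ n).contDiffAt)
  rw [e]
  exact pow_mul_norm_iteratedFDeriv_sub_le φ k n ha hb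

theorem continuous_translate : Continuous fun a => w (φ.compSubConstCLM ℝ a) := by
  obtain ⟨s, C, hC0, hC⟩ := exists_seminorm_bound w
  rw [continuous_iff_continuousAt]
  intro a
  rw [ContinuousAt, tendsto_iff_norm_sub_tendsto_zero]
  have hlim : Tendsto (fun b => C * ∑ i ∈ s, (1 + (‖a‖ + 1)) ^ i.1 * decayConst φ i.1 (i.2 + 1) *
      ‖b - a‖) (𝓝 a) (𝓝 0) := by
    have : Continuous (fun b => C * ∑ i ∈ s, (1 + (‖a‖ + 1)) ^ i.1 *
      decayConst φ i.1 (i.2 + 1) * ‖b - a‖) := by fun_prop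
    simpa using this.tendsto a
  refine squeeze_zero' (.of_forall fun _ => norm_nonneg _) ?_ hlim
  filter_upwards [Metric.ball_mem_nhds a one_pos] with b hb
  rw [← map_sub, Real.norm_eq_abs]
  refine (hC _).trans (mul_le_mul_of_nonneg_left (Finset.sum_le_sum fun i _ => ?_) hC0)
  refine seminorm_translate_sub_le φ ?_ (by linarith) i.1 i.2
  rw [mem_ball_iff_norm] at hb
  have : ‖b‖ ≤ ‖a‖ + ‖b - a‖ := by simpa using norm_add_le a (b - a)
  linarith

/-- A tempered distribution is bounded by finitely many seminorms, and those of a translate grow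
polynomially. This supplies the majorants in all limits under the integral sign. -/
theorem exists_translate_bound :
    ∃ (N : ℕ) (K : ℝ), 0 ≤ K ∧ ∀ a, |w (φ.compSubConstCLM ℝ a)| ≤ K * (1 + ‖a‖) ^ N := by
  obtain ⟨s, C, hC0, hC⟩ := exists_seminorm_bound w
  have hd : ∀ i : ℕ × ℕ, 0 ≤ decayConst φ i.1 i.2 := fun i => decayConst_nonneg φ _ _
  refine ⟨s.sup Prod.fst, C * ∑ i ∈ s, decayConst φ i.1 i.2,
    mul_nonneg hC0 (Finset.sum_nonneg fun i _ => hd i), fun a => ?_⟩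
  refine (hC _).trans ?_
  rw [mul_assoc, Finset.sum_mul]
  refine mul_le_mul_of_nonneg_left (Finset.sum_le_sum fun i hi => ?_) hC0
  refine (seminorm_translate_le φ a i.1 i.2).trans ?_
  rw [mul_comm]
  refine mul_le_mul_of_nonneg_left (pow_le_pow_right₀ ?_ (Finset.le_sup (f := Prod.fst) hi)) (hd i)
  linarith [norm_nonneg a]

theorem integral_smul_comp_simpleFunc {g : Plane → ℝ} (hg : Integrable g)
    (c : SimpleFunc Plane Plane) (Ψ : Plane → ℝ) :
    ∫ y, g y * Ψ (c y) = ∑ v ∈ c.range, (∫ y in c ⁻¹' {v}, g y) * Ψ v := by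
  have h : ∀ y, g y * Ψ (c y) =
      ∑ v ∈ c.range, (c ⁻¹' {v}).indicator g y * Ψ v := fun y => by
    rw [Finset.sum_eq_single (c y)]
    · simp
    · intro v _ hv
      rw [Set.indicator_of_notMem, zero_mul]
      exact fun h => hv h.symm
    · intro hn
      exact absurd (c.mem_range_self y) hn
  simp_rw [h]
  rw [integral_finsetSum _ fun v _ =>
    (hg.indicator (c.measurableSet_preimage _)).mul_const _]
  refine Finset.sum_congr rfl fun v _ => ?_
  rw [integral_mul_const, integral_indicator (c.measurableSet_preimage _)]

/-- For simple `c` the superposition is a finite linear combination of translates, so only linearity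
of `w` is involved. -/
theorem apply_superpose_simpleFunc (c : SimpleFunc Plane Plane) (hc2 : ∀ y, ‖c y‖ ≤ 2 * ‖y‖) :
    w (superpose g c.measurable hc2 φ) = ∫ y, g y * w (φ.compSubConstCLM ℝ (c y)) := by
  have e : superpose g c.measurable hc2 φ =
      ∑ v ∈ c.range, (∫ y in c ⁻¹' {v}, g y) • φ.compSubConstCLM ℝ v := by
    ext x
    rw [superpose_apply, sum_apply]
    exact integral_smul_comp_simpleFunc g.integrable c fun v => φ (x - v)
  rw [e, map_sum, integral_smul_comp_simpleFunc g.integrable c fun v => w (φ.compSubConstCLM ℝ v)]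
  simp

theorem integrable_mul_translate : Integrable fun y => g y * w (φ.compSubConstCLM ℝ y) := by
  obtain ⟨N, K, hK, hb⟩ := exists_translate_bound w φ
  refine ((integrable_one_add_norm_pow_mul g N).const_mul K).mono'
    (g.continuous.mul (continuous_translate w φ)).aestronglyMeasurable (.of_forall fun y => ?_)
  rw [norm_mul, Real.norm_eq_abs (w _)]
  calc ‖g y‖ * |w (φ.compSubConstCLM ℝ y)| ≤ ‖g y‖ * (K * (1 + ‖y‖) ^ N) := by gcongr; exact hb y
    _ = _ := by ring

theorem norm_le_two_mul_self (y : Plane) : ‖id y‖ ≤ 2 * ‖y‖ := by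
  rw [id]; linarith [norm_nonneg y]

/-- The Schwartz function `x ↦ ∫ g(y) φ(x - y) dy`. -/
def convSchwartz : 𝓢(Plane, ℝ) := superpose g measurable_id norm_le_two_mul_self φ

theorem convSchwartz_apply (x : Plane) : convSchwartz g φ x = ∫ y, g y * φ (x - y) := rfl

theorem convSchwartz_comm : convSchwartz g φ = convSchwartz φ g := by
  ext x
  rw [convSchwartz_apply, convSchwartz_apply,
    ← integral_sub_left_eq_self (fun y => g y * φ (x - y)) volume x]
  simp [mul_comm]

/-- A distribution may be applied under the integral sign. -/
theorem apply_convSchwartz :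
    w (convSchwartz g φ) = ∫ y, g y * w (φ.compSubConstCLM ℝ y) := by
  obtain ⟨s, C, hC0, hC⟩ := exists_seminorm_bound w
  obtain ⟨N, K, hK, hb⟩ := exists_translate_bound w φ
  -- The identity map is approximated by simple maps; their bound `|c(y)| ≤ 2|y|` is the reason for
  -- the factor two in `superpose`. The value of `w` on the approximations converges to both sides:
  -- on the left by continuity of `w`, on the right by dominated convergence.
  let c : ℕ → SimpleFunc Plane Plane := fun m =>
    SimpleFunc.approxOn id measurable_id Set.univ 0 (Set.mem_univ _) m
  have hc2 : ∀ m y, ‖c m y‖ ≤ 2 * ‖y‖ := fun m y =>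
    (SimpleFunc.norm_approxOn_zero_le measurable_id (Set.mem_univ _) y m).trans_eq
      (two_mul _).symm
  have hct : ∀ y, Tendsto (fun m => c m y) atTop (𝓝 y) := fun y =>
    SimpleFunc.tendsto_approxOn measurable_id (Set.mem_univ _) (by simp)
  have h1 : Tendsto (fun m => w (superpose g (c m).measurable (hc2 m) φ)) atTop
      (𝓝 (w (convSchwartz g φ))) := by
    rw [tendsto_iff_norm_sub_tendsto_zero]
    have hlim : Tendsto (fun m => C * ∑ i ∈ s, ∫ y, 2 ^ i.1 * decayConst φ i.1 (i.2 + 1) *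
        ((1 + ‖y‖) ^ i.1 * ‖g y‖ * ‖c m y - id y‖)) atTop (𝓝 0) := by
      rw [show (0 : ℝ) = C * ∑ i ∈ s, 0 by simp]
      refine (tendsto_finsetSum _ fun i _ => ?_).const_mul C
      rw [show (0 : ℝ) = ∫ _ : Plane, (0 : ℝ) by simp]
      refine tendsto_integral_of_dominated_convergence
        (fun y => 2 ^ i.1 * decayConst φ i.1 (i.2 + 1) * (3 * ((1 + ‖y‖) ^ (i.1 + 1) * ‖g y‖)))
        (fun m => ?_)
        (((integrable_one_add_norm_pow_mul g (i.1 + 1)).const_mul 3).const_mul _)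
        (fun m => .of_forall fun y => ?_) (.of_forall fun y => ?_)
      · refine AEStronglyMeasurable.const_mul ?_ _
        exact ((by fun_prop : AEStronglyMeasurable fun y => (1 + ‖y‖) ^ i.1 * ‖g y‖).mul
          ((c m).measurable.sub measurable_id).norm.aestronglyMeasurable)
      · have := decayConst_nonneg φ i.1 (i.2 + 1)
        rw [Real.norm_of_nonneg (by positivity), pow_succ]
        have h3 : ‖c m y - id y‖ ≤ 3 * (1 + ‖y‖) := by
          have := norm_sub_le (c m y) (id y)
          have := hc2 m y
          simp only [id] at *
          linarith
        calc _ ≤ 2 ^ i.1 * decayConst φ i.1 (i.2 + 1) *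
              ((1 + ‖y‖) ^ i.1 * ‖g y‖ * (3 * (1 + ‖y‖))) := by gcongr
          _ = _ := by ring
      · have h : Tendsto (fun m => ‖c m y - id y‖) atTop (𝓝 0) :=
          tendsto_iff_norm_sub_tendsto_zero.1 (hct y)
        simpa using (h.const_mul ((1 + ‖y‖) ^ i.1 * ‖g y‖)).const_mul
          (2 ^ i.1 * decayConst φ i.1 (i.2 + 1))
    refine squeeze_zero (fun _ => norm_nonneg _) (fun m => ?_) hlim
    rw [← map_sub, Real.norm_eq_abs]
    refine (hC _).trans (mul_le_mul_of_nonneg_left (Finset.sum_le_sum fun i _ => ?_) hC0)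
    exact seminorm_superpose_sub_le g _ _ _ _ φ i.1 i.2
  have h2 : Tendsto (fun m => w (superpose g (c m).measurable (hc2 m) φ)) atTop
      (𝓝 (∫ y, g y * w (φ.compSubConstCLM ℝ y))) := by
    simp_rw [apply_superpose_simpleFunc]
    refine tendsto_integral_of_dominated_convergence
      (fun y => K * 2 ^ N * ((1 + ‖y‖) ^ N * ‖g y‖))
      (fun m => ?_) ((integrable_one_add_norm_pow_mul g N).const_mul _)
      (fun m => .of_forall fun y => ?_) (.of_forall fun y => ?_)
    · exact g.continuous.aestronglyMeasurable.mul
        ((continuous_translate w φ).stronglyMeasurable.comp_measurable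
          (c m).measurable).aestronglyMeasurable
    · rw [norm_mul, Real.norm_eq_abs (w _)]
      calc ‖g y‖ * |w (φ.compSubConstCLM ℝ (c m y))| ≤ ‖g y‖ * (K * (1 + ‖c m y‖) ^ N) := by
            gcongr; exact hb _
        _ ≤ ‖g y‖ * (K * (2 ^ N * (1 + ‖y‖) ^ N)) := by
            gcongr; exact one_add_two_mul_pow_le (hc2 m y) N
        _ = _ := by ring
    · exact (((continuous_translate w φ).tendsto y).comp (hct y)).const_mul _
  exact tendsto_nhds_unique h1 h2

end Distributions

/-! ### The heat semigroup on tempered distributions -/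

section Heat

variable (w : Distr)

theorem heatTest_eq_translate {t : ℝ} (ht : 0 < t) (x : Plane) :
    heatTest t ht x = (heatTest t ht 0).compSubConstCLM ℝ x := by
  ext y
  rw [SchwartzMap.compSubConstCLM_apply, heatTest_apply, heatTest_apply, zero_sub, neg_sub]

theorem heat_eq {t : ℝ} (ht : 0 < t) :
    heat t ht w = fun x => w ((heatTest t ht 0).compSubConstCLM ℝ x) := by
  ext x
  rw [heat, heatTest_eq_translate]

theorem continuous_heat {t : ℝ} (ht : 0 < t) : Continuous (heat t ht w) := by
  rw [heat_eq]
  exact continuous_translate w _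

theorem integrable_mul_heat {t : ℝ} (ht : 0 < t) (g : 𝓢(Plane, ℝ)) :
    Integrable fun y => g y * heat t ht w y := by
  rw [heat_eq]
  exact integrable_mul_translate w g _

theorem integral_mul_heat {t : ℝ} (ht : 0 < t) (g : 𝓢(Plane, ℝ)) :
    ∫ y, g y * heat t ht w y = w (convSchwartz g (heatTest t ht 0)) := by
  rw [heat_eq]
  exact (apply_convSchwartz w g _).symm

/-- The semigroup property. -/
theorem heat_add {s t : ℝ} (hs : 0 < s) (ht : 0 < t) (x : Plane) :
    heat (s + t) (add_pos hs ht) w x = ∫ y, gaussKernel s (x - y) * heat t ht w y := by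
  have h := integral_mul_heat w ht (heatTest s hs x)
  simp only [heatTest_apply] at h
  rw [h, heat]
  congr 1
  ext z
  rw [heatTest_apply, convSchwartz_apply, ← integral_gaussKernel_mul_gaussKernel hs ht,
    ← integral_sub_right_eq_self _ z]
  refine integral_congr_ae (.of_forall fun y => ?_)
  simp only [heatTest_apply]
  rw [show x - z - (y - z) = x - y by abel, zero_sub, neg_sub]

theorem gaussKernel_sqrt_smul {t : ℝ} (ht : 0 < t) (y : Plane) :
    t * gaussKernel t (√t • y) = gaussKernel 1 y := by
  simp only [gaussKernel, norm_smul, mul_pow, Real.norm_of_nonneg (Real.sqrt_nonneg t),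
    Real.sq_sqrt ht.le]
  rw [show -(t * ‖y‖ ^ 2) / (4 * t) = -‖y‖ ^ 2 / (4 * 1) by field_simp]
  field_simp

/-- Parabolic scaling moves the time from the kernel into the argument of `h`, after which a limit
`t → 0` involves one fixed weight. -/
theorem integral_gaussKernel_mul_eq {t : ℝ} (ht : 0 < t) (h : Plane → ℝ) :
    ∫ y, gaussKernel t y * h y = ∫ y, gaussKernel 1 y * h (√t • y) := by
  have e := Measure.integral_comp_smul volume (fun y => gaussKernel t y * h y) √t
  rw [finrank_euclideanSpace_fin, Real.sq_sqrt ht.le, abs_of_pos (by positivity)] at e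
  rw [eq_comm, inv_smul_eq_iff₀ ht.ne', smul_eq_mul, ← integral_const_mul] at e
  rw [e]
  simp_rw [← gaussKernel_sqrt_smul ht, mul_assoc]

/-- The heat kernel is moved onto `ψ`: the pairing is the mean of `w` over the translates of `ψ` by
`√t·y` with weight `G(y,1)`. As `t → 0` the translates tend to `ψ`, and polynomial growth against a
Gaussian gives the majorant. -/
theorem tendsto_integral_heat (ψ : 𝓢(Plane, ℝ)) {A : ℝ → Plane → ℝ}
    (hA : ∀ t (ht : 0 < t), A t =ᵐ[volume] heat t ht w) :
    Tendsto (fun t => ∫ y, A t y * ψ y) (𝓝[>] 0) (𝓝 (w ψ)) := by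
  obtain ⟨N, K, hK, hb⟩ := exists_translate_bound w ψ
  have e : ∀ t, 0 < t → ∫ y, A t y * ψ y =
      ∫ y, gaussKernel 1 y * w (ψ.compSubConstCLM ℝ (√t • y)) := fun t ht => by
    have h1 : ∫ y, A t y * ψ y = ∫ y, ψ y * heat t ht w y :=
      integral_congr_ae (by filter_upwards [hA t ht] with y hy; rw [hy, mul_comm])
    rw [h1, integral_mul_heat, convSchwartz_comm, apply_convSchwartz,
      ← integral_gaussKernel_mul_eq ht fun y => w (ψ.compSubConstCLM ℝ y)]
    simp only [heatTest_apply, zero_sub, gaussKernel_neg]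
  have hev : (fun t => ∫ y, gaussKernel 1 y * w (ψ.compSubConstCLM ℝ (√t • y))) =ᶠ[𝓝[>] 0]
      fun t => ∫ y, A t y * ψ y := by
    filter_upwards [self_mem_nhdsWithin] with t ht using (e t ht).symm
  refine Tendsto.congr' hev ?_
  have hlim : w ψ = ∫ y, gaussKernel 1 y * w ψ := by
    rw [integral_mul_const, integral_gaussKernel one_pos, one_mul]
  rw [hlim]
  have hcont := continuous_translate w ψ
  refine tendsto_integral_filter_of_dominated_convergence
    (fun y => K * ((1 + ‖y‖) ^ N * ‖heatTest 1 one_pos 0 y‖)) (.of_forall fun t => ?_) ?_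
    ((integrable_one_add_norm_pow_mul _ N).const_mul K) (.of_forall fun y => ?_)
  · exact ((continuous_gaussKernel 1).mul
      (hcont.comp (continuous_const_smul _))).aestronglyMeasurable
  · have h1 : ∀ᶠ t : ℝ in 𝓝[>] 0, t ≤ 1 :=
      mem_nhdsWithin_of_mem_nhds (Iic_mem_nhds one_pos)
    filter_upwards [h1] with t ht
    refine .of_forall fun y => ?_
    rw [norm_mul, heatTest_apply, zero_sub, gaussKernel_neg, Real.norm_eq_abs (w _)]
    have hs : ‖√t • y‖ ≤ ‖y‖ := by
      rw [norm_smul, Real.norm_of_nonneg (Real.sqrt_nonneg t)]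
      exact mul_le_of_le_one_left (norm_nonneg y) (Real.sqrt_le_one.2 ht)
    calc ‖gaussKernel 1 y‖ * |w (ψ.compSubConstCLM ℝ (√t • y))|
        ≤ ‖gaussKernel 1 y‖ * (K * (1 + ‖√t • y‖) ^ N) := by gcongr; exact hb _
      _ ≤ ‖gaussKernel 1 y‖ * (K * (1 + ‖y‖) ^ N) := by gcongr
      _ = _ := by ring
  · refine Tendsto.const_mul _ ?_
    have h : Continuous fun t : ℝ => w (ψ.compSubConstCLM ℝ (√t • y)) :=
      hcont.comp (Real.continuous_sqrt.smul continuous_const)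
    have h0 := h.tendsto 0
    simp only [Real.sqrt_zero, zero_smul, SchwartzMap.compSubConstCLM_zero] at h0
    exact h0.mono_left nhdsWithin_le_nhds

end Heat

/-! ### The Besov norm -/

section Besov

theorem ofReal_rpow_mul_ofReal_rpow_neg {t : ℝ} (ht : 0 < t) (a : ℝ) :
    ENNReal.ofReal (t ^ a) * ENNReal.ofReal (t ^ (-a)) = 1 := by
  rw [← ENNReal.ofReal_mul (by positivity), ← Real.rpow_add ht, add_neg_cancel, Real.rpow_zero,
    ENNReal.ofReal_one]

theorem besovNorm_le_iff {w : Distr} {N : ℝ≥0∞} :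
    besovNorm w ≤ N ↔ ∀ t (ht : 0 < t),
      eLpNorm (heat t ht w) (4 / 3) volume ≤ ENNReal.ofReal (t ^ (-(1 / 4) : ℝ)) * N := by
  rw [besovNorm, iSup₂_le_iff]
  refine forall₂_congr fun t ht => ⟨fun h => ?_, fun h => ?_⟩
  · calc eLpNorm (heat t ht w) (4 / 3) volume
        = ENNReal.ofReal (t ^ (-(1 / 4) : ℝ)) *
          (ENNReal.ofReal (t ^ (1 / 4 : ℝ)) * eLpNorm (heat t ht w) (4 / 3) volume) := by
          rw [← mul_assoc, mul_comm (ENNReal.ofReal _) (ENNReal.ofReal _),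
            ofReal_rpow_mul_ofReal_rpow_neg ht, one_mul]
      _ ≤ _ := by gcongr
  · calc _ ≤ ENNReal.ofReal (t ^ (1 / 4 : ℝ)) * (ENNReal.ofReal (t ^ (-(1 / 4) : ℝ)) * N) := by
          gcongr
      _ = N := by rw [← mul_assoc, ofReal_rpow_mul_ofReal_rpow_neg ht, one_mul]

theorem eLpNorm_heat_le (w : Distr) {t : ℝ} (ht : 0 < t) :
    eLpNorm (heat t ht w) (4 / 3) volume ≤
      ENNReal.ofReal (t ^ (-(1 / 4) : ℝ)) * besovNorm w :=
  besovNorm_le_iff.1 le_rfl t ht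

theorem besovNorm_add_le (v w : Distr) : besovNorm (v + w) ≤ besovNorm v + besovNorm w := by
  refine besovNorm_le_iff.2 fun t ht => ?_
  have h : heat t ht (v + w) = heat t ht v + heat t ht w := rfl
  rw [h, mul_add]
  exact (eLpNorm_add_le (continuous_heat v ht).aestronglyMeasurable
    (continuous_heat w ht).aestronglyMeasurable Fact.out).trans
    (add_le_add (eLpNorm_heat_le v ht) (eLpNorm_heat_le w ht))

theorem norm_mul_le_one : ‖ContinuousLinearMap.mul ℝ ℝ‖ ≤ 1 :=
  ContinuousLinearMap.opNorm_mul_le ℝ ℝ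

/-- Both times are factored through the common time `r`. Continuity in time then depends only on the
difference of two Gaussians in `L¹`. -/
theorem heat_add_sub_heat_add (w : Distr) {r a b : ℝ} (hr : 0 < r) (ha : 0 < a) (hb : 0 < b) :
    (fun x => heat (a + r) (add_pos ha hr) w x - heat (b + r) (add_pos hb hr) w x) =
      convFun (ContinuousLinearMap.mul ℝ ℝ) (heat r hr w)
        (fun z => gaussKernel a z - gaussKernel b z) := by
  ext x
  have hi : ∀ {c : ℝ}, 0 < c → Integrable fun y => gaussKernel c (x - y) * heat r hr w y :=
    fun {c} hc => by
      refine (integrable_mul_heat w hr (heatTest c hc x)).congr (.of_forall fun y => ?_)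
      simp only [heatTest_apply]
  rw [heat_add w ha hr, heat_add w hb hr, ← integral_sub (hi ha) (hi hb), convFun,
    ← integral_sub_left_eq_self _ volume x]
  refine integral_congr_ae (.of_forall fun y => ?_)
  simp only [ContinuousLinearMap.mul_apply', sub_sub_cancel]
  ring

theorem eLpNorm_heat_sub_heat_le (w : Distr) {r a b : ℝ} (hr : 0 < r) (ha : 0 < a) (hb : 0 < b) :
    eLpNorm (fun x => heat (a + r) (add_pos ha hr) w x - heat (b + r) (add_pos hb hr) w x)
        (4 / 3) volume ≤
      eLpNorm (fun z => gaussKernel a z - gaussKernel b z) 1 volume *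
        eLpNorm (heat r hr w) (4 / 3) volume := by
  rw [heat_add_sub_heat_add w hr ha hb]
  exact eLpNorm_convFun_le _ norm_mul_le_one Fact.out four_thirds_ne_top
    (continuous_heat w hr).aestronglyMeasurable
    ((continuous_gaussKernel a).sub (continuous_gaussKernel b)).aestronglyMeasurable

variable {w : Distr} (hw : besovNorm w < ∞)

theorem memLp_heat {w : Distr} (hw : besovNorm w < ∞) {t : ℝ} (ht : 0 < t) : MemLp (heat t ht w) (4 / 3) volume :=
  ⟨(continuous_heat w ht).aestronglyMeasurable,
    (eLpNorm_heat_le w ht).trans_lt (ENNReal.mul_lt_top ENNReal.ofReal_lt_top hw)⟩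

/-- The curve `t ↦ e^{tΔ} w` in `L^{4/3}`, extended by zero to `t ≤ 0`. -/
def heatCurve (t : ℝ) : L43 :=
  open Classical in if ht : 0 < t then (memLp_heat hw ht).toLp else 0

theorem coeFn_heatCurve {t : ℝ} (ht : 0 < t) : heatCurve hw t =ᵐ[volume] heat t ht w := by
  rw [heatCurve, dif_pos ht]
  exact MemLp.coeFn_toLp _

theorem norm_heatCurve_le {t : ℝ} (ht : 0 < t) :
    ‖heatCurve hw t‖ ≤ (besovNorm w).toReal * t ^ (-(1 / 4) : ℝ) := by
  rw [heatCurve, dif_pos ht, Lp.norm_toLp]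
  refine ENNReal.toReal_le_of_le_ofReal (by positivity) ((eLpNorm_heat_le w ht).trans_eq ?_)
  rw [mul_comm, ENNReal.ofReal_mul ENNReal.toReal_nonneg, ENNReal.ofReal_toReal hw.ne]

theorem heat_toDistr_heatCurve {s t : ℝ} (hs : 0 < s) (ht : 0 < t) :
    heat s hs (toDistr (heatCurve hw t)) = heat (s + t) (add_pos hs ht) w := by
  ext x
  rw [heat_add w hs ht, heat, toDistr_apply]
  refine integral_congr_ae ?_
  filter_upwards [coeFn_heatCurve hw ht] with y hy
  rw [hy, heatTest_apply, mul_comm]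

theorem ofReal_rpow_neg_le {s t : ℝ} (hs : 0 < s) (ht : 0 ≤ t) :
    ENNReal.ofReal ((s + t) ^ (-(1 / 4) : ℝ)) ≤ ENNReal.ofReal (s ^ (-(1 / 4) : ℝ)) :=
  ENNReal.ofReal_le_ofReal
    (Real.rpow_le_rpow_of_nonpos hs (by linarith) (by norm_num))

theorem besovNorm_toDistr_heatCurve_le {t : ℝ} (ht : 0 < t) :
    besovNorm (toDistr (heatCurve hw t)) ≤ besovNorm w := by
  refine besovNorm_le_iff.2 fun s hs => ?_
  rw [heat_toDistr_heatCurve hw hs ht]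
  refine (eLpNorm_heat_le w (add_pos hs ht)).trans ?_
  gcongr ?_ * _
  exact ofReal_rpow_neg_le hs ht.le

theorem tendsto_mul_eLpNorm_gaussKernel_sub {t : ℝ} (ht : 0 < t) {N : ℝ≥0∞} (hN : N < ∞) :
    Tendsto (fun t' => eLpNorm (fun z => gaussKernel (t' - t / 2) z - gaussKernel (t / 2) z) 1
      volume * N) (𝓝 t) (𝓝 0) := by
  have h1 : Tendsto (fun t' => t' - t / 2) (𝓝 t) (𝓝 (t / 2)) := by
    have : Continuous fun t' => t' - t / 2 := by fun_prop
    convert this.tendsto t using 2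
    ring
  have h2 := (tendsto_eLpNorm_gaussKernel_sub (half_pos ht) one_ne_zero ENNReal.one_ne_top).comp h1
  simpa using ENNReal.Tendsto.mul_const h2 (Or.inr hN.ne)

/-- The time `t/2` is split off, which keeps both Gaussians at positive times as `t'` approaches
`t`. The remaining factor, at time `s + t/2`, is controlled by `s^{-1/4}‖w‖`, so the estimate is
uniform in `s`. -/
theorem tendsto_besovNorm_heatCurve_sub {t : ℝ} (ht : 0 < t) :
    Tendsto (fun t' => besovNorm (toDistr (heatCurve hw t') - toDistr (heatCurve hw t)))
      (𝓝 t) (𝓝 0) := by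
  refine tendsto_of_tendsto_of_tendsto_of_le_of_le' tendsto_const_nhds
    (tendsto_mul_eLpNorm_gaussKernel_sub ht hw) (.of_forall fun _ => zero_le) ?_
  filter_upwards [Ioi_mem_nhds (half_lt_self ht)] with t' ht'
  rw [Set.mem_Ioi] at ht'
  have ht0 : 0 < t' := (half_pos ht).trans ht'
  refine besovNorm_le_iff.2 fun s hs => ?_
  have h : heat s hs (toDistr (heatCurve hw t') - toDistr (heatCurve hw t)) =
      fun x => heat ((t' - t / 2) + (s + t / 2)) (by linarith) w x -
        heat (t / 2 + (s + t / 2)) (by linarith) w x := by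
    have e1 := heat_toDistr_heatCurve hw hs ht0
    have e2 := heat_toDistr_heatCurve hw hs ht
    ext x
    have e3 : heat s hs (toDistr (heatCurve hw t') - toDistr (heatCurve hw t)) x =
        heat s hs (toDistr (heatCurve hw t')) x - heat s hs (toDistr (heatCurve hw t)) x := rfl
    rw [e3, e1, e2]
    congr! 2 <;> ring
  rw [h]
  refine (eLpNorm_heat_sub_heat_le w (add_pos hs (half_pos ht)) (sub_pos.2 ht')
    (half_pos ht)).trans ?_
  rw [mul_left_comm]
  gcongr
  refine (eLpNorm_heat_le w _).trans ?_
  gcongr ?_ * _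
  exact ofReal_rpow_neg_le hs (half_pos ht).le

theorem continuousOn_heatCurve : ContinuousOn (heatCurve hw) (Set.Ioi 0) := by
  intro t ht
  rw [Set.mem_Ioi] at ht
  refine ContinuousAt.continuousWithinAt ?_
  rw [ContinuousAt, tendsto_iff_edist_tendsto_0]
  refine tendsto_of_tendsto_of_tendsto_of_le_of_le' tendsto_const_nhds
    (tendsto_mul_eLpNorm_gaussKernel_sub ht (memLp_heat hw (half_pos ht)).2)
    (.of_forall fun _ => zero_le) ?_
  filter_upwards [Ioi_mem_nhds (half_lt_self ht)] with t' ht'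
  rw [Set.mem_Ioi] at ht'
  have ht0 : 0 < t' := (half_pos ht).trans ht'
  rw [heatCurve, heatCurve, dif_pos ht0, dif_pos ht, Lp.edist_toLp_toLp]
  refine le_trans (le_of_eq ?_) (eLpNorm_heat_sub_heat_le w (half_pos ht) (sub_pos.2 ht')
    (half_pos ht))
  congr 1
  ext x
  simp only [Pi.sub_apply]
  congr! 2 <;> ring

theorem aestronglyMeasurable_heatCurve :
    AEStronglyMeasurable (heatCurve hw) (volume.restrict (Set.Ioi 0)) :=
  (continuousOn_heatCurve hw).aestronglyMeasurable measurableSet_Ioi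

end Besov

/-! ### Integrable functions as distributions -/

section Integrable

/-- The space of integrable functions on the plane. -/
abbrev L1 : Type := Lp ℝ 1 (volume : Measure Plane)

/-- The tempered distribution `ψ ↦ ∫ f ψ` given by an integrable function `f`. -/
def l1ToDistr (f : L1) : Distr :=
  (ContinuousLinearMap.mul ℝ ℝ).lpPairing volume 1 ∞ f ∘L SchwartzMap.toLpCLM ℝ ℝ ∞ volume

theorem l1ToDistr_apply (f : L1) (ψ : 𝓢(Plane, ℝ)) : l1ToDistr f ψ = ∫ x, f x * ψ x := by
  simp only [l1ToDistr, ContinuousLinearMap.comp_apply, SchwartzMap.toLpCLM_apply,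
    ContinuousLinearMap.lpPairing_eq_integral, ContinuousLinearMap.mul_apply']
  refine integral_congr_ae ?_
  filter_upwards [ψ.coeFn_toLp ∞ volume] with x hx
  rw [hx]

theorem toDistr_eq_l1ToDistr {f : L43} {g : L1} (h : f =ᵐ[volume] g) :
    toDistr f = l1ToDistr g := by
  ext ψ
  rw [toDistr_apply, l1ToDistr_apply]
  refine integral_congr_ae ?_
  filter_upwards [h] with x hx
  rw [hx]

theorem l1ToDistr_sub (f g : L1) : l1ToDistr (f - g) = l1ToDistr f - l1ToDistr g := by
  simp only [l1ToDistr, map_sub, ContinuousLinearMap.sub_comp]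

theorem toDistr_add (f g : L43) : toDistr (f + g) = toDistr f + toDistr g := by
  simp only [toDistr, map_add, ContinuousLinearMap.add_comp]

/-- Integrable functions belong to the Besov space. -/
theorem besovNorm_l1ToDistr_le (f : L1) :
    besovNorm (l1ToDistr f) ≤ ENNReal.ofReal gaussConst * ‖f‖ₑ := by
  refine besovNorm_le_iff.2 fun s hs => ?_
  have h : heat s hs (l1ToDistr f) =
      convFun (ContinuousLinearMap.mul ℝ ℝ) (gaussKernel s) f := by
    ext x
    rw [heat, l1ToDistr_apply, convFun]
    refine integral_congr_ae (.of_forall fun y => ?_)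
    simp only [heatTest_apply, ContinuousLinearMap.mul_apply', mul_comm]
  rw [h]
  refine (eLpNorm_convFun_le _ norm_mul_le_one Fact.out four_thirds_ne_top
    (continuous_gaussKernel s).aestronglyMeasurable (Lp.aestronglyMeasurable f)).trans_eq ?_
  rw [eLpNorm_gaussKernel hs, ENNReal.ofReal_mul gaussConst_pos.le, ← Lp.enorm_def, neg_div]
  ring

theorem norm_sub_le_seminorm (ψ : 𝓢(Plane, ℝ)) (a b : Plane) :
    ‖ψ a - ψ b‖ ≤ SchwartzMap.seminorm ℝ 0 1 ψ * ‖a - b‖ := by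
  refine convex_univ.norm_image_sub_le_of_norm_fderiv_le (𝕜 := ℝ)
    (fun x _ => ψ.differentiableAt) (fun x _ => ?_) (Set.mem_univ b) (Set.mem_univ a)
  rw [← norm_iteratedFDeriv_one]
  exact ψ.norm_iteratedFDeriv_le_seminorm ℝ 1 x

/-- The kernel `∇G(·,s)` has mean zero, so `ψ(y)` may be subtracted from `ψ`. The Lipschitz bound
for `ψ` then produces the factor `|z|` that cancels the singularity in `s`. -/
theorem norm_integral_mul_inner_gradient_le (ψ : 𝓢(Plane, ℝ)) {s : ℝ} (hs : 0 < s)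
    (y v : Plane) :
    ‖∫ x, ψ x * inner ℝ (gradient (gaussKernel s) (x - y)) v‖ ≤
      8 * SchwartzMap.seminorm ℝ 0 1 ψ * ‖v‖ := by
  have hi := integrable_gradient_gaussKernel hs
  have h1 : ∫ x, ψ x * inner ℝ (gradient (gaussKernel s) (x - y)) v =
      ∫ z, (ψ (z + y) - ψ y) * inner ℝ (gradient (gaussKernel s) z) v := by
    have e0 : ∫ z, ψ y * inner ℝ (gradient (gaussKernel s) z) v = 0 := by
      have := integral_inner (𝕜 := ℝ) hi v
      simp_rw [real_inner_comm _ v] at this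
      rw [integral_const_mul, this, integral_gradient_gaussKernel hs, inner_zero_left, mul_zero]
    have hv : Integrable fun z => inner ℝ (gradient (gaussKernel s) z) v := hi.inner_const v
    rw [← integral_add_right_eq_self _ y]
    simp only [add_sub_cancel_right, sub_mul]
    rw [integral_sub _ (hv.const_mul _), e0, sub_zero]
    refine hv.bdd_mul (c := SchwartzMap.seminorm ℝ 0 0 ψ)
      (ψ.continuous.comp (continuous_add_const y)).aestronglyMeasurable
      (.of_forall fun z => ψ.norm_le_seminorm ℝ _)
  rw [h1]
  have hG := integrable_gaussKernel (t := 2 * s) (by positivity)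
  refine (norm_integral_le_of_norm_le
    (hG.const_mul (8 * SchwartzMap.seminorm ℝ 0 1 ψ * ‖v‖)) (.of_forall fun z => ?_)).trans_eq ?_
  · rw [norm_mul]
    have a1 := norm_sub_le_seminorm ψ (z + y) y
    rw [add_sub_cancel_right] at a1
    have a2 := norm_inner_le_norm (𝕜 := ℝ) (gradient (gaussKernel s) z) v
    have a3 := norm_mul_norm_gradient_gaussKernel_le hs z
    calc _ ≤ (SchwartzMap.seminorm ℝ 0 1 ψ * ‖z‖) * (‖gradient (gaussKernel s) z‖ * ‖v‖) := by
          gcongr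
      _ = (‖z‖ * ‖gradient (gaussKernel s) z‖) * (SchwartzMap.seminorm ℝ 0 1 ψ * ‖v‖) := by ring
      _ ≤ (8 * gaussKernel (2 * s) z) * (SchwartzMap.seminorm ℝ 0 1 ψ * ‖v‖) := by gcongr
      _ = _ := by ring
  · rw [integral_const_mul, integral_gaussKernel (by positivity), mul_one]

/-- Fubini moves the test function inside, where the preceding bound applies for each `y`
separately. -/
theorem norm_integral_convFun_mul_le (ψ : 𝓢(Plane, ℝ)) {s : ℝ} (hs : 0 < s) (F : L1Field) :
    ‖∫ x, convFun innerBilin (gradient (gaussKernel s)) F x * ψ x‖ ≤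
      8 * SchwartzMap.seminorm ℝ 0 1 ψ * ‖F‖ := by
  have hF := L1.integrable_coeFn F
  have hint : Integrable (fun q : Plane × Plane =>
      ψ q.1 * innerBilin (gradient (gaussKernel s) (q.1 - q.2)) (F q.2))
      (volume.prod volume) := by
    refine Integrable.bdd_mul (c := SchwartzMap.seminorm ℝ 0 0 ψ) ?_
      (ψ.continuous.comp continuous_fst).aestronglyMeasurable
      (.of_forall fun q => ψ.norm_le_seminorm ℝ _)
    refine (hF.convolution_integrand innerBilin
      (integrable_gradient_gaussKernel hs)).congr (.of_forall fun q => ?_)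
    simp only [innerBilin_apply, real_inner_comm]
  have h2 : ∫ x, convFun innerBilin (gradient (gaussKernel s)) F x * ψ x =
      ∫ y, ∫ x, ψ x * inner ℝ (gradient (gaussKernel s) (x - y)) (F y) := by
    rw [integral_integral_swap (f := fun y x => ψ x * inner ℝ (gradient (gaussKernel s) (x - y)) (F y)) hint.swap]
    refine integral_congr_ae (.of_forall fun x => ?_)
    simp only [convFun, innerBilin_apply]
    rw [mul_comm, ← integral_const_mul]
  rw [h2]
  refine (norm_integral_le_of_norm_le (hF.norm.const_mul (8 * SchwartzMap.seminorm ℝ 0 1 ψ))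
    (.of_forall fun y => norm_integral_mul_inner_gradient_le ψ hs y (F y))).trans_eq ?_
  rw [integral_const_mul, L1.norm_eq_integral_norm]

end Integrable

/-! ### The curve `e^{tΔ} w + ∫₀ᵗ e^{(t - τ)Δ} ∇ · P(τ) dτ` -/

section Curve

/-- The constant in the bilinear estimate in `L^{4/3}`. -/
def duhamelConst : ℝ :=
  2 * gaussConst * (2 ^ (1 / 2 : ℝ) / (1 - 3 / 4) + 2 ^ (3 / 4 : ℝ) / (1 - 1 / 2))

theorem duhamelConst_nonneg : 0 ≤ duhamelConst := by
  have := gaussConst_pos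
  unfold duhamelConst
  norm_num
  positivity

theorem integrableOn_duhamel_four_thirds {P : ℝ → L1Field}
    (hPm : AEStronglyMeasurable P (volume.restrict (Set.Ioi 0))) {m : ℝ}
    (hP : ∀ τ, 0 < τ → ‖P τ‖ ≤ m * τ ^ (-(1 / 2) : ℝ)) {t : ℝ} (ht : 0 < t) :
    IntegrableOn (fun τ => conv innerBilin norm_innerBilin_le (gradHeat (4 / 3) (t - τ)) (P τ))
      (Set.Ioo 0 t) :=
  integrableOn_duhamel_integrand hPm (by norm_num) (by norm_num) (by norm_num) (by norm_num)
    (by have := gaussConst_pos; positivity) (fun _ => norm_gradHeat_four_thirds_le) hP ht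

theorem integrableOn_duhamel_one {P : ℝ → L1Field}
    (hPm : AEStronglyMeasurable P (volume.restrict (Set.Ioi 0))) {m : ℝ}
    (hP : ∀ τ, 0 < τ → ‖P τ‖ ≤ m * τ ^ (-(1 / 2) : ℝ)) {t : ℝ} (ht : 0 < t) :
    IntegrableOn (fun τ => conv innerBilin norm_innerBilin_le (gradHeat 1 (t - τ)) (P τ))
      (Set.Ioo 0 t) :=
  integrableOn_duhamel_integrand hPm (by norm_num) (by norm_num) (by norm_num) (by norm_num)
    two_pos.le (fun _ => norm_gradHeat_one_le) hP ht

theorem norm_duhamel_four_thirds_le {P : ℝ → L1Field} {m : ℝ} (hm : 0 ≤ m)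
    (hP : ∀ τ, 0 < τ → ‖P τ‖ ≤ m * τ ^ (-(1 / 2) : ℝ)) {t : ℝ} (ht : 0 < t) :
    ‖duhamel (4 / 3) P t‖ ≤ duhamelConst * m * t ^ (-(1 / 4) : ℝ) := by
  refine (norm_duhamel_le (α := 3 / 4) (β := 1 / 2) (by norm_num) (by norm_num) (by norm_num)
    (by norm_num) (by have := gaussConst_pos; positivity) hm
    (fun _ => norm_gradHeat_four_thirds_le) hP ht).trans_eq ?_
  rw [show (1 - 3 / 4 - 1 / 2 : ℝ) = -(1 / 4) by norm_num, duhamelConst]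
  ring

theorem norm_duhamel_one_le {P : ℝ → L1Field} {m : ℝ} (hm : 0 ≤ m)
    (hP : ∀ τ, 0 < τ → ‖P τ‖ ≤ m * τ ^ (-(1 / 2) : ℝ)) {t : ℝ} (ht : 0 < t) :
    ‖duhamel 1 P t‖ ≤ 2 * m * (2 ^ (1 / 2 : ℝ) / (1 - 1 / 2) + 2 ^ (1 / 2 : ℝ) / (1 - 1 / 2)) := by
  refine (norm_duhamel_le (α := 1 / 2) (β := 1 / 2) (by norm_num) (by norm_num) (by norm_num)
    (by norm_num) two_pos.le hm (fun _ => norm_gradHeat_one_le) hP ht).trans_eq ?_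
  rw [show (1 - 1 / 2 - 1 / 2 : ℝ) = 0 by norm_num, Real.rpow_zero, mul_one]

/-- Both Bochner integrals are evaluated almost everywhere by the same pointwise time integral. The
Duhamel term therefore inherits its `BX` properties from `L¹`. -/
theorem duhamel_four_thirds_ae_eq_duhamel_one {P : ℝ → L1Field}
    (hPm : AEStronglyMeasurable P (volume.restrict (Set.Ioi 0))) {m : ℝ}
    (hP : ∀ τ, 0 < τ → ‖P τ‖ ≤ m * τ ^ (-(1 / 2) : ℝ)) {t : ℝ} (ht : 0 < t) :
    duhamel (4 / 3) P t =ᵐ[volume] duhamel 1 P t := by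
  filter_upwards [coeFn_duhamel hPm ht (integrableOn_duhamel_four_thirds hPm hP ht),
    coeFn_duhamel hPm ht (integrableOn_duhamel_one hPm hP ht)] with x h1 h2
  rw [h1.2, h2.2]

theorem toDistr_duhamel {P : ℝ → L1Field}
    (hPm : AEStronglyMeasurable P (volume.restrict (Set.Ioi 0))) {m : ℝ}
    (hP : ∀ τ, 0 < τ → ‖P τ‖ ≤ m * τ ^ (-(1 / 2) : ℝ)) {t : ℝ} (ht : 0 < t) :
    toDistr (duhamel (4 / 3) P t) = l1ToDistr (duhamel 1 P t) :=
  toDistr_eq_l1ToDistr (duhamel_four_thirds_ae_eq_duhamel_one hPm hP ht)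

/-- The `L¹` norm of the Duhamel term is merely bounded as `t → 0`. Against a smooth function the
kernel costs no power of `t - τ`, so the exponents are `α = 0`, `β = 1/2` and a factor `t^{1/2}` is
left. -/
theorem abs_l1ToDistr_duhamel_le {P : ℝ → L1Field}
    (hPm : AEStronglyMeasurable P (volume.restrict (Set.Ioi 0))) {m : ℝ}
    (hP : ∀ τ, 0 < τ → ‖P τ‖ ≤ m * τ ^ (-(1 / 2) : ℝ)) (hm : 0 ≤ m) {t : ℝ} (ht : 0 < t)
    (ψ : 𝓢(Plane, ℝ)) :
    ‖l1ToDistr (duhamel 1 P t) ψ‖ ≤ 8 * SchwartzMap.seminorm ℝ 0 1 ψ * m *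
      ((2 ^ (1 / 2 : ℝ) / (1 - 0) + 2 ^ (0 : ℝ) / (1 - 1 / 2)) * t ^ (1 / 2 : ℝ)) := by
  let Λ : L1 →L[ℝ] ℝ :=
    ((ContinuousLinearMap.mul ℝ ℝ).lpPairing volume 1 ∞).flip (ψ.toLp ∞ volume)
  have hΛ : ∀ f : L1, l1ToDistr f ψ = Λ f := fun f => rfl
  have hI := integrableOn_rpow_mul_rpow (α := 0) (β := 1 / 2) le_rfl one_pos (by norm_num)
    (by norm_num) ht
  have h8 : 0 ≤ 8 * SchwartzMap.seminorm ℝ 0 1 ψ * m := by positivity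
  rw [hΛ, duhamel, ← Λ.integral_comp_comm (integrableOn_duhamel_one hPm hP ht)]
  refine (norm_integral_le_of_norm_le (hI.1.const_mul (8 * SchwartzMap.seminorm ℝ 0 1 ψ * m))
    ?_).trans ?_
  · filter_upwards [ae_restrict_mem measurableSet_Ioo] with τ hτ
    have hs : 0 < t - τ := sub_pos.2 hτ.2
    rw [← hΛ, l1ToDistr_apply]
    have e : ∫ x, conv innerBilin norm_innerBilin_le (gradHeat 1 (t - τ)) (P τ) x * ψ x =
        ∫ x, convFun innerBilin (gradient (gaussKernel (t - τ))) (P τ) x * ψ x := by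
      refine integral_congr_ae ?_
      filter_upwards [coeFn_conv innerBilin norm_innerBilin_le (gradHeat 1 (t - τ)) (P τ)] with x hx
      rw [hx, convFun_congr_ae innerBilin (coeFn_gradHeat 1 hs) (ae_eq_refl _)]
    rw [e]
    refine (norm_integral_convFun_mul_le ψ hs (P τ)).trans ?_
    rw [neg_zero, Real.rpow_zero, one_mul, mul_assoc _ m]
    gcongr
    exact hP τ hτ.1
  · rw [integral_const_mul]
    refine mul_le_mul_of_nonneg_left ?_ h8
    have h := hI.2
    rwa [show (1 - 0 - 1 / 2 : ℝ) = 1 / 2 by norm_num] at h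

theorem tendsto_l1ToDistr_duhamel {P : ℝ → L1Field}
    (hPm : AEStronglyMeasurable P (volume.restrict (Set.Ioi 0))) {m : ℝ}
    (hP : ∀ τ, 0 < τ → ‖P τ‖ ≤ m * τ ^ (-(1 / 2) : ℝ)) (hm : 0 ≤ m) (ψ : 𝓢(Plane, ℝ)) :
    Tendsto (fun t => l1ToDistr (duhamel 1 P t) ψ) (𝓝[>] 0) (𝓝 0) := by
  have hlim : Tendsto (fun t : ℝ => 8 * SchwartzMap.seminorm ℝ 0 1 ψ * m *
      ((2 ^ (1 / 2 : ℝ) / (1 - 0) + 2 ^ (0 : ℝ) / (1 - 1 / 2)) * t ^ (1 / 2 : ℝ)))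
      (𝓝[>] 0) (𝓝 0) := by
    have h := ((Real.continuous_rpow_const (q := 1 / 2) (by norm_num)).tendsto 0)
    rw [Real.zero_rpow (by norm_num)] at h
    have h2 := ((h.const_mul (2 ^ (1 / 2 : ℝ) / (1 - 0) + 2 ^ (0 : ℝ) / (1 - 1 / 2))).const_mul
      (8 * SchwartzMap.seminorm ℝ 0 1 ψ * m)).mono_left (nhdsWithin_le_nhds (s := Set.Ioi 0))
    rwa [mul_zero, mul_zero] at h2
  refine squeeze_zero_norm' ?_ hlim
  filter_upwards [self_mem_nhdsWithin] with t ht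
  exact abs_l1ToDistr_duhamel_le hPm hP hm ht ψ

/-- The linear part is continuous in `BX`, so it suffices to approximate the time variable. The
Duhamel part is strongly measurable in `L¹`, whose simple approximations also converge in `BX`. -/
theorem exists_simpleFunc_tendsto_besovNorm {w : Distr} (hw : besovNorm w < ∞) {P : ℝ → L1Field}
    (hPm : AEStronglyMeasurable P (volume.restrict (Set.Ioi 0))) {m : ℝ}
    (hP : ∀ τ, 0 < τ → ‖P τ‖ ≤ m * τ ^ (-(1 / 2) : ℝ)) :
    ∃ s : ℕ → SimpleFunc ℝ Distr, (∀ n t, besovNorm (s n t) < ∞) ∧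
      ∀ t, 0 < t → Tendsto (fun n => besovNorm
        (s n t - toDistr (heatCurve hw t + duhamel (4 / 3) P t))) atTop (𝓝 0) := by
  have hD := stronglyMeasurable_duhamel (p := 1) hPm
  -- The approximations of `t` take only positive values, so `heatCurve` is evaluated where it is
  -- the heat flow.
  let τ : ℕ → SimpleFunc ℝ ℝ := fun n =>
    SimpleFunc.approxOn id measurable_id (Set.Ioi 0) 1 (Set.mem_Ioi.2 one_pos) n
  have hτ : ∀ n t, 0 < τ n t := fun n t =>
    Set.mem_Ioi.1 (SimpleFunc.approxOn_mem measurable_id (Set.mem_Ioi.2 one_pos) n t)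
  refine ⟨fun n => (τ n).map (fun r => toDistr (heatCurve hw r)) + (hD.approx n).map l1ToDistr,
    fun n t => ?_, fun t ht => ?_⟩
  · refine (besovNorm_add_le _ _).trans_lt (ENNReal.add_lt_top.2 ⟨?_, ?_⟩)
    · exact (besovNorm_toDistr_heatCurve_le hw (hτ n t)).trans_lt hw
    · exact (besovNorm_l1ToDistr_le _).trans_lt (ENNReal.mul_lt_top ENNReal.ofReal_lt_top
        enorm_lt_top)
  · have h1 : Tendsto (fun n => τ n t) atTop (𝓝 t) :=
      SimpleFunc.tendsto_approxOn measurable_id _ (subset_closure (Set.mem_Ioi.2 ht))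
    have h2 := (tendsto_besovNorm_heatCurve_sub hw ht).comp h1
    have h3 : Tendsto (fun n => ENNReal.ofReal gaussConst * ‖hD.approx n t - duhamel 1 P t‖ₑ)
        atTop (𝓝 0) := by
      have := (tendsto_iff_edist_tendsto_0.1 (hD.tendsto_approx t))
      simp_rw [edist_eq_enorm_sub] at this
      simpa using ENNReal.Tendsto.const_mul this (Or.inr ENNReal.ofReal_ne_top)
    have h4 := h2.add h3
    rw [add_zero] at h4
    refine tendsto_of_tendsto_of_tendsto_of_le_of_le tendsto_const_nhds h4 (fun _ => zero_le)
      fun n => ?_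
    have e : ((τ n).map (fun r => toDistr (heatCurve hw r)) + (hD.approx n).map l1ToDistr) t -
        toDistr (heatCurve hw t + duhamel (4 / 3) P t) =
        (toDistr (heatCurve hw (τ n t)) - toDistr (heatCurve hw t)) +
          l1ToDistr (hD.approx n t - duhamel 1 P t) := by
      rw [toDistr_add, toDistr_duhamel hPm hP ht, l1ToDistr_sub, ← add_sub_add_comm]
      rfl
    simp only [e]
    exact (besovNorm_add_le _ _).trans (add_le_add le_rfl (besovNorm_l1ToDistr_le _))

/-- Only the `L¹` bound `mτ^{-1/2}` on the flux is used here, not that `P` comes from `u`. Each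
requirement splits into the heat flow and the Duhamel term. -/
theorem memSolutionSpace_of_eq {w : Distr} (hw : besovNorm w < ∞) {P : ℝ → L1Field}
    (hPm : AEStronglyMeasurable P (volume.restrict (Set.Ioi 0))) {m : ℝ}
    (hP : ∀ τ, 0 < τ → ‖P τ‖ ≤ m * τ ^ (-(1 / 2) : ℝ)) (hm : 0 ≤ m) {u : ℝ → L43}
    (hu : ∀ t, 0 < t → u t = heatCurve hw t + duhamel (4 / 3) P t) (hu2 : weightedSup u < ∞) :
    MemSolutionSpace w u where
  measurable_besov := by
    obtain ⟨s, hs, hlim⟩ := exists_simpleFunc_tendsto_besovNorm hw hPm hP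
    refine ⟨s, hs, ?_⟩
    filter_upwards [ae_restrict_mem measurableSet_Ioi] with t ht
    rw [hu t ht]
    exact hlim t ht
  bounded_besov := by
    refine lt_of_le_of_lt (iSup₂_le fun t ht => ?_) (b := besovNorm w +
      ENNReal.ofReal gaussConst * ENNReal.ofReal (2 * m *
        (2 ^ (1 / 2 : ℝ) / (1 - 1 / 2) + 2 ^ (1 / 2 : ℝ) / (1 - 1 / 2)))) ?_
    · rw [hu t ht, toDistr_add, toDistr_duhamel hPm hP ht]
      refine (besovNorm_add_le _ _).trans (add_le_add (besovNorm_toDistr_heatCurve_le hw ht) ?_)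
      refine (besovNorm_l1ToDistr_le _).trans ?_
      gcongr
      rw [← ofReal_norm]
      exact ENNReal.ofReal_le_ofReal (norm_duhamel_one_le hm hP ht)
    · exact ENNReal.add_lt_top.2 ⟨hw, ENNReal.mul_lt_top ENNReal.ofReal_lt_top ENNReal.ofReal_lt_top⟩
  initial ψ := by
    have h := (tendsto_integral_heat w ψ (A := fun t => heatCurve hw t)
      fun t ht => coeFn_heatCurve hw ht).add (tendsto_l1ToDistr_duhamel hPm hP hm ψ)
    rw [add_zero] at h
    refine h.congr' ?_
    filter_upwards [self_mem_nhdsWithin] with t ht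
    rw [← toDistr_duhamel hPm hP ht, ← toDistr_apply, ← toDistr_apply, hu t ht, toDistr_add]
    rfl
  measurable_L43 := by
    refine ((aestronglyMeasurable_heatCurve hw).add
      (stronglyMeasurable_duhamel (p := 4 / 3) hPm).aestronglyMeasurable).congr ?_
    filter_upwards [ae_restrict_mem measurableSet_Ioi] with t ht
    exact (hu t ht).symm
  bounded_L43 := hu2

end Curve

/-! ### The bilinear estimate and the fixed point -/

section FixedPoint

/-- The nonlinear term `∫₀ᵗ e^{(t - τ)Δ} ∇ · (u ∇φ_u)(τ) dτ` of the Duhamel formula. -/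
def nonlinear (u : ℝ → L43) : ℝ → L43 := duhamel (4 / 3) fun τ => flux (u τ) (u τ)

/-- The constant of the bilinear estimate. -/
def bilinConst : ℝ := duhamelConst * hlsConst

theorem bilinConst_nonneg : 0 ≤ bilinConst := mul_nonneg duhamelConst_nonneg hlsConst_nonneg

theorem aestronglyMeasurable_flux {u : ℝ → L43} (hu : MeasurableInTime u) :
    AEStronglyMeasurable (fun τ => flux (u τ) (u τ)) (volume.restrict (Set.Ioi 0)) :=
  flux.aestronglyMeasurable_comp₂ hu hu

theorem norm_flux_le_of_le {f g : L43} {a b τ : ℝ} (hτ : 0 < τ) (ha : 0 ≤ a)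
    (hf : ‖f‖ ≤ a * τ ^ (-(1 / 4) : ℝ)) (hg : ‖g‖ ≤ b * τ ^ (-(1 / 4) : ℝ)) :
    ‖flux f g‖ ≤ hlsConst * (a * b) * τ ^ (-(1 / 2) : ℝ) := by
  have h := hlsConst_nonneg
  refine (norm_flux_le f g).trans ?_
  calc hlsConst * ‖f‖ * ‖g‖
      ≤ hlsConst * (a * τ ^ (-(1 / 4) : ℝ)) * (b * τ ^ (-(1 / 4) : ℝ)) := by gcongr
    _ = hlsConst * (a * b) * (τ ^ (-(1 / 4) : ℝ) * τ ^ (-(1 / 4) : ℝ)) := by ring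
    _ = _ := by rw [← Real.rpow_add hτ]; norm_num

/-- Bilinearity: `B(f,f) - B(g,g) = B(f-g,f) + B(g,f-g)`. -/
theorem norm_flux_sub_flux_le {f g : L43} {a d τ : ℝ} (hτ : 0 < τ) (ha : 0 ≤ a) (hd : 0 ≤ d)
    (hf : ‖f‖ ≤ a * τ ^ (-(1 / 4) : ℝ)) (hg : ‖g‖ ≤ a * τ ^ (-(1 / 4) : ℝ))
    (hfg : ‖f - g‖ ≤ d * τ ^ (-(1 / 4) : ℝ)) :
    ‖flux f f - flux g g‖ ≤ hlsConst * (2 * a * d) * τ ^ (-(1 / 2) : ℝ) := by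
  have e : flux f f - flux g g = flux (f - g) f + flux g (f - g) := by
    rw [map_sub, map_sub, sub_apply]
    abel
  rw [e]
  refine (norm_add_le _ _).trans ((add_le_add (norm_flux_le_of_le hτ hd hfg hf)
    (norm_flux_le_of_le hτ ha hg hfg)).trans_eq ?_)
  ring

theorem norm_nonlinear_le {u : ℝ → L43} {a : ℝ} (ha : 0 ≤ a)
    (hu : ∀ t, 0 < t → ‖u t‖ ≤ a * t ^ (-(1 / 4) : ℝ)) {t : ℝ} (ht : 0 < t) :
    ‖nonlinear u t‖ ≤ bilinConst * a ^ 2 * t ^ (-(1 / 4) : ℝ) := by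
  have h := hlsConst_nonneg
  refine (norm_duhamel_four_thirds_le (m := hlsConst * (a * a)) (by positivity)
    (fun τ hτ => norm_flux_le_of_le hτ ha (hu τ hτ) (hu τ hτ)) ht).trans_eq ?_
  rw [bilinConst]; ring

theorem norm_nonlinear_sub_le {u v : ℝ → L43} (hum : MeasurableInTime u)
    (hvm : MeasurableInTime v) {a d : ℝ} (ha : 0 ≤ a) (hd : 0 ≤ d)
    (hu : ∀ t, 0 < t → ‖u t‖ ≤ a * t ^ (-(1 / 4) : ℝ))
    (hv : ∀ t, 0 < t → ‖v t‖ ≤ a * t ^ (-(1 / 4) : ℝ))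
    (huv : ∀ t, 0 < t → ‖u t - v t‖ ≤ d * t ^ (-(1 / 4) : ℝ)) {t : ℝ} (ht : 0 < t) :
    ‖nonlinear u t - nonlinear v t‖ ≤ bilinConst * (2 * a) * d * t ^ (-(1 / 4) : ℝ) := by
  have h := hlsConst_nonneg
  have e : nonlinear u t - nonlinear v t =
      duhamel (4 / 3) (fun τ => flux (u τ) (u τ) - flux (v τ) (v τ)) t := by
    rw [nonlinear, nonlinear, duhamel, duhamel, duhamel, ← integral_sub]
    · simp only [map_sub]
    · exact integrableOn_duhamel_four_thirds (aestronglyMeasurable_flux hum)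
        (fun τ hτ => norm_flux_le_of_le hτ ha (hu τ hτ) (hu τ hτ)) ht
    · exact integrableOn_duhamel_four_thirds (aestronglyMeasurable_flux hvm)
        (fun τ hτ => norm_flux_le_of_le hτ ha (hv τ hτ) (hv τ hτ)) ht
  rw [e]
  refine (norm_duhamel_four_thirds_le (m := hlsConst * (2 * a * d)) (by positivity)
    (fun τ hτ => norm_flux_sub_flux_le hτ ha hd (hu τ hτ) (hv τ hτ) (huv τ hτ)) ht).trans_eq ?_
  rw [bilinConst]; ring

theorem heatBilin_eq_convFun_flux (s : ℝ) (f g : L43) (x : Plane) :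
    heatBilin s f g x = convFun innerBilin (gradient (gaussKernel s)) (flux f g) x := by
  rw [convFun_congr_ae innerBilin (ae_eq_refl _) (coeFn_flux f g)]
  rfl

/-- The weighted bound on `u` makes the Duhamel integrand Bochner integrable, so the absolute
convergence demanded of a mild solution is automatic. What is left is an equality of functions
almost everywhere, that is, in `L^{4/3}`. -/
theorem isMildSolution_iff {w : Distr} (hw : besovNorm w < ∞) {u : ℝ → L43}
    (hum : MeasurableInTime u) {a : ℝ} (ha : 0 ≤ a)
    (hu : ∀ t, 0 < t → ‖u t‖ ≤ a * t ^ (-(1 / 4) : ℝ)) :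
    IsMildSolution w u ↔ ∀ t, 0 < t → u t = heatCurve hw t + nonlinear u t := by
  have hP := aestronglyMeasurable_flux hum
  simp only [IsMildSolution, heatBilin_eq_convFun_flux]
  refine forall₂_congr fun t ht => ?_
  have hD := coeFn_duhamel hP ht (integrableOn_duhamel_four_thirds hP
    (fun τ hτ => norm_flux_le_of_le hτ ha (hu τ hτ) (hu τ hτ)) ht)
  refine ⟨fun h => Lp.ext ?_, fun h => ?_⟩
  · filter_upwards [h, hD, coeFn_heatCurve hw ht, Lp.coeFn_add (heatCurve hw t) (nonlinear u t)]
      with x h1 h2 h3 h4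
    rw [h4, Pi.add_apply, h3, h1.2, nonlinear, h2.2]
  · filter_upwards [hD, coeFn_heatCurve hw ht, Lp.coeFn_add (heatCurve hw t) (nonlinear u t)]
      with x h2 h3 h4
    refine ⟨h2.1, ?_⟩
    rw [h, h4, Pi.add_apply, h3, nonlinear, h2.2]

theorem weightedSup_le_iff {u : ℝ → L43} {a : ℝ} (ha : 0 ≤ a) :
    weightedSup u ≤ ENNReal.ofReal a ↔ ∀ t, 0 < t → ‖u t‖ ≤ a * t ^ (-(1 / 4) : ℝ) := by
  rw [weightedSup, iSup₂_le_iff]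
  refine forall₂_congr fun t ht => ?_
  rw [ENNReal.ofReal_le_ofReal_iff ha, Real.rpow_neg ht.le, ← div_eq_mul_inv,
    le_div_iff₀ (by positivity), mul_comm]

/-- The Picard iterates. -/
def picard {w : Distr} (hw : besovNorm w < ∞) : ℕ → ℝ → L43
  | 0 => heatCurve hw
  | n + 1 => fun t => heatCurve hw t + nonlinear (picard hw n) t

variable {w : Distr} (hw : besovNorm w < ∞)

theorem measurableInTime_nonlinear {u : ℝ → L43} (hu : MeasurableInTime u) :
    MeasurableInTime (nonlinear u) :=
  (stronglyMeasurable_duhamel (aestronglyMeasurable_flux hu)).aestronglyMeasurable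

theorem measurableInTime_picard (n : ℕ) : MeasurableInTime (picard hw n) := by
  induction n with
  | zero => exact aestronglyMeasurable_heatCurve hw
  | succ n ih => exact (aestronglyMeasurable_heatCurve hw).add (measurableInTime_nonlinear ih)

/-- With `K = bilinConst`, the ball of radius `2N` is invariant: `N + K(2N)² = N + 4KN·N ≤ 2N`,
because `8KN ≤ 1`. -/
theorem norm_picard_le {w : Distr} (hw : besovNorm w < ∞) {N : ℝ} (hN0 : 0 ≤ N)
    (hN : (besovNorm w).toReal ≤ N) (hsmall : 8 * bilinConst * N ≤ 1) (n : ℕ) :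
    ∀ t, 0 < t → ‖picard hw n t‖ ≤ 2 * N * t ^ (-(1 / 4) : ℝ) := by
  induction n with
  | zero =>
    intro t ht
    refine (norm_heatCurve_le hw ht).trans ?_
    gcongr
    linarith
  | succ n ih =>
    intro t ht
    refine (norm_add_le _ _).trans ((add_le_add (norm_heatCurve_le hw ht)
      (norm_nonlinear_le (by positivity) ih ht)).trans ?_)
    rw [← add_mul]
    gcongr
    nlinarith [mul_le_mul_of_nonneg_right hsmall hN0]

/-- On the ball of radius `2N` the Lipschitz constant is `K·2·2N = 4KN ≤ 1/2`. The initial factor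
`4N` is the diameter bound. -/
theorem norm_picard_succ_sub_le {w : Distr} (hw : besovNorm w < ∞) {N : ℝ} (hN0 : 0 ≤ N)
    (hN : (besovNorm w).toReal ≤ N) (hsmall : 8 * bilinConst * N ≤ 1) (n : ℕ) :
    ∀ t, 0 < t → ‖picard hw (n + 1) t - picard hw n t‖ ≤
      4 * N * (1 / 2) ^ n * t ^ (-(1 / 4) : ℝ) := by
  have hb := norm_picard_le hw hN0 hN hsmall
  induction n with
  | zero =>
    intro t ht
    refine (norm_sub_le _ _).trans ((add_le_add (hb 1 t ht) (hb 0 t ht)).trans_eq ?_)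
    ring
  | succ n ih =>
    intro t ht
    have e : picard hw (n + 1 + 1) t - picard hw (n + 1) t =
        nonlinear (picard hw (n + 1)) t - nonlinear (picard hw n) t :=
      add_sub_add_left_eq_sub _ _ _
    rw [e]
    refine (norm_nonlinear_sub_le (measurableInTime_picard hw _) (measurableInTime_picard hw _)
      (by positivity) (by positivity) (hb (n + 1)) (hb n) ih ht).trans ?_
    rw [pow_succ]
    gcongr ?_ * _
    calc bilinConst * (2 * (2 * N)) * (4 * N * (1 / 2) ^ n)
        = (8 * bilinConst * N) * (2 * N * (1 / 2) ^ n) := by ring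
      _ ≤ 1 * (2 * N * (1 / 2) ^ n) := by gcongr
      _ = _ := by ring

/-- Existence of a fixed point. -/
theorem exists_fixedPoint {w : Distr} (hw : besovNorm w < ∞) {N : ℝ} (hN0 : 0 ≤ N)
    (hN : (besovNorm w).toReal ≤ N) (hsmall : 8 * bilinConst * N ≤ 1) :
    ∃ u : ℝ → L43, MeasurableInTime u ∧ (∀ t, 0 < t → ‖u t‖ ≤ 2 * N * t ^ (-(1 / 4) : ℝ)) ∧
      ∀ t, 0 < t → u t = heatCurve hw t + nonlinear u t := by
  have hb := norm_picard_le hw hN0 hN hsmall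
  have hm := measurableInTime_picard hw
  have hd : ∀ t, 0 < t → ∀ n, dist (picard hw n t) (picard hw (n + 1) t) ≤
      4 * N * t ^ (-(1 / 4) : ℝ) * (1 / 2) ^ n := fun t ht n => by
    rw [dist_comm, dist_eq_norm]
    exact (norm_picard_succ_sub_le hw hN0 hN hsmall n t ht).trans_eq (by ring)
  -- Limits are taken at each positive time separately, by completeness of `L^{4/3}`; values at
  -- other times are irrelevant. The geometric rate carries the weight `t^{-1/4}`, which later lets
  -- the nonlinear term pass to the limit.
  have hex : ∀ t, ∃ l, 0 < t → Tendsto (fun n => picard hw n t) atTop (𝓝 l) := fun t => by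
    by_cases ht : 0 < t
    · obtain ⟨l, hl⟩ := cauchySeq_tendsto_of_complete
        (cauchySeq_of_le_geometric (1 / 2) _ (by norm_num) (hd t ht))
      exact ⟨l, fun _ => hl⟩
    · exact ⟨0, fun h => absurd h ht⟩
  choose u hu using hex
  have hum : MeasurableInTime u := by
    refine aestronglyMeasurable_of_tendsto_ae atTop hm ?_
    filter_upwards [ae_restrict_mem measurableSet_Ioi] with t ht using hu t ht
  have hub : ∀ t, 0 < t → ‖u t‖ ≤ 2 * N * t ^ (-(1 / 4) : ℝ) := fun t ht =>
    le_of_tendsto (hu t ht).norm (.of_forall fun n => hb n t ht)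
  have hun : ∀ n t, 0 < t → ‖picard hw n t - u t‖ ≤
      8 * N * (1 / 2) ^ n * t ^ (-(1 / 4) : ℝ) := fun n t ht => by
    have h := dist_le_of_le_geometric_of_tendsto (1 / 2) _ (by norm_num) (hd t ht) (hu t ht) n
    rw [dist_eq_norm] at h
    refine h.trans_eq ?_
    ring
  refine ⟨u, hum, hub, fun t ht => ?_⟩
  have hl : Tendsto (fun n => nonlinear (picard hw n) t) atTop (𝓝 (nonlinear u t)) := by
    rw [tendsto_iff_norm_sub_tendsto_zero]
    refine squeeze_zero (g := fun n => bilinConst * (2 * (2 * N)) * (8 * N * (1 / 2) ^ n) *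
      t ^ (-(1 / 4) : ℝ)) (fun _ => norm_nonneg _) (fun n => ?_) ?_
    · exact norm_nonlinear_sub_le (hm n) hum (by positivity) (by positivity) (hb n) hub (hun n) ht
    · have h2 := tendsto_pow_atTop_nhds_zero_of_lt_one (r := (1 / 2 : ℝ)) (by norm_num)
        (by norm_num)
      simpa using (((h2.const_mul (8 * N)).const_mul
        (bilinConst * (2 * (2 * N)))).mul_const (t ^ (-(1 / 4) : ℝ)))
  exact tendsto_nhds_unique ((tendsto_add_atTop_iff_nat 1).2 (hu t ht)) (hl.const_add _)

/-- Each use of the Lipschitz estimate halves the bound on the difference in the weighted norm, so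
iterating sends it to zero. -/
theorem fixedPoint_unique {w : Distr} (hw : besovNorm w < ∞) {a : ℝ} (ha : 0 ≤ a)
    (hsmall : 4 * bilinConst * a ≤ 1) {u v : ℝ → L43}
    (hum : MeasurableInTime u) (hvm : MeasurableInTime v)
    (hub : ∀ t, 0 < t → ‖u t‖ ≤ a * t ^ (-(1 / 4) : ℝ))
    (hvb : ∀ t, 0 < t → ‖v t‖ ≤ a * t ^ (-(1 / 4) : ℝ))
    (hu : ∀ t, 0 < t → u t = heatCurve hw t + nonlinear u t)
    (hv : ∀ t, 0 < t → v t = heatCurve hw t + nonlinear v t) {t : ℝ} (ht : 0 < t) :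
    v t = u t := by
  have key : ∀ (n : ℕ) t, 0 < t → ‖v t - u t‖ ≤ 2 * a * (1 / 2) ^ n * t ^ (-(1 / 4) : ℝ) := by
    intro n
    induction n with
    | zero =>
      intro t ht
      refine (norm_sub_le _ _).trans ((add_le_add (hvb t ht) (hub t ht)).trans_eq ?_)
      ring
    | succ n ih =>
      intro t ht
      rw [hu t ht, hv t ht, add_sub_add_left_eq_sub]
      refine (norm_nonlinear_sub_le hvm hum ha (by positivity) hvb hub ih ht).trans ?_
      gcongr ?_ * _
      calc bilinConst * (2 * a) * (2 * a * (1 / 2) ^ n)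
          = (4 * bilinConst * a) * (a * (1 / 2) ^ n) := by ring
        _ ≤ 1 * (a * (1 / 2) ^ n) := by gcongr
        _ = _ := by rw [pow_succ]; ring
  have h2 := tendsto_pow_atTop_nhds_zero_of_lt_one (r := (1 / 2 : ℝ)) (by norm_num) (by norm_num)
  have h3 := ((h2.const_mul (2 * a)).mul_const (t ^ (-(1 / 4) : ℝ)))
  rw [mul_zero, zero_mul] at h3
  have h4 := ge_of_tendsto h3 (.of_forall fun n => key n t ht)
  exact sub_eq_zero.1 (norm_le_zero_iff.1 h4)

theorem exists_unique_mildSolution {ε : ℝ} (hε : 0 < ε) (hsmall : 8 * bilinConst * ε ≤ 1)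
    {w : Distr} (hw : besovNorm w < ENNReal.ofReal ε) :
    ∃ u : ℝ → L43,
      MemSolutionSpace w u ∧ IsMildSolution w u ∧ weightedSup u < ENNReal.ofReal (2 * ε) ∧
      ∀ v : ℝ → L43, MeasurableInTime v → IsMildSolution w v →
        weightedSup v < ENNReal.ofReal (2 * ε) → ∀ t : ℝ, 0 < t → v t = u t := by
  have hwt : besovNorm w < ∞ := hw.trans ENNReal.ofReal_lt_top
  have hNε : (besovNorm w).toReal < ε := (ENNReal.lt_ofReal_iff_toReal_lt hwt.ne).1 hw
  have hN0 : 0 ≤ (besovNorm w).toReal := ENNReal.toReal_nonneg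
  have hsm : 8 * bilinConst * (besovNorm w).toReal ≤ 1 :=
    (mul_le_mul_of_nonneg_left hNε.le (by have := bilinConst_nonneg; positivity)).trans hsmall
  -- Taking `N` to be the norm of `w` itself, and not `ε`, gives the strict inequality `2N < 2ε`
  -- required below.
  obtain ⟨u, hum, hub, hu⟩ := exists_fixedPoint hwt hN0 le_rfl hsm
  have hsup : weightedSup u < ENNReal.ofReal (2 * ε) :=
    ((weightedSup_le_iff (by positivity)).2 hub).trans_lt
      ((ENNReal.ofReal_lt_ofReal_iff (by positivity)).2 (by linarith))
  have hub2 := (weightedSup_le_iff (by positivity)).1 hsup.le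
  refine ⟨u, ?_, (isMildSolution_iff hwt hum (by positivity) hub).2 hu, hsup,
    fun v hvm hv hvs t ht => ?_⟩
  · exact memSolutionSpace_of_eq hwt (aestronglyMeasurable_flux hum)
      (fun τ hτ => norm_flux_le_of_le hτ (by positivity) (hub τ hτ) (hub τ hτ))
      (mul_nonneg hlsConst_nonneg (by positivity)) hu (hsup.trans ENNReal.ofReal_lt_top)
  · have hvb := (weightedSup_le_iff (by positivity)).1 hvs.le
    -- With radius `2ε` the condition `4Ka ≤ 1` is precisely `8Kε ≤ 1`.
    exact fixedPoint_unique hwt (a := 2 * ε) (by positivity) (by linarith) hum hvm hub2 hvb hu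
      ((isMildSolution_iff hwt hvm (by positivity) hvb).1 hv) ht

end FixedPoint

/-! ### Atomic measures -/

section Atomic

variable (M : ℕ → ℝ) (x : ℕ → Plane) (hM : Summable fun i => |M i|)

theorem heat_atomic {t : ℝ} (ht : 0 < t) (z : Plane) :
    heat t ht (atomic M x hM) z = ∑' i, M i * gaussKernel t (z - x i) := by
  change ∑' i, M i * heatTest t ht z (x i) = _
  simp only [heatTest_apply]

theorem besovNorm_atomic_le :
    besovNorm (atomic M x hM) ≤ ENNReal.ofReal (gaussConst * ∑' i, |M i|) := by
  refine besovNorm_le_iff.2 fun t ht => ?_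
  -- The measure `∑|Mᵢ|δ_{xᵢ}` dominates the atomic measure; the points may repeat, and only its
  -- total mass matters.
  let ν : Measure Plane := Measure.sum fun i => ENNReal.ofReal |M i| • Measure.dirac (x i)
  have h1 : ν Set.univ = ENNReal.ofReal (∑' i, |M i|) := by
    rw [ENNReal.ofReal_tsum_of_nonneg (fun i => abs_nonneg _) hM,
      Measure.sum_apply _ MeasurableSet.univ]
    simp
  have hk : Measurable fun z => ‖gaussKernel t z‖ₑ := (continuous_gaussKernel t).measurable.enorm
  have h2 := eLpNorm_lintegral_sub_le (p := 4 / 3) Fact.out four_thirds_ne_top hk ν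
  have h3 : eLpNorm (heat t ht (atomic M x hM)) (4 / 3) volume ≤
      eLpNorm (fun z => ∫⁻ y, ‖gaussKernel t (z - y)‖ₑ ∂ν) (4 / 3) volume := by
    refine eLpNorm_mono_enorm fun z => ?_
    rw [enorm_eq_self, heat_atomic, lintegral_sum_measure]
    refine enorm_tsum_le_tsum_enorm.trans (le_of_eq (tsum_congr fun i => ?_))
    rw [lintegral_smul_measure, lintegral_dirac, enorm_mul, Real.enorm_eq_ofReal_abs (M i),
      smul_eq_mul]
  refine (h3.trans h2).trans_eq ?_
  rw [eLpNorm_enorm, eLpNorm_gaussKernel ht, h1, ENNReal.ofReal_mul gaussConst_pos.le,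
    ENNReal.ofReal_mul gaussConst_pos.le, neg_div]
  ring

/-- The dilation contributes `R^{-3/2}` to the `L^{4/3}` norm, and `R² · R^{-3/2} = (R²)^{1/4}`.
This is the weight of the Besov norm at time `R²`. -/
theorem eLpNorm_comp_add_smul (a : Plane) {R : ℝ} (hR : 0 < R) {h : Plane → ℝ}
    (hh : Continuous h) :
    ENNReal.ofReal (R ^ 2) * eLpNorm (fun y => h (a + R • y)) (4 / 3) volume =
      ENNReal.ofReal ((R ^ 2) ^ (1 / 4 : ℝ)) * eLpNorm h (4 / 3) volume := by
  have hmap : Measure.map (fun y : Plane => a + R • y) volume =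
      ENNReal.ofReal ((R ^ 2)⁻¹) • volume := by
    have e := Measure.map_map (μ := (volume : Measure Plane)) (measurable_const_add a)
      (measurable_const_smul R)
    rw [show (fun y : Plane => a + R • y) = (fun y => a + y) ∘ (fun y => R • y) from rfl, ← e,
      Measure.map_addHaar_smul _ hR.ne', Measure.map_smul, map_add_left_eq_self,
      finrank_euclideanSpace_fin, abs_of_pos (by positivity)]
  have e2 := eLpNorm_map_measure (p := 4 / 3) (μ := (volume : Measure Plane))
    (f := fun y : Plane => a + R • y) (g := h) hh.aestronglyMeasurable
    (by fun_prop : Measurable fun y : Plane => a + R • y).aemeasurable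
  rw [hmap, eLpNorm_smul_measure_of_ne_top four_thirds_ne_top, smul_eq_mul] at e2
  change _ = eLpNorm (fun y => h (a + R • y)) (4 / 3) volume at e2
  rw [← e2, ← mul_assoc]
  congr 1
  rw [one_div, ENNReal.toReal_inv, toReal_four_thirds, ENNReal.ofReal_rpow_of_pos (by positivity),
    ← ENNReal.ofReal_mul (by positivity)]
  congr 1
  rw [← Real.rpow_natCast, ← Real.rpow_neg hR.le, ← Real.rpow_mul hR.le, ← Real.rpow_mul hR.le,
    ← Real.rpow_add hR]
  norm_num

/-- The scale invariance of the Besov norm: zooming in at a point by the factor `R` is paid for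
exactly by the weight at time `t = R²`. -/
theorem eLpNorm_rescaled_heat_le (w : Distr) (a : Plane) {R : ℝ} (hR : 0 < R) :
    eLpNorm (fun y => R ^ 2 * heat (R ^ 2) (by positivity) w (a + R • y)) (4 / 3) volume ≤
      besovNorm w := by
  have h := eLpNorm_const_smul (R ^ 2) (fun y => heat (R ^ 2) (by positivity) w (a + R • y))
    (4 / 3) (volume : Measure Plane)
  have h2 : (fun y => R ^ 2 * heat (R ^ 2) (by positivity) w (a + R • y)) =
      R ^ 2 • (fun y => heat (R ^ 2) (by positivity) w (a + R • y)) := rfl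
  rw [h2, h, Real.enorm_of_nonneg (by positivity),
    eLpNorm_comp_add_smul a hR (continuous_heat w _)]
  exact le_iSup₂_of_le (R ^ 2) (by positivity) le_rfl

theorem mul_gaussKernel_sq {R : ℝ} (hR : 0 < R) (z : Plane) :
    R ^ 2 * gaussKernel (R ^ 2) z = gaussKernel 1 (R⁻¹ • z) := by
  have h := gaussKernel_sqrt_smul (t := R ^ 2) (by positivity) (R⁻¹ • z)
  rwa [Real.sqrt_sq hR.le, smul_inv_smul₀ hR.ne'] at h

theorem tendsto_gaussKernel_cocompact : Tendsto (gaussKernel 1) (cocompact Plane) (𝓝 0) := by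
  have h := (heatTest 1 one_pos 0).tendsto_cocompact
  refine h.congr fun y => ?_
  rw [heatTest_apply, zero_sub, gaussKernel_neg]

theorem tendsto_gaussKernel_add_smul (y : Plane) {d : Plane} (hd : d ≠ 0) :
    Tendsto (fun n : ℕ => gaussKernel 1 (y + ((n : ℝ) + 1) • d)) atTop (𝓝 0) := by
  refine tendsto_gaussKernel_cocompact.comp ?_
  rw [← Metric.cobounded_eq_cocompact, ← tendsto_norm_atTop_iff_cobounded]
  have h1 : Tendsto (fun n : ℕ => ((n : ℝ) + 1) * ‖d‖ - ‖y‖) atTop atTop := by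
    refine tendsto_atTop_add_const_right _ _ (Tendsto.atTop_mul_const (norm_pos_iff.2 hd) ?_)
    exact tendsto_atTop_add_const_right _ _ tendsto_natCast_atTop_atTop
  refine tendsto_atTop_mono (fun n => ?_) h1
  have h2 := norm_sub_norm_le (((n : ℝ) + 1) • d) (-y)
  rwa [norm_smul, Real.norm_of_nonneg (by positivity), norm_neg, sub_neg_eq_add, add_comm _ y]
    at h2

/-- After rescaling, the atom `j` contributes `M_j G(y + (n+1)(xᵢ - x_j), 1)`. For `j = i` this is
constant in `n`; the other atoms escape to infinity since the points are distinct. The sum is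
dominated by `∑|M_j|/(4π)`. -/
theorem tendsto_rescaled_heat_atomic (hx : Function.Injective x) (i : ℕ) (y : Plane) :
    Tendsto (fun n : ℕ => (((n : ℝ) + 1)⁻¹) ^ 2 *
      heat ((((n : ℝ) + 1)⁻¹) ^ 2) (by positivity) (atomic M x hM)
        (x i + ((n : ℝ) + 1)⁻¹ • y)) atTop (𝓝 (M i * gaussKernel 1 y)) := by
  have e : ∀ n : ℕ, (((n : ℝ) + 1)⁻¹) ^ 2 *
      heat ((((n : ℝ) + 1)⁻¹) ^ 2) (by positivity) (atomic M x hM) (x i + ((n : ℝ) + 1)⁻¹ • y) =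
      ∑' j, M j * gaussKernel 1 (y + ((n : ℝ) + 1) • (x i - x j)) := fun n => by
    have hn : (0 : ℝ) < (n : ℝ) + 1 := by positivity
    rw [heat_atomic, ← tsum_mul_left]
    refine tsum_congr fun j => ?_
    rw [mul_left_comm, mul_gaussKernel_sq (inv_pos.2 hn), inv_inv,
      show x i + ((n : ℝ) + 1)⁻¹ • y - x j = ((n : ℝ) + 1)⁻¹ • y + (x i - x j) by abel, smul_add,
      smul_inv_smul₀ hn.ne']
  simp_rw [e]
  have hlim : M i * gaussKernel 1 y =
      ∑' j, M j * if j = i then gaussKernel 1 y else 0 := by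
    rw [tsum_eq_single i fun j hj => by rw [if_neg hj, mul_zero], if_pos rfl]
  rw [hlim]
  refine tendsto_tsum_of_dominated_convergence (hM.mul_right (1 / (4 * Real.pi * 1)))
    (fun j => Tendsto.const_mul _ ?_) (.of_forall fun n j => ?_)
  · split_ifs with hj
    · subst hj
      simp
    · exact tendsto_gaussKernel_add_smul y (sub_ne_zero.2 fun h => hj (hx h).symm)
  · rw [norm_mul, Real.norm_eq_abs, Real.norm_of_nonneg (gaussKernel_nonneg one_pos _)]
    gcongr
    exact gaussKernel_le_of_le one_pos _

/-- Each atom is controlled by the norm of the measure. -/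
theorem ofReal_mul_abs_le_besovNorm_atomic (hx : Function.Injective x) (i : ℕ) :
    ENNReal.ofReal (gaussConst * |M i|) ≤ besovNorm (atomic M x hM) := by
  have hcont : ∀ n : ℕ, Continuous fun y => (((n : ℝ) + 1)⁻¹) ^ 2 *
      heat ((((n : ℝ) + 1)⁻¹) ^ 2) (by positivity) (atomic M x hM)
        (x i + ((n : ℝ) + 1)⁻¹ • y) := fun n =>
    continuous_const.mul ((continuous_heat _ _).comp
      (continuous_const.add (continuous_const_smul _)))
  -- Fatou's lemma: pointwise convergence of the rescaled functions and the uniform bound of their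
  -- norms suffice.
  have h := Lp.eLpNorm_lim_le_liminf_eLpNorm (p := 4 / 3) (μ := (volume : Measure Plane))
    (fun n => (hcont n).aestronglyMeasurable) (fun y => M i * gaussKernel 1 y)
    (.of_forall fun y => tendsto_rescaled_heat_atomic M x hM hx i y)
  have e : eLpNorm (fun y => M i * gaussKernel 1 y) (4 / 3) (volume : Measure Plane) =
      ENNReal.ofReal (gaussConst * |M i|) := by
    rw [show (fun y => M i * gaussKernel 1 y) = M i • gaussKernel 1 from rfl, eLpNorm_const_smul,
      eLpNorm_gaussKernel one_pos, Real.one_rpow, mul_one, Real.enorm_eq_ofReal_abs,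
      ← ENNReal.ofReal_mul (abs_nonneg _), mul_comm]
  rw [← e]
  refine h.trans (liminf_le_of_le (by isBoundedDefault) fun b hb => ?_)
  obtain ⟨n, hn⟩ := hb.exists
  exact hn.trans (eLpNorm_rescaled_heat_le _ _ (by positivity))

end Atomic

end DebyeNernstPlanck

end

/-! ### The choice of the thresholds -/

open DebyeNernstPlanck in
theorem mainTheorem2 :
    ∃ ε : ℝ, 0 < ε ∧
      (∀ u₀ : Distr, besovNorm u₀ < ENNReal.ofReal ε →
        ∃ u : ℝ → L43,
          MemSolutionSpace u₀ u ∧ IsMildSolution u₀ u ∧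
          weightedSup u < ENNReal.ofReal (2 * ε) ∧
          ∀ v : ℝ → L43, MeasurableInTime v → IsMildSolution u₀ v →
            weightedSup v < ENNReal.ofReal (2 * ε) →
            ∀ t : ℝ, 0 < t → v t = u t) ∧
      ∃ η : ℝ, 0 < η ∧
        ∀ (M : ℕ → ℝ) (x : ℕ → Plane) (hM : Summable fun i => |M i|),
          (∑' i, |M i| < η → besovNorm (atomic M x hM) < ENNReal.ofReal ε) ∧
          (Function.Injective x → besovNorm (atomic M x hM) < ENNReal.ofReal ε →
            ∀ i, |M i| < η) := by
  have hC := bilinConst_nonneg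
  have hG := gaussConst_pos
  have hε : 0 < 1 / (8 * (bilinConst + 1)) := by positivity
  -- The summand one keeps the denominator positive when `bilinConst` is zero. The second threshold
  -- is `ε / gaussConst`, as both bounds for atomic measures have the constant `gaussConst`.
  refine ⟨1 / (8 * (bilinConst + 1)), hε, fun u₀ hu₀ => ?_,
    1 / (8 * (bilinConst + 1)) / gaussConst, by positivity, fun M x hM => ⟨fun h => ?_,
      fun hx h i => ?_⟩⟩
  · refine exists_unique_mildSolution hε ?_ hu₀
    rw [mul_one_div, div_le_one (by positivity)]
    linarith
  · refine (besovNorm_atomic_le M x hM).trans_lt ((ENNReal.ofReal_lt_ofReal_iff hε).2 ?_)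
    rwa [lt_div_iff₀' hG] at h
  · rw [lt_div_iff₀' hG]
    exact (ENNReal.ofReal_lt_ofReal_iff hε).1
      ((ofReal_mul_abs_le_besovNorm_atomic M x hM hx i).trans_lt h)
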